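/- **Conventions.** For $p$-forms on a Euclidean space, $\langle a,b\rangle=\frac1{p!}\sum a(e_{i_1},\dots,e_{i_p})\,b(e_{i_1},\dots,e_{i_p})$ over an orthonormal basis; wedge products satisfy $(e_1\wedge\dots\wedge e_p)(e_1,\dots,e_p)=1$; $\lrcorner$ is the interior product and $d^*\alpha=-\sum_i e_i\lrcorner\nabla_{e_i}\alpha$ the coderivative. Given an almost complex structure $I$, for a one-form $\mu$ and a bilinear form $b$ put $(I\mu)(x)=-\mu(Ix)$ and $(I_{(2)}b)(x,y)=-b(x,Iy)$. **$G_2$-structure.** Let $\overline M$ be a smooth Riemannian 7-manifold, with Levi-Civita connection $\overline\nabla$, and let $\varphi$ be a smooth three-form such that every tangent space has an orthonormal basis $e_0,\dots,e_6$ (a Cayley frame) with $\varphi=\sum_{i\in\mathbb Z_7}e_i\wedge e_{i+1}\wedge e_{i+3}$. Let $P$ be defined by $\langle P(x,y),z\rangle=\varphi(x,y,z)$, let $*$ be the Hodge star of the volume form $e_0\wedge\dots\wedge e_6$ (which does not depend on the Cayley frame), and put $$\overline r(\varphi)(x,y)=\tfrac14\langle\overline\nabla_x\varphi,\;y\lrcorner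 *\varphi\rangle,\qquad p\,d^*\varphi=*(*d\varphi\wedge\varphi).$$ **Hypersurface.** Let $M$ be a smooth Riemannian 6-manifold with Levi-Civita connection $\nabla$, let $\iota:M\to\overline M$ be a smooth isometric immersion, $n$ a smooth unit normal vector field along $\iota$, and $\theta$ a smooth function on $M$. Let $B(x,y)=\langle II(x,y),n\rangle$, where $II(x,y)$ is the component of $\overline\nabla_x(\iota_*y)$ normal to $M$, and $h=\langle H,n\rangle$, where $H=\frac16\operatorname{Tr}II$ is the mean curvature vector. **$SU(3)$-structure.** On $M$ consider the $SU(3)$-structure with $Ix=P(n,x)$ and complex volume form $\Psi=\psi_++i\psi_-$, $$\psi_+=\cos\theta\,\iota^*\varphi-\sin\theta\,\iota^*(n\lrcorner *\varphi),\qquad \psi_-=\sin\theta\,\iota^*\varphi+\cos\theta\,\iota^*(n\lrcorner *\varphi).$$ Let $\omega(x,y)=\langle x,Iy\rangle$, $r(\omega)(x,y)=\frac12\langle\nabla_x\omega,\;y\lrcorner\psi_+\rangle$, $\operatorname{Tr}(b)=\sum_i b(e_i,e_i)$ and $c_\omega(b)=\sum_{i,j}\omega(e_i,e_j)\,b(e_i,e_j)$,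 over an orthonormal basis of the tangent space of $M$. **Proposition.** At each point of $M$, for all tangent vectors of $M$ at that point: $$\begin{aligned} r(\omega)&=\cos\theta\,\bigl(-I_{(2)}\iota^*\overline r(\varphi)+B\bigr)-\sin\theta\,\bigl(\iota^*\overline r(\varphi)+I_{(2)}B\bigr),\\ 2\,I d^*\omega&=\iota^*p\,d^*\varphi-2\,\overline r(\varphi)(n,\iota_*I\,\cdot)+2\,\overline r(\varphi)(\iota_*I\,\cdot,n),\\ p\,d^*\varphi(n)&=-2\cos\theta\,\operatorname{Tr}(r(\omega))-2\sin\theta\,c_\omega(r(\omega))+12\,h,\\ \operatorname{Tr}(\iota^*\overline r(\varphi))&=-\sin\theta\,\operatorname{Tr}(r(\omega))+\cos\theta\,c_\omega(r(\omega)). \end{aligned}$$ Moreover there is exactly one one-form $\eta$ such that $\nabla+\eta+\xi$ is an $SU(3)$-connection, that is, such that $\omega$, $\psi_+$ and $\psi_-$ are parallel for it, where $\xi_xy=-\frac12I(\nabla_xI)y$ and $\eta_xy=(I\eta)(x)\,Iy$ (this is the $W_5$-part of the intrinsic torsion), and it satisfies $$3\,I\eta=d\theta-\overline r(\varphi)(\iota_*\,\cdot,n).$$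 -/

import Mathlib

open Manifold Bundle Module
open scoped ContDiff RealInnerProductSpace

noncomputable section

namespace G2Hypersurface

/-! ### Linear algebra on a finite-dimensional Euclidean space

Covariant `k`-tensors are functions of `k` vectors. All sums below run over an orthonormal basis,
and do not depend on the basis for multilinear arguments. -/

section Euclidean

variable {V : Type*} [NormedAddCommGroup V] [InnerProductSpace ℝ V] [FiniteDimensional ℝ V]

/-- An orthonormal basis of `V`. -/
abbrev onb (V : Type*) [NormedAddCommGroup V] [InnerProductSpace ℝ V] [FiniteDimensional ℝ V] :
    OrthonormalBasis (Fin (finrank ℝ V)) ℝ V := stdOrthonormalBasis ℝ V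

/-- The vector `v` representing a linear functional `f`: `⟪v, w⟫ = f w` for all `w`. -/
def sharp (f : V → ℝ) : V := ∑ i, f (onb V i) • onb V i

/-- The scalar product of `p`-forms, `(1/p!) ∑ a(e_{i₁}, …, e_{i_p}) b(e_{i₁}, …, e_{i_p})`. -/
def formInner {p : ℕ} (a b : (Fin p → V) → ℝ) : ℝ :=
  (1 / (p.factorial : ℝ)) *
    ∑ f : Fin p → Fin (finrank ℝ V), a (fun i => onb V (f i)) * b (fun i => onb V (f i))

/-- The metric trace of a bilinear form. -/
def bilinTrace (b : V → V → ℝ) : ℝ := ∑ i, b (onb V i) (onb V i)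

/-- The contraction of a bilinear form `b` by a two-form `τ`, `∑ τ(e_i, e_j) b(e_i, e_j)`. -/
def bilinContract (τ : (Fin 2 → V) → ℝ) (b : V → V → ℝ) : ℝ :=
  ∑ i, ∑ j, τ ![onb V i, onb V j] * b (onb V i) (onb V j)

/-- The interior product `x ⌟ a`. -/
def interior {p : ℕ} (x : V) (a : (Fin (p + 1) → V) → ℝ) : (Fin p → V) → ℝ :=
  fun w => a (Fin.cons x w)

/-- The wedge product of a `p`-form and a `q`-form, normalised so that
`(e₁ ∧ ⋯ ∧ e_n)(e₁, …, e_n) = 1` for dual bases. -/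
def wedge {p q : ℕ} (a : (Fin p → V) → ℝ) (b : (Fin q → V) → ℝ) : (Fin (p + q) → V) → ℝ :=
  fun v => (1 / ((p.factorial : ℝ) * (q.factorial : ℝ))) *
    ∑ σ : Equiv.Perm (Fin (p + q)), ((Equiv.Perm.sign σ : ℤ) : ℝ) *
      (a (fun i => v (σ (Fin.castAdd q i))) * b (fun j => v (σ (Fin.natAdd p j))))

/-- The Hodge star of a `p`-form with respect to the volume form `vol`, normalised so that
`a ∧ ∗b = ⟨a, b⟩ vol`. -/
def hodge {p q : ℕ} (vol : (Fin (p + q) → V) → ℝ) (a : (Fin p → V) → ℝ) : (Fin q → V) → ℝ :=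
  fun v => (1 / (p.factorial : ℝ)) * ∑ f : Fin p → Fin (finrank ℝ V),
    a (fun i => onb V (f i)) * vol (Fin.append (fun i => onb V (f i)) v)

/-- `e` is a Cayley frame for `φ`: it is orthonormal and `φ = ∑ e_i ∧ e_{i+1} ∧ e_{i+3}`, with
indices modulo `7`. The summand is the determinant of the matrix `e_k(v_l)`. -/
def IsCayleyFrame (φ : (Fin 3 → V) → ℝ) (e : OrthonormalBasis (Fin 7) ℝ V) : Prop :=
  ∀ v : Fin 3 → V,
    φ v = ∑ i : Fin 7, (Matrix.of fun k l : Fin 3 => ⟪e ((![i, i + 1, i + 3] : Fin 3 → Fin 7) k), v l⟫).det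

open Classical in
/-- The volume form `Vol = e₀ ∧ ⋯ ∧ e₆` of a Cayley frame. Two Cayley frames differ by an element
of `G₂ ⊆ SO(7)`, so it does not depend on the frame. -/
def cayleyVol (φ : (Fin 3 → V) → ℝ) : (Fin 7 → V) → ℝ :=
  if h : ∃ e : OrthonormalBasis (Fin 7) ℝ V, IsCayleyFrame φ e then
    fun v => h.choose.toBasis.det v
  else 0

/-- The four-form `∗φ`. -/
def starForm (φ : (Fin 3 → V) → ℝ) : (Fin 4 → V) → ℝ :=
  hodge (p := 3) (q := 4) (cayleyVol φ) φ

/-- The vector cross product `P`, `⟪P(x, y), z⟫ = φ(x, y, z)`. -/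
def cross (φ : (Fin 3 → V) → ℝ) (x y : V) : V := sharp fun z => φ ![x, y, z]

/-- `I_(2) b (x, y) = - b(x, J y)`. -/
def twist₂ (J : V → V) (b : V → V → ℝ) : V → V → ℝ := fun x y => -b x (J y)

/-- `J μ (x) = - μ(J x)` for a one-form `μ`. -/
def twist₁ (J : V → V) (μ : V → ℝ) : V → ℝ := fun x => -μ (J x)

end Euclidean

/-! ### Riemannian manifolds

`FiberBundle.extend (𝔼 d) v` is the vector field extending `v ∈ T_pM` whose components in the
preferred chart at `p` are constant, i.e. a coordinate vector field near `p`. -/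

/-- The model space `ℝᵈ`. -/
abbrev 𝔼 (d : ℕ) : Type := EuclideanSpace ℝ (Fin d)

section Riemannian

variable {d : ℕ} {M : Type*} [TopologicalSpace M] [ChartedSpace (𝔼 d) M]

instance (x : M) : FiniteDimensional ℝ (TangentSpace (𝓡 d) x) :=
  inferInstanceAs (FiniteDimensional ℝ (𝔼 d))

variable [IsManifold (𝓡 d) ∞ M]

/-- Covariant `k`-tensor fields. -/
abbrev CovTensor (d : ℕ) (M : Type*) [TopologicalSpace M] [ChartedSpace (𝔼 d) M] (k : ℕ) :=
  ∀ x : M, (Fin k → TangentSpace (𝓡 d) x) → ℝ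

/-- The component of `α` on the coordinate vector fields (of the chart at `p`) extending `w`. -/
def component {k : ℕ} (α : CovTensor d M k) (p : M) (w : Fin k → TangentSpace (𝓡 d) p) (q : M) :
    ℝ :=
  α q fun i => FiberBundle.extend (𝔼 d) (w i) q

/-- The exterior derivative
`(dα)_p(v₀, …, v_k) = ∑ (-1)^i ∂_{v_i} (α(V₀, …, V̂_i, …, V_k))`, for coordinate fields `V_i`. -/
def extDer {k : ℕ} (α : CovTensor d M k) : CovTensor d M (k + 1) := fun p v =>
  ∑ i : Fin (k + 1), (-1 : ℝ) ^ (i : ℕ) *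
    mvfderiv (𝓡 d) (component α p fun j => v (i.succAbove j)) p (v i)

/-- Smoothness of a covariant tensor field: its components in charts are smooth. -/
def IsSmoothTensor {k : ℕ} (α : CovTensor d M k) : Prop :=
  ∀ (p : M) (w : Fin k → TangentSpace (𝓡 d) p),
    ContMDiffAt (𝓡 d) 𝓘(ℝ, ℝ) ∞ (component α p w) p

variable [RiemannianBundle (fun x : M => TangentSpace (𝓡 d) x)]

/-- The metric as a covariant tensor field. -/
def metricTensor (d : ℕ) (M : Type*) [TopologicalSpace M] [ChartedSpace (𝔼 d) M]
    [RiemannianBundle (fun x : M => TangentSpace (𝓡 d) x)] : CovTensor d M 2 :=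
  fun _ w => ⟪w 0, w 1⟫

/-- The Levi-Civita derivative `∇_u V` at `p` of the coordinate vector field `V` extending `v`,
by the Koszul formula `2⟨∇_U V, W⟩ = U⟨V, W⟩ + V⟨U, W⟩ - W⟨U, V⟩` for coordinate fields. In other
words, this is the Christoffel symbol `Γ(u, v)` in the chart at `p`. -/
def christoffel (p : M) (u v : TangentSpace (𝓡 d) p) : TangentSpace (𝓡 d) p :=
  sharp fun w => (1 / 2 : ℝ) *
    (mvfderiv (𝓡 d) (component (metricTensor d M) p ![v, w]) p u
      + mvfderiv (𝓡 d) (component (metricTensor d M) p ![u, w]) p v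
      - mvfderiv (𝓡 d) (component (metricTensor d M) p ![u, v]) p w)

/-- The Levi-Civita covariant derivative of a covariant tensor field,
`(∇_u α)(w₁, …, w_k) = u(α(W₁, …, W_k)) - ∑ α(W₁, …, ∇_u W_i, …, W_k)`. -/
def nabla {k : ℕ} (α : CovTensor d M k) (p : M) (u : TangentSpace (𝓡 d) p) :
    (Fin k → TangentSpace (𝓡 d) p) → ℝ := fun w =>
  mvfderiv (𝓡 d) (component α p w) p u
    - ∑ i, α p (Function.update w i (christoffel p u (w i)))

/-- The coderivative of a two-form, `d*α = - ∑ e_i ⌟ ∇_{e_i} α`. -/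
def coderiv₂ (α : CovTensor d M 2) (p : M) (x : TangentSpace (𝓡 d) p) : ℝ :=
  -∑ i, nabla α p (onb (TangentSpace (𝓡 d) p) i) ![onb (TangentSpace (𝓡 d) p) i, x]

variable {d' : ℕ} {N : Type*} [TopologicalSpace N] [ChartedSpace (𝔼 d') N]
  [IsManifold (𝓡 d') ∞ N] [RiemannianBundle (fun x : N => TangentSpace (𝓡 d') x)]

/-- The Levi-Civita derivative along a map `f : M → N` of a vector field `X` of `N` along `f`:
differentiate the components of `X` in the chart at `f p`, then add the Christoffel term. -/
def nablaAlong (f : M → N) (X : ∀ q, TangentSpace (𝓡 d') (f q)) (p : M)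
    (u : TangentSpace (𝓡 d) p) : TangentSpace (𝓡 d') (f p) :=
  (trivializationAt (𝔼 d') (TangentSpace (𝓡 d') : N → Type) (f p)).symm (f p)
      (mvfderiv (𝓡 d) (fun q =>
        (trivializationAt (𝔼 d') (TangentSpace (𝓡 d') : N → Type) (f p) ⟨f q, X q⟩).2) p u)
    + christoffel (f p) (mfderiv (𝓡 d) (𝓡 d') f p u) (X p)

/-- The covariant derivative of a field of endomorphisms, `(∇_u J) v = ∇_u (J V) - J (∇_u V)`. -/
def nablaEnd (J : ∀ x : M, TangentSpace (𝓡 d) x → TangentSpace (𝓡 d) x) (p : M)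
    (u v : TangentSpace (𝓡 d) p) : TangentSpace (𝓡 d) p :=
  nablaAlong (fun q : M => q) (fun q => J q (FiberBundle.extend (𝔼 d) v q)) p u
    - J p (christoffel p u v)

/-- The second fundamental form of an immersion: `II(u, v)` is the normal component of the
ambient Levi-Civita derivative of `ι_* V` in the direction `u`, where `V` extends `v`. -/
def secondFund (ι : M → N) (p : M) (u v : TangentSpace (𝓡 d) p) : TangentSpace (𝓡 d') (ι p) :=
  (LinearMap.range
      (mfderiv (𝓡 d) (𝓡 d') ι p : TangentSpace (𝓡 d) p →ₗ[ℝ] TangentSpace (𝓡 d') (ι p)))ᗮ.starProjection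
    (nablaAlong ι (fun q => mfderiv (𝓡 d) (𝓡 d') ι q (FiberBundle.extend (𝔼 d) v q)) p u)

/-- The mean curvature vector `H = (1/d) Tr II`. -/
def meanCurvature (ι : M → N) (p : M) : TangentSpace (𝓡 d') (ι p) :=
  (1 / (d : ℝ)) • ∑ i, secondFund ι p (onb (TangentSpace (𝓡 d) p) i) (onb (TangentSpace (𝓡 d) p) i)

end Riemannian

/-! ### `SU(3)`-structures on six-manifolds -/

section SU3

variable {M : Type*} [TopologicalSpace M] [ChartedSpace (𝔼 6) M] [IsManifold (𝓡 6) ∞ M]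
  [RiemannianBundle (fun x : M => TangentSpace (𝓡 6) x)]

/-- The Kähler form `ω(x, y) = ⟨x, J y⟩`. -/
def kahler (J : ∀ x : M, TangentSpace (𝓡 6) x → TangentSpace (𝓡 6) x) : CovTensor 6 M 2 :=
  fun x w => ⟪w 0, J x (w 1)⟫

/-- `r(κ)(x, y) = r(∇κ)(x, y) = ½ ⟨∇_x κ, y ⌟ ψ₊⟩`, to be used for the Kähler form `κ`. -/
def rSU3 (κ : CovTensor 6 M 2) (ψp : CovTensor 6 M 3) (p : M) (x y : TangentSpace (𝓡 6) p) : ℝ :=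
  (1 / 2 : ℝ) * formInner (nabla κ p x) (interior y (ψp p))

/-- The tensor `η_x y + ξ_x y`, where `η_x y = (Jη)(x) J y` is determined by the one-form `η`
and `ξ_x y = - ½ J (∇_x J) y`. -/
def torsionSU3 (J : ∀ x : M, TangentSpace (𝓡 6) x → TangentSpace (𝓡 6) x) {p : M}
    (η : TangentSpace (𝓡 6) p →ₗ[ℝ] ℝ) (x y : TangentSpace (𝓡 6) p) : TangentSpace (𝓡 6) p :=
  twist₁ (J p) η x • J p y + (-(1 / 2 : ℝ)) • J p (nablaEnd J p x y)

/-- The tensor field `α` is parallel at `p` for the connection `∇ + T`. -/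
def IsParallelAt {k : ℕ} (α : CovTensor 6 M k) (p : M)
    (T : TangentSpace (𝓡 6) p → TangentSpace (𝓡 6) p → TangentSpace (𝓡 6) p) : Prop :=
  ∀ (x : TangentSpace (𝓡 6) p) (w : Fin k → TangentSpace (𝓡 6) p),
    nabla α p x w - ∑ i, α p (Function.update w i (T x (w i))) = 0

/-- The one-form `η` is the `W₅`-part of the intrinsic torsion at `p`: the connection
`∇ + η + ξ` is an `SU(3)`-connection, i.e. `ω`, `ψ₊` and `ψ₋` are parallel for it. -/
def IsW5Torsion (J : ∀ x : M, TangentSpace (𝓡 6) x → TangentSpace (𝓡 6) x)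
    (ψp ψm : CovTensor 6 M 3) (p : M) (η : TangentSpace (𝓡 6) p →ₗ[ℝ] ℝ) : Prop :=
  IsParallelAt (kahler J) p (torsionSU3 J η) ∧
    IsParallelAt ψp p (torsionSU3 J η) ∧ IsParallelAt ψm p (torsionSU3 J η)

end SU3

/-! ### `G₂`-structures on seven-manifolds -/

section G2

variable {N : Type*} [TopologicalSpace N] [ChartedSpace (𝔼 7) N] [IsManifold (𝓡 7) ∞ N]
  [RiemannianBundle (fun x : N => TangentSpace (𝓡 7) x)]

/-- A `G₂`-structure on a Riemannian seven-manifold: a smooth three-form which has a Cayley frame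
at each point. -/
structure IsG2Structure (φ : ∀ x : N, (TangentSpace (𝓡 7) x) [⋀^Fin 3]→ₗ[ℝ] ℝ) : Prop where
  smooth : IsSmoothTensor (fun x => ⇑(φ x))
  cayley : ∀ x : N, ∃ e : OrthonormalBasis (Fin 7) ℝ (TangentSpace (𝓡 7) x),
    IsCayleyFrame (φ x) e

/-- `r̄(φ)(x, y) = ¼ ⟨∇_x φ, y ⌟ ∗φ⟩`. -/
def rG2 (φ : CovTensor 7 N 3) (p : N) (x y : TangentSpace (𝓡 7) p) : ℝ :=
  (1 / 4 : ℝ) * formInner (nabla φ p x) (interior y (starForm (φ p)))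

/-- The one-form `p d*φ = ∗(∗dφ ∧ φ)`. -/
def pdStar (φ : CovTensor 7 N 3) (p : N) (x : TangentSpace (𝓡 7) p) : ℝ :=
  hodge (p := 6) (q := 1) (cayleyVol (φ p))
    (wedge (p := 3) (q := 3) (hodge (p := 4) (q := 3) (cayleyVol (φ p)) (extDer φ p)) (φ p)) ![x]

end G2

/-! ### The induced structure on a hypersurface -/

section Hypersurface

variable {N : Type*} [TopologicalSpace N] [ChartedSpace (𝔼 7) N] [IsManifold (𝓡 7) ∞ N]
  [RiemannianBundle (fun x : N => TangentSpace (𝓡 7) x)]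
  {M : Type*} [TopologicalSpace M] [ChartedSpace (𝔼 6) M] [IsManifold (𝓡 6) ∞ M]
  [RiemannianBundle (fun x : M => TangentSpace (𝓡 6) x)]

/-- The differential `ι_*` at `x`. -/
abbrev push (ι : M → N) (x : M) : TangentSpace (𝓡 6) x →L[ℝ] TangentSpace (𝓡 7) (ι x) :=
  mfderiv (𝓡 6) (𝓡 7) ι x

/-- A Riemannian hypersurface with a unit normal field: `ι` is a smooth isometric immersion and
`n` is a smooth unit vector field along `ι` orthogonal to `M`. -/
structure IsHypersurface (ι : M → N) (n : ∀ x : M, TangentSpace (𝓡 7) (ι x)) : Prop where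
  smooth : ContMDiff (𝓡 6) (𝓡 7) ∞ ι
  isometric : ∀ (x : M) (v w : TangentSpace (𝓡 6) x), ⟪push ι x v, push ι x w⟫ = ⟪v, w⟫
  smooth_normal : ContMDiff (𝓡 6) (𝓡 7).tangent ∞
    fun x => (⟨ι x, n x⟩ : TangentBundle (𝓡 7) N)
  unit : ∀ x, ‖n x‖ = 1
  normal : ∀ (x : M) (v : TangentSpace (𝓡 6) x), ⟪n x, push ι x v⟫ = 0

variable (φ : CovTensor 7 N 3) (ι : M → N) (n : ∀ x : M, TangentSpace (𝓡 7) (ι x)) (θ : M → ℝ)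

/-- The almost complex structure `I x = P(n, x)`: the tangent vector `I x` is characterised by
`⟨I x, w⟩ = ⟨P(n, ι_* x), ι_* w⟩`. As `P(n, ι_* x)` is orthogonal to `n`, this means that
`ι_* (I x) = P(n, ι_* x)`. -/
def inducedI (x : M) (v : TangentSpace (𝓡 6) x) : TangentSpace (𝓡 6) x :=
  sharp fun w => ⟪cross (φ (ι x)) (n x) (push ι x v), push ι x w⟫

/-- `ι^*φ`. -/
def pullForm : CovTensor 6 M 3 := fun x w => φ (ι x) fun i => push ι x (w i)

/-- `ι^*(n ⌟ ∗φ)`. -/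
def pullStar : CovTensor 6 M 3 :=
  fun x w => interior (n x) (starForm (φ (ι x))) fun i => push ι x (w i)

/-- `ψ₊ = cos θ ι^*φ - sin θ ι^*(n ⌟ ∗φ)`. -/
def psiPlus : CovTensor 6 M 3 := fun x w =>
  Real.cos (θ x) * pullForm φ ι x w - Real.sin (θ x) * pullStar φ ι n x w

/-- `ψ₋ = sin θ ι^*φ + cos θ ι^*(n ⌟ ∗φ)`. -/
def psiMinus : CovTensor 6 M 3 := fun x w =>
  Real.sin (θ x) * pullForm φ ι x w + Real.cos (θ x) * pullStar φ ι n x w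

/-- `B(x, y) = ⟨II(x, y), n⟩`. -/
def scalarSecondFund (x : M) (v w : TangentSpace (𝓡 6) x) : ℝ := ⟪secondFund ι x v w, n x⟫

/-- `h = ⟨H, n⟩`. -/
def scalarMeanCurvature (x : M) : ℝ := ⟪meanCurvature (d := 6) ι x, n x⟫

/-- `ι^* r̄(φ)`. -/
def pullR (x : M) (v w : TangentSpace (𝓡 6) x) : ℝ := rG2 φ (ι x) (push ι x v) (push ι x w)

end Hypersurface

end G2Hypersurface

end

open G2Hypersurface

/-! The derivative of φ has few degrees of freedom. For all vector fields φ(X, Y, P(X, Y)) = |P(X,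
Y)|² = |X|²|Y|² - ⟨X, Y⟩², and differentiating this gives (∇̄_u φ)(x, y, P(x, y)) = 0
(`nabla_cross_eq_zero`). Polarised over a Cayley frame, the condition cuts the 35-dimensional space
of three-forms down to the 7-dimensional space of the forms v ⌟ ∗φ (`eq_starC_of_cross`). Hence ∇̄_u
φ = ∑ r̄(φ)(u, e_j) e_j ⌟ ∗φ (`nabla_eq_starC`): r̄(φ) knows the whole derivative of φ, and with it
p d*φ (`pdStar_eq`).

On the hypersurface every tensor is built from φ, n and push-forwards: ω(v, w) = φ(n, w, v) and
ι^*(n ⌟ ∗φ) = -ι^*φ(I·, ·, ·). The Leibniz rule along ι (`mvfderiv_tensor_along`) with the Gauss and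
Weingarten formulas then expresses ∇ω and ∇ι^*φ by r̄(φ) and B (`IsHypersurface.nabla_kahler`,
`IsHypersurface.nabla_pullAlt`). The unit normal extends to a Cayley frame with e_0 = n
(`exists_cayleyFrame`), in which the formulas for r(ω) and I d*ω are polynomial identities in the
entries of r̄(φ) and B (`model_rSU3`, `model_coderiv`). The two trace formulas follow from the one
for r(ω): the pair (Tr r(ω), c_ω(r(ω))) is the rotation by θ of the pair (6h - ½ p d*φ(n), Tr
ι^*r̄(φ)), and the rotation is inverted (`IsAdapted.traces`).

For the torsion, ω is parallel for ∇ + η + ξ whatever η is, while ι^*φ and ι^*(n ⌟ ∗φ) are rotated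
into each other with speed r̄(φ)(ι_*u, n) + 3(Iη)(u) (`IsAdapted.nabla_pullAlt_sub`,
`IsAdapted.nabla_pullStar_sub`). The phase of Ψ turns with speed dθ, so ψ₊ and ψ₋ are parallel
exactly when the two speeds agree (`IsAdapted.isW5Torsion_iff`). This is a linear equation for η
with one solution, because I is invertible. -/

set_option linter.unusedSectionVars false

namespace G2Hypersurface

open scoped Topology

/-! ### Coordinate frames -/

section Frame

variable {d : ℕ} {N : Type*} [TopologicalSpace N] [ChartedSpace (𝔼 d) N] [IsManifold (𝓡 d) ∞ N]

/-- The components of a tangent vector at `q` in the preferred chart at `p`. -/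
noncomputable def coord (p q : N) (v : TangentSpace (𝓡 d) q) : 𝔼 d :=
  (trivializationAt (𝔼 d) (TangentSpace (𝓡 d) : N → Type) p ⟨q, v⟩).2

/-- The coordinate vectors at `p`. -/
noncomputable def coordVec (p : N) (j : Fin d) : TangentSpace (𝓡 d) p :=
  (trivializationAt (𝔼 d) (TangentSpace (𝓡 d) : N → Type) p).symm p (EuclideanSpace.single j 1)

theorem symm_eq_symmL (p q : N)
    (hq : q ∈ (trivializationAt (𝔼 d) (TangentSpace (𝓡 d) : N → Type) p).baseSet) (y : 𝔼 d) :
    (trivializationAt (𝔼 d) (TangentSpace (𝓡 d) : N → Type) p).symm q y =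
      (trivializationAt (𝔼 d) (TangentSpace (𝓡 d) : N → Type) p).symmL ℝ q y :=
  (Trivialization.symmL_apply _ hq y).symm

theorem coord_eq_linearMapAt (p q : N)
    (hq : q ∈ (trivializationAt (𝔼 d) (TangentSpace (𝓡 d) : N → Type) p).baseSet)
    (v : TangentSpace (𝓡 d) q) :
    coord p q v =
      (trivializationAt (𝔼 d) (TangentSpace (𝓡 d) : N → Type) p).continuousLinearMapAt ℝ q v := by
  rw [Trivialization.continuousLinearMapAt_apply_of_mem _ _ hq]; rfl

/-- `FiberBundle.extend` as a linear map. -/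
noncomputable def extendL (p q : N) : TangentSpace (𝓡 d) p →L[ℝ] TangentSpace (𝓡 d) q :=
  (trivializationAt (𝔼 d) (TangentSpace (𝓡 d) : N → Type) p).symmL ℝ q ∘L
    (trivializationAt (𝔼 d) (TangentSpace (𝓡 d) : N → Type) p).continuousLinearMapAt ℝ p

/-- Shows the coordinate extension as a linear function of the vector; the multilinearity of
components, of Christoffel symbols and of ∇α comes from here. -/
theorem extend_eq (p q : N)
    (hq : q ∈ (trivializationAt (𝔼 d) (TangentSpace (𝓡 d) : N → Type) p).baseSet)
    (v : TangentSpace (𝓡 d) p) :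
    FiberBundle.extend (𝔼 d) v q = extendL p q v := by
  rw [extendL, ContinuousLinearMap.comp_apply,
    ← coord_eq_linearMapAt p p (FiberBundle.mem_baseSet_trivializationAt' p)]
  exact symm_eq_symmL p q hq _

theorem symm_eq_sum (p q : N)
    (hq : q ∈ (trivializationAt (𝔼 d) (TangentSpace (𝓡 d) : N → Type) p).baseSet) (y : 𝔼 d) :
    (trivializationAt (𝔼 d) (TangentSpace (𝓡 d) : N → Type) p).symm q y =
      ∑ j, y j • FiberBundle.extend (𝔼 d) (coordVec p j) q := by
  have h0 := FiberBundle.mem_baseSet_trivializationAt' (F := 𝔼 d)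
    (E := (TangentSpace (𝓡 d) : N → Type)) p
  have h1 : ∀ j, FiberBundle.extend (𝔼 d) (coordVec p j) q =
      (trivializationAt (𝔼 d) (TangentSpace (𝓡 d) : N → Type) p).symmL ℝ q
        (EuclideanSpace.single j 1) := by
    intro j
    rw [extend_eq p q hq, extendL, ContinuousLinearMap.comp_apply, coordVec,
      symm_eq_symmL p p h0, Trivialization.continuousLinearMapAt_symmL _ h0]
  simp_rw [h1, symm_eq_symmL p q hq]
  rw [← Finset.sum_congr rfl (fun j _ => map_smul _ (y j) _), ← map_sum]
  congr 1
  ext j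
  simp [Pi.single_apply]

theorem eq_sum_coord (p q : N)
    (hq : q ∈ (trivializationAt (𝔼 d) (TangentSpace (𝓡 d) : N → Type) p).baseSet)
    (v : TangentSpace (𝓡 d) q) :
    v = ∑ j, coord p q v j • FiberBundle.extend (𝔼 d) (coordVec p j) q := by
  rw [← symm_eq_sum p q hq]
  exact (Trivialization.symm_apply_apply_mk _ hq v).symm

theorem coord_extend (p q : N)
    (hq : q ∈ (trivializationAt (𝔼 d) (TangentSpace (𝓡 d) : N → Type) p).baseSet)
    (v : TangentSpace (𝓡 d) p) : coord p q (FiberBundle.extend (𝔼 d) v q) = coord p p v := by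
  rw [coord_eq_linearMapAt p q hq, extend_eq p q hq, extendL,
    ContinuousLinearMap.comp_apply, Trivialization.continuousLinearMapAt_symmL _ hq,
    coord_eq_linearMapAt p p (FiberBundle.mem_baseSet_trivializationAt' p)]

theorem baseSet_mem_nhds (p : N) :
    (trivializationAt (𝔼 d) (TangentSpace (𝓡 d) : N → Type) p).baseSet ∈ 𝓝 p :=
  (Trivialization.open_baseSet _).mem_nhds (FiberBundle.mem_baseSet_trivializationAt' p)

end Frame

/-! ### Differentiating sums and products -/

section Deriv

variable {d : ℕ} {M : Type*} [TopologicalSpace M] [ChartedSpace (𝔼 d) M]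
variable {ι : Type*}

/-- Differentiability and derivative are proved together, since the induction step for the
derivative needs the differentiability of the partial sum. -/
theorem mvfderiv_finset_sum (s : Finset ι) {g : ι → M → ℝ} {p : M}
    (hg : ∀ i ∈ s, MDifferentiableAt (𝓡 d) 𝓘(ℝ, ℝ) (g i) p) (u : TangentSpace (𝓡 d) p) :
    MDifferentiableAt (𝓡 d) 𝓘(ℝ, ℝ) (fun q => ∑ i ∈ s, g i q) p ∧
    mvfderiv (𝓡 d) (fun q => ∑ i ∈ s, g i q) p u = ∑ i ∈ s, mvfderiv (𝓡 d) (g i) p u := by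
  classical
  induction s using Finset.induction_on with
  | empty => simpa [mvfderiv_const] using mdifferentiableAt_const
  | insert a s ha ih =>
    obtain ⟨h1, h2⟩ := ih fun i hi => hg i (Finset.mem_insert_of_mem hi)
    simp_rw [Finset.sum_insert ha]
    refine ⟨(hg a (Finset.mem_insert_self a s)).add h1, ?_⟩
    rw [mvfderiv_fun_add (hg a (Finset.mem_insert_self a s)) h1, ← h2]
    rfl

theorem mvfderiv_finset_prod [DecidableEq ι] (s : Finset ι) {g : ι → M → ℝ} {p : M}
    (hg : ∀ i ∈ s, MDifferentiableAt (𝓡 d) 𝓘(ℝ, ℝ) (g i) p) (u : TangentSpace (𝓡 d) p) :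
    MDifferentiableAt (𝓡 d) 𝓘(ℝ, ℝ) (fun q => ∏ i ∈ s, g i q) p ∧
    mvfderiv (𝓡 d) (fun q => ∏ i ∈ s, g i q) p u =
      ∑ i ∈ s, mvfderiv (𝓡 d) (g i) p u * ∏ j ∈ s.erase i, g j p := by
  induction s using Finset.induction_on with
  | empty => simpa [mvfderiv_const] using mdifferentiableAt_const
  | insert a s ha ih =>
    obtain ⟨h1, h2⟩ := ih fun i hi => hg i (Finset.mem_insert_of_mem hi)
    have ha' := hg a (Finset.mem_insert_self a s)
    simp_rw [Finset.prod_insert ha, Finset.sum_insert ha]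
    refine ⟨ha'.mul h1, ?_⟩
    rw [mvfderiv_fun_mul ha' h1, Finset.erase_insert ha]
    simp only [add_apply, smul_apply, smul_eq_mul, h2,
      Finset.mul_sum]
    rw [add_comm, mul_comm]
    congr 1
    refine Finset.sum_congr rfl fun i hi => ?_
    have hne : a ≠ i := fun h => ha (h ▸ hi)
    rw [Finset.erase_insert_of_ne hne, Finset.prod_insert (by simp [ha])]
    ring

end Deriv

/-! ### The Leibniz rule for tensors along a map. -/

section Leibniz

variable {d' : ℕ} {N : Type*} [TopologicalSpace N] [ChartedSpace (𝔼 d') N]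
  [IsManifold (𝓡 d') ∞ N]

/-- Separates the two sources of variation, the coefficients of the vector fields and the components
of the tensor on a fixed coordinate frame, so that the product rule can be applied. -/
theorem map_eq_sum_component {k : ℕ} (α : ∀ y : N, MultilinearMap ℝ
      (fun _ : Fin k => TangentSpace (𝓡 d') y) ℝ) (y z : N) (X : Fin k → TangentSpace (𝓡 d') z)
    (c : Fin k → Fin d' → ℝ)
    (hX : ∀ i, X i = ∑ j, c i j • FiberBundle.extend (𝔼 d') (coordVec y j) z) :
    α z X = ∑ J : Fin k → Fin d', (∏ i, c i (J i)) *
      component (fun y => ⇑(α y)) y (fun i => coordVec y (J i)) z := by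
  rw [funext hX, MultilinearMap.map_sum]
  refine Finset.sum_congr rfl fun J _ => ?_
  rw [MultilinearMap.map_smul_univ, smul_eq_mul]
  rfl

theorem component_eq_sum {k : ℕ} (α : ∀ y : N, MultilinearMap ℝ
      (fun _ : Fin k => TangentSpace (𝓡 d') y) ℝ) (y z : N)
    (hz : z ∈ (trivializationAt (𝔼 d') (TangentSpace (𝓡 d') : N → Type) y).baseSet)
    (w : Fin k → TangentSpace (𝓡 d') y) :
    component (fun y => ⇑(α y)) y w z = ∑ J : Fin k → Fin d', (∏ i, coord y y (w i) (J i)) *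
      component (fun y => ⇑(α y)) y (fun i => coordVec y (J i)) z := by
  refine map_eq_sum_component α y z _ _ fun i => ?_
  rw [← coord_extend y z hz (w i)]
  exact eq_sum_coord y z hz _

variable [RiemannianBundle (fun x : N => TangentSpace (𝓡 d') x)]
  {d : ℕ} {M : Type*} [TopologicalSpace M] [ChartedSpace (𝔼 d) M] [IsManifold (𝓡 d) ∞ M]

variable (d) in
/-- The vector field `X` along `f` is differentiable at `p`, as tested in the chart at `f p`. -/
def DiffAlong (f : M → N) (X : ∀ q, TangentSpace (𝓡 d') (f q)) (p : M) : Prop :=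
  MDifferentiableAt (𝓡 d) 𝓘(ℝ, 𝔼 d') (fun q => coord (f p) (f q) (X q)) p

theorem DiffAlong.coord_apply {f : M → N} {X : ∀ q, TangentSpace (𝓡 d') (f q)} {p : M}
    (h : DiffAlong d f X p) (j : Fin d') (u : TangentSpace (𝓡 d) p) :
    MDifferentiableAt (𝓡 d) 𝓘(ℝ, ℝ) (fun q => coord (f p) (f q) (X q) j) p ∧
      mvfderiv (𝓡 d) (fun q => coord (f p) (f q) (X q) j) p u =
        mvfderiv (𝓡 d) (fun q => coord (f p) (f q) (X q)) p u j := by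
  have hl : MDifferentiableAt 𝓘(ℝ, 𝔼 d') 𝓘(ℝ, ℝ) (EuclideanSpace.proj (𝕜 := ℝ) j)
      (coord (f p) (f p) (X p)) :=
    (EuclideanSpace.proj (𝕜 := ℝ) j : 𝔼 d' →L[ℝ] ℝ).mdifferentiableAt
  refine ⟨hl.comp p h, ?_⟩
  have := mfderiv_comp_apply p hl h u
  rw [ContinuousLinearMap.mfderiv_eq] at this
  exact this

/-- The Leibniz rule for the pull-back of a covariant tensor along a map. -/
theorem mvfderiv_tensor_along {k : ℕ} (α : ∀ y : N, MultilinearMap ℝ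
      (fun _ : Fin k => TangentSpace (𝓡 d') y) ℝ) (f : M → N) (p : M)
    (hf : MDifferentiableAt (𝓡 d) (𝓡 d') f p)
    (hα : ∀ w, MDifferentiableAt (𝓡 d') 𝓘(ℝ, ℝ) (component (fun y => ⇑(α y)) (f p) w) (f p))
    (X : Fin k → ∀ q, TangentSpace (𝓡 d') (f q)) (hX : ∀ i, DiffAlong d f (X i) p)
    (u : TangentSpace (𝓡 d) p) :
    MDifferentiableAt (𝓡 d) 𝓘(ℝ, ℝ) (fun q => α (f q) fun i => X i q) p ∧
    mvfderiv (𝓡 d) (fun q => α (f q) fun i => X i q) p u =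
      nabla (fun y => ⇑(α y)) (f p) (mfderiv (𝓡 d) (𝓡 d') f p u) (fun i => X i p) +
        ∑ i, α (f p) (Function.update (fun i => X i p) i (nablaAlong f (X i) p u)) := by
  classical
  have h0 := FiberBundle.mem_baseSet_trivializationAt' (F := 𝔼 d')
    (E := (TangentSpace (𝓡 d') : N → Type)) (f p)
  set x : Fin k → Fin d' → M → ℝ := fun i j q => coord (f p) (f q) (X i q) j with hx
  set c : (Fin k → Fin d') → N → ℝ :=
    fun J => component (fun y => ⇑(α y)) (f p) (fun i => coordVec (f p) (J i)) with hc
  set v : TangentSpace (𝓡 d') (f p) := mfderiv (𝓡 d) (𝓡 d') f p u with hv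
  have hxd : ∀ i j, MDifferentiableAt (𝓡 d) 𝓘(ℝ, ℝ) (x i j) p := fun i j =>
    ((hX i).coord_apply j u).1
  have hcd : ∀ J, MDifferentiableAt (𝓡 d) 𝓘(ℝ, ℝ) (fun q => c J (f q)) p := fun J =>
    MDifferentiableAt.comp p (hα _) hf
  have hcv : ∀ J, mvfderiv (𝓡 d) (fun q => c J (f q)) p u = mvfderiv (𝓡 d') (c J) (f p) v :=
    fun J => mvfderiv_comp_apply p (hα _) hf u
  -- Near `p` the function is a polynomial in the real functions `x i j` and `c J ∘ f`.
  have hev : (fun q => α (f q) fun i => X i q) =ᶠ[𝓝 p]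
      fun q => ∑ J : Fin k → Fin d', (∏ i, x i (J i) q) * c J (f q) := by
    filter_upwards [hf.continuousAt.preimage_mem_nhds (baseSet_mem_nhds (d := d') (f p))] with q hq
    refine map_eq_sum_component α (f p) (f q) _ (fun i j => x i j q)
      fun i => ?_
    exact eq_sum_coord (f p) (f q) hq (X i q)
  have hprod := fun J : Fin k → Fin d' =>
    mvfderiv_finset_prod Finset.univ (g := fun i => x i (J i)) (fun i _ => hxd i (J i)) u
  have hsum := mvfderiv_finset_sum Finset.univ
    (g := fun (J : Fin k → Fin d') q => (∏ i, x i (J i) q) * c J (f q))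
    (fun J _ => (hprod J).1.mul (hcd J)) u
  refine ⟨hsum.1.congr_of_eventuallyEq hev, ?_⟩
  -- The coordinate fields extending `X i p` have constant coefficients, so only the functions `c J`
  -- are differentiated here.
  have hcomp : mvfderiv (𝓡 d') (component (fun y => ⇑(α y)) (f p) (fun i => X i p)) (f p) v =
      ∑ J, (∏ i, x i (J i) p) * mvfderiv (𝓡 d') (c J) (f p) v := by
    have hev' : component (fun y => ⇑(α y)) (f p) (fun i => X i p) =ᶠ[𝓝 (f p)]
        fun z => ∑ J : Fin k → Fin d', (∏ i, x i (J i) p) * c J z := by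
      filter_upwards [baseSet_mem_nhds (d := d') (f p)] with z hz
      exact component_eq_sum α (f p) z hz _
    have h1 : mvfderiv (𝓡 d') (component (fun y => ⇑(α y)) (f p) (fun i => X i p)) (f p) =
        mvfderiv (𝓡 d') (fun z => ∑ J : Fin k → Fin d', (∏ i, x i (J i) p) * c J z) (f p) := by
      have := hev'.mfderiv_eq (I := 𝓡 d') (I' := 𝓘(ℝ, ℝ))
      exact this
    rw [h1, (mvfderiv_finset_sum Finset.univ
      (g := fun (J : Fin k → Fin d') z => (∏ i, x i (J i) p) * c J z)
      (fun J _ => mdifferentiableAt_const.mul (hα _)) v).2]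
    refine Finset.sum_congr rfl fun J _ => ?_
    rw [mvfderiv_fun_mul mdifferentiableAt_const (hα _)]
    simp only [mvfderiv_const, smul_zero, add_zero, smul_apply, smul_eq_mul]
    rfl
  -- The derivative of `X i` along the map splits into the derivative of its coordinates and a
  -- Christoffel term; the latter cancels against the correction terms of `nabla`.
  have hterm : ∀ i, α (f p) (Function.update (fun i => X i p) i (nablaAlong f (X i) p u)) =
      (∑ J, c J (f p) * (mvfderiv (𝓡 d) (x i (J i)) p u * ∏ j ∈ Finset.univ.erase i, x j (J j) p)) +
      α (f p) (Function.update (fun i => X i p) i (christoffel (f p) v (X i p))) := by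
    intro i
    rw [nablaAlong, MultilinearMap.map_update_add]
    congr 1
    rw [map_eq_sum_component α (f p) (f p) _ (fun j l =>
      if j = i then mvfderiv (𝓡 d) (x i l) p u else x j l p)]
    · refine Finset.sum_congr rfl fun J _ => ?_
      rw [mul_comm]
      congr 1
      rw [← Finset.mul_prod_erase _ _ (Finset.mem_univ i), if_pos rfl]
      congr 1
      exact Finset.prod_congr rfl fun j hj => if_neg (Finset.ne_of_mem_erase hj)
    · intro j
      by_cases hj : j = i
      · subst hj
        simp only [Function.update_self, if_true]
        rw [symm_eq_sum (f p) (f p) h0]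
        refine Finset.sum_congr rfl fun l _ => ?_
        rw [((hX j).coord_apply l u).2]
        rfl
      · simp only [Function.update_of_ne hj, if_neg hj]
        exact eq_sum_coord (f p) (f p) h0 _
  have h1 : mvfderiv (𝓡 d) (fun q => α (f q) fun i => X i q) p =
      mvfderiv (𝓡 d) (fun q => ∑ J : Fin k → Fin d', (∏ i, x i (J i) q) * c J (f q)) p := by
    have := hev.mfderiv_eq (I := 𝓡 d) (I' := 𝓘(ℝ, ℝ))
    have hp := hev.eq_of_nhds
    unfold mvfderiv
    rw [this]
    rfl
  rw [h1, hsum.2, nabla, hcomp]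
  simp_rw [hterm]
  rw [Finset.sum_add_distrib, Finset.sum_comm]
  have : ∀ J : Fin k → Fin d',
      mvfderiv (𝓡 d) (fun q => (∏ i, x i (J i) q) * c J (f q)) p u =
      (∏ i, x i (J i) p) * mvfderiv (𝓡 d') (c J) (f p) v + ∑ i, c J (f p) *
        (mvfderiv (𝓡 d) (x i (J i)) p u * ∏ j ∈ Finset.univ.erase i, x j (J j) p) := by
    intro J
    rw [mvfderiv_fun_mul (hprod J).1 (hcd J)]
    simp only [add_apply, smul_apply, smul_eq_mul, (hprod J).2, hcv, Finset.mul_sum]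
  simp_rw [this, Finset.sum_add_distrib]
  ring

end Leibniz

section Sharp

variable {V : Type*} [NormedAddCommGroup V] [InnerProductSpace ℝ V] [FiniteDimensional ℝ V]

theorem inner_sharp (f : V →ₗ[ℝ] ℝ) (w : V) : ⟪sharp f, w⟫ = f w := by
  conv_rhs => rw [← (onb V).sum_repr' w]
  simp [sharp, sum_inner, real_inner_smul_left, mul_comm]

end Sharp

/-! ### Multilinearity of the components of a tensor and of their derivatives. -/

section Tensor

variable {d : ℕ} {N : Type*} [TopologicalSpace N] [ChartedSpace (𝔼 d) N]
  [IsManifold (𝓡 d) ∞ N]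

/-- Linearity of the extension is taken from `extend_eq`, hence over the base set; an equality of
germs at `p` is all that differentiation needs. -/
theorem component_update_add {k : ℕ} (α : ∀ y : N, MultilinearMap ℝ
      (fun _ : Fin k => TangentSpace (𝓡 d) y) ℝ) (p : N) (w : Fin k → TangentSpace (𝓡 d) p)
    (i : Fin k) (a b : TangentSpace (𝓡 d) p) :
    component (fun y => ⇑(α y)) p (Function.update w i (a + b)) =ᶠ[𝓝 p]
      fun q => component (fun y => ⇑(α y)) p (Function.update w i a) q +
        component (fun y => ⇑(α y)) p (Function.update w i b) q := by
  filter_upwards [baseSet_mem_nhds (d := d) p] with q hq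
  have h : ∀ c, (fun j => FiberBundle.extend (𝔼 d) (Function.update w i c j) q) =
      Function.update (fun j => extendL p q (w j)) i (extendL p q c) := by
    intro c; ext1 j
    rw [extend_eq p q hq]
    exact Function.apply_update (fun _ => extendL p q) w i c j
  simp only [component, h, map_add, MultilinearMap.map_update_add]

theorem component_update_smul {k : ℕ} (α : ∀ y : N, MultilinearMap ℝ
      (fun _ : Fin k => TangentSpace (𝓡 d) y) ℝ) (p : N) (w : Fin k → TangentSpace (𝓡 d) p)
    (i : Fin k) (c : ℝ) (a : TangentSpace (𝓡 d) p) :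
    component (fun y => ⇑(α y)) p (Function.update w i (c • a)) =ᶠ[𝓝 p]
      fun q => c * component (fun y => ⇑(α y)) p (Function.update w i a) q := by
  filter_upwards [baseSet_mem_nhds (d := d) p] with q hq
  have h : ∀ c, (fun j => FiberBundle.extend (𝔼 d) (Function.update w i c j) q) =
      Function.update (fun j => extendL p q (w j)) i (extendL p q c) := by
    intro c; ext1 j
    rw [extend_eq p q hq]
    exact Function.apply_update (fun _ => extendL p q) w i c j
  simp only [component, h, map_smul, MultilinearMap.map_update_smul, smul_eq_mul]

theorem mvfderiv_congr {g g' : N → ℝ} {p : N} (h : g =ᶠ[𝓝 p] g') (u : TangentSpace (𝓡 d) p) :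
    mvfderiv (𝓡 d) g p u = mvfderiv (𝓡 d) g' p u := by
  have := h.mfderiv_eq (I := 𝓡 d) (I' := 𝓘(ℝ, ℝ))
  unfold mvfderiv
  rw [this]
  rfl

/-- The differential of the components of a covariant tensor field. -/
noncomputable def componentDeriv {k : ℕ} (α : ∀ y : N, MultilinearMap ℝ
      (fun _ : Fin k => TangentSpace (𝓡 d) y) ℝ) (p : N)
    (hα : ∀ w, MDifferentiableAt (𝓡 d) 𝓘(ℝ, ℝ) (component (fun y => ⇑(α y)) p w) p)
    (u : TangentSpace (𝓡 d) p) :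
    MultilinearMap ℝ (fun _ : Fin k => TangentSpace (𝓡 d) p) ℝ where
  toFun w := mvfderiv (𝓡 d) (component (fun y => ⇑(α y)) p w) p u
  map_update_add' {hdec} w i a b := by
    rw [Subsingleton.elim hdec (instDecidableEqFin k),
      mvfderiv_congr (component_update_add α p w i a b), mvfderiv_fun_add (hα _) (hα _)]
    rfl
  map_update_smul' {hdec} w i c a := by
    rw [Subsingleton.elim hdec (instDecidableEqFin k),
      mvfderiv_congr (component_update_smul α p w i c a),
      mvfderiv_fun_mul mdifferentiableAt_const (hα _)]
    simp only [mvfderiv_const, smul_zero, add_zero, smul_apply, smul_eq_mul]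

end Tensor

/-! ### The Levi-Civita connection: symmetry, linearity and compatibility with the metric. -/

section Metric

variable {d : ℕ} {N : Type*} [TopologicalSpace N] [ChartedSpace (𝔼 d) N]
  [IsManifold (𝓡 d) ∞ N] [RiemannianBundle (fun x : N => TangentSpace (𝓡 d) x)]

/-- The metric as a multilinear map. -/
noncomputable def metricMap (y : N) :
    MultilinearMap ℝ (fun _ : Fin 2 => TangentSpace (𝓡 d) y) ℝ where
  toFun w := ⟪w 0, w 1⟫
  map_update_add' {hdec} w i a b := by
    rw [Subsingleton.elim hdec (instDecidableEqFin 2)]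
    fin_cases i <;> simp [inner_add_left, inner_add_right]
  map_update_smul' {hdec} w i c a := by
    rw [Subsingleton.elim hdec (instDecidableEqFin 2)]
    fin_cases i <;> simp [real_inner_smul_left, real_inner_smul_right]

variable [IsContMDiffRiemannianBundle (𝓡 d) ∞ (𝔼 d) (fun x : N => TangentSpace (𝓡 d) x)]

theorem mdifferentiableAt_metric (p : N) (w : Fin 2 → TangentSpace (𝓡 d) p) :
    MDifferentiableAt (𝓡 d) 𝓘(ℝ, ℝ) (component (metricTensor d N) p w) p :=
  haveI : IsContMDiffRiemannianBundle (𝓡 d) 1 (𝔼 d) (fun x : N => TangentSpace (𝓡 d) x) :=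
    IsContMDiffRiemannianBundle.of_le (n := ∞) (by simp)
  MDifferentiableAt.inner_bundle (F := 𝔼 d) (E := fun x : N => TangentSpace (𝓡 d) x)
    (IB := 𝓡 d) (b := fun q => q)
    (v := fun q => FiberBundle.extend (𝔼 d) (w 0) q)
    (w := fun q => FiberBundle.extend (𝔼 d) (w 1) q)
    (FiberBundle.mdifferentiableAt_extend (𝓡 d) (𝔼 d) (w 0))
    (FiberBundle.mdifferentiableAt_extend (𝓡 d) (𝔼 d) (w 1))

theorem component_metric_comm (p : N) (v w : TangentSpace (𝓡 d) p) :
    component (metricTensor d N) p ![v, w] = component (metricTensor d N) p ![w, v] := by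
  ext q
  simp only [component, metricTensor]
  exact real_inner_comm _ _

theorem christoffel_comm (p : N) (u v : TangentSpace (𝓡 d) p) :
    christoffel p u v = christoffel p v u := by
  unfold christoffel
  congr 1
  ext w
  rw [component_metric_comm p u v]
  ring

/-- `sharp` represents a functional only if it is linear, so the content is the linearity in `w` of
the Koszul expression: the first two terms are linear by `componentDeriv`, the third is a
differential. -/
theorem inner_christoffel (p : N) (u v w : TangentSpace (𝓡 d) p) :
    ⟪christoffel p u v, w⟫ = (1 / 2 : ℝ) *
    (mvfderiv (𝓡 d) (component (metricTensor d N) p ![v, w]) p u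
      + mvfderiv (𝓡 d) (component (metricTensor d N) p ![u, w]) p v
      - mvfderiv (𝓡 d) (component (metricTensor d N) p ![u, v]) p w) := by
  have hu : ∀ a b : TangentSpace (𝓡 d) p, ∀ c, Function.update ![a, b] 1 c = ![a, c] := by
    intro a b c; ext i; fin_cases i <;> simp
  have hl : ∀ a b : TangentSpace (𝓡 d) p, ∃ f : TangentSpace (𝓡 d) p →ₗ[ℝ] ℝ, ∀ w,
      mvfderiv (𝓡 d) (component (metricTensor d N) p ![a, w]) p b = f w := fun a b =>
    ⟨(componentDeriv metricMap p (mdifferentiableAt_metric p) b).toLinearMap ![a, a] 1, fun w => by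
      rw [MultilinearMap.toLinearMap_apply, hu]; rfl⟩
  obtain ⟨f, hf⟩ := hl v u
  obtain ⟨g, hg⟩ := hl u v
  have : (fun w => (1 / 2 : ℝ) *
    (mvfderiv (𝓡 d) (component (metricTensor d N) p ![v, w]) p u
      + mvfderiv (𝓡 d) (component (metricTensor d N) p ![u, w]) p v
      - mvfderiv (𝓡 d) (component (metricTensor d N) p ![u, v]) p w)) =
      ⇑((1 / 2 : ℝ) • (f + g - (mvfderiv (𝓡 d) (component (metricTensor d N) p ![u, v])
        p).toLinearMap) : TangentSpace (𝓡 d) p →ₗ[ℝ] ℝ) := by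
    ext w
    simp [hf, hg]
  rw [christoffel, this, inner_sharp, ← this]

theorem christoffel_add (p : N) (u v w : TangentSpace (𝓡 d) p) :
    christoffel p (u + v) w = christoffel p u w + christoffel p v w := by
  refine ext_inner_right ℝ fun z => ?_
  have hu : ∀ a b : TangentSpace (𝓡 d) p, ∀ c, Function.update ![a, b] 0 c = ![c, b] := by
    intro a b c; ext i; fin_cases i <;> simp
  have h := fun b c : TangentSpace (𝓡 d) p =>
    (componentDeriv metricMap p (mdifferentiableAt_metric p) c).map_update_add ![u, b] 0 u v
  simp only [hu] at h
  have h' : ∀ b c : TangentSpace (𝓡 d) p,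
      mvfderiv (𝓡 d) (component (metricTensor d N) p ![u + v, b]) p c =
      mvfderiv (𝓡 d) (component (metricTensor d N) p ![u, b]) p c +
      mvfderiv (𝓡 d) (component (metricTensor d N) p ![v, b]) p c := h
  rw [inner_add_left, inner_christoffel, inner_christoffel, inner_christoffel, h', h', map_add]
  ring

theorem christoffel_smul (p : N) (c : ℝ) (u w : TangentSpace (𝓡 d) p) :
    christoffel p (c • u) w = c • christoffel p u w := by
  refine ext_inner_right ℝ fun z => ?_
  have hu : ∀ a b : TangentSpace (𝓡 d) p, ∀ c, Function.update ![a, b] 0 c = ![c, b] := by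
    intro a b c; ext i; fin_cases i <;> simp
  have h := fun b e : TangentSpace (𝓡 d) p =>
    (componentDeriv metricMap p (mdifferentiableAt_metric p) e).map_update_smul ![u, b] 0 c u
  simp only [hu] at h
  have h' : ∀ b e : TangentSpace (𝓡 d) p,
      mvfderiv (𝓡 d) (component (metricTensor d N) p ![c • u, b]) p e =
      c * mvfderiv (𝓡 d) (component (metricTensor d N) p ![u, b]) p e := h
  rw [real_inner_smul_left, inner_christoffel, inner_christoffel, h', h', map_smul, smul_eq_mul]
  ring

/-- The Christoffel symbol as a linear map in its second argument. -/
noncomputable def christoffelMap (p : N) (u : TangentSpace (𝓡 d) p) :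
    TangentSpace (𝓡 d) p →ₗ[ℝ] TangentSpace (𝓡 d) p where
  toFun v := christoffel p u v
  map_add' a b := by simp only [christoffel_comm p u, christoffel_add]
  map_smul' c a := by simp only [christoffel_comm p u, christoffel_smul, RingHom.id_apply]

/-- The Levi-Civita connection is metric. -/
theorem nabla_metric (p : N) (u : TangentSpace (𝓡 d) p) (w : Fin 2 → TangentSpace (𝓡 d) p) :
    nabla (metricTensor d N) p u w = 0 := by
  have hw : w = ![w 0, w 1] := by ext i; fin_cases i <;> rfl
  have e1 := component_metric_comm p (w 1) (w 0)
  have e2 := component_metric_comm p u (w 1)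
  have e3 := component_metric_comm p u (w 0)
  have h1 := inner_christoffel p u (w 0) (w 1)
  have h2 := inner_christoffel p u (w 1) (w 0)
  rw [e1] at h2
  have hs : nabla (metricTensor d N) p u w =
      mvfderiv (𝓡 d) (component (metricTensor d N) p ![w 0, w 1]) p u -
        (⟪christoffel p u (w 0), w 1⟫ + ⟪w 0, christoffel p u (w 1)⟫) := by
    rw [nabla, Fin.sum_univ_two, ← hw]
    simp [metricTensor]
  rw [hs, real_inner_comm _ (w 0), h1, h2]
  ring

section Nabla

variable {k : ℕ} 

/-- The covariant derivative of a multilinear tensor field is multilinear. -/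
noncomputable def nablaMap (α : ∀ y : N, MultilinearMap ℝ
      (fun _ : Fin k => TangentSpace (𝓡 d) y) ℝ) (p : N)
    (hα : ∀ w, MDifferentiableAt (𝓡 d) 𝓘(ℝ, ℝ) (component (fun y => ⇑(α y)) p w) p)
    (u : TangentSpace (𝓡 d) p) :
    MultilinearMap ℝ (fun _ : Fin k => TangentSpace (𝓡 d) p) ℝ :=
  componentDeriv α p hα u - ∑ i, (α p).compLinearMap
    (Function.update (fun _ => LinearMap.id) i (christoffelMap p u))

theorem nablaMap_coe (α : ∀ y : N, MultilinearMap ℝ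
      (fun _ : Fin k => TangentSpace (𝓡 d) y) ℝ) (p : N)
    (hα : ∀ w, MDifferentiableAt (𝓡 d) 𝓘(ℝ, ℝ) (component (fun y => ⇑(α y)) p w) p)
    (u : TangentSpace (𝓡 d) p) (w : Fin k → TangentSpace (𝓡 d) p) :
    nablaMap α p hα u w = nabla (fun y => ⇑(α y)) p u w := by
  rw [nablaMap, sub_apply, sum_apply, nabla]
  congr 1
  refine Finset.sum_congr rfl fun i _ => ?_
  rw [MultilinearMap.compLinearMap_apply]
  congr 1
  ext1 j
  by_cases h : j = i
  · subst h; simp [christoffelMap]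
  · simp [h]

/-- The covariant derivative of an alternating tensor field is alternating. -/
noncomputable def nablaAlt (α : ∀ y : N, (TangentSpace (𝓡 d) y) [⋀^Fin k]→ₗ[ℝ] ℝ) (p : N)
    (hα : ∀ w, MDifferentiableAt (𝓡 d) 𝓘(ℝ, ℝ) (component (fun y => ⇑(α y)) p w) p)
    (u : TangentSpace (𝓡 d) p) : (TangentSpace (𝓡 d) p) [⋀^Fin k]→ₗ[ℝ] ℝ where
  __ := nablaMap (fun y => (α y).toMultilinearMap) p hα u
  map_eq_zero_of_eq' w i j hij hne := by
    change nablaMap (fun y => (α y).toMultilinearMap) p hα u w = 0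
    rw [nablaMap_coe, nabla]
    have h1 : component (fun y => ⇑(α y).toMultilinearMap) p w = fun _ => 0 := by
      ext q
      exact (α q).map_eq_zero_of_eq _ (by rw [hij]) hne
    rw [h1, mvfderiv_const]
    -- Correcting any other slot leaves two equal arguments. The corrections of the slots `i` and
    -- `j` differ by a transposition and cancel.
    have h2 : ∀ l, l ≠ i → l ≠ j →
        (α p) (Function.update w l (christoffel p u (w l))) = 0 := by
      intro l hi hj
      refine (α p).map_eq_zero_of_eq _ ?_ hne
      rw [Function.update_of_ne (Ne.symm hi), Function.update_of_ne (Ne.symm hj), hij]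
    have h3 : (α p) (Function.update w j (christoffel p u (w j))) =
        -(α p) (Function.update w i (christoffel p u (w i))) := by
      rw [← (α p).map_swap _ hne]
      congr 1
      ext1 l
      rw [Function.comp_apply]
      by_cases hl : l = i
      · subst hl
        rw [Equiv.swap_apply_left, Function.update_of_ne hne, Function.update_of_ne hne.symm, hij]
      · by_cases hl' : l = j
        · subst hl'
          rw [Equiv.swap_apply_right, Function.update_self, Function.update_self, hij]
        · rw [Equiv.swap_apply_of_ne_of_ne hl hl', Function.update_of_ne hl,
            Function.update_of_ne hl']
    have h4 : ∑ l, (α p) (Function.update w l (christoffel p u (w l))) = 0 := by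
      rw [← Finset.sum_subset (Finset.subset_univ {i, j}), Finset.sum_pair hne, h3, add_neg_cancel]
      intro l _ hl
      simp only [Finset.mem_insert, Finset.mem_singleton, not_or] at hl
      exact h2 l hl.1 hl.2
    have h5 : ∑ l, (α p).toMultilinearMap (Function.update w l (christoffel p u (w l))) = 0 := h4
    rw [h5]
    simp

theorem nablaAlt_coe (α : ∀ y : N, (TangentSpace (𝓡 d) y) [⋀^Fin k]→ₗ[ℝ] ℝ) (p : N)
    (hα : ∀ w, MDifferentiableAt (𝓡 d) 𝓘(ℝ, ℝ) (component (fun y => ⇑(α y)) p w) p)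
    (u : TangentSpace (𝓡 d) p) (w : Fin k → TangentSpace (𝓡 d) p) :
    nablaAlt α p hα u w = nabla (fun y => ⇑(α y)) p u w :=
  nablaMap_coe (fun y => (α y).toMultilinearMap) p hα u w

theorem nabla_add (α : ∀ y : N, MultilinearMap ℝ
      (fun _ : Fin k => TangentSpace (𝓡 d) y) ℝ) (p : N) (u v : TangentSpace (𝓡 d) p)
      (w : Fin k → TangentSpace (𝓡 d) p) :
    nabla (fun y => ⇑(α y)) p (u + v) w =
      nabla (fun y => ⇑(α y)) p u w + nabla (fun y => ⇑(α y)) p v w := by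
  simp only [nabla, map_add, christoffel_add, MultilinearMap.map_update_add,
    Finset.sum_add_distrib]
  ring

theorem nabla_smul (α : ∀ y : N, MultilinearMap ℝ
      (fun _ : Fin k => TangentSpace (𝓡 d) y) ℝ) (p : N) (c : ℝ) (u : TangentSpace (𝓡 d) p)
      (w : Fin k → TangentSpace (𝓡 d) p) :
    nabla (fun y => ⇑(α y)) p (c • u) w = c * nabla (fun y => ⇑(α y)) p u w := by
  simp only [nabla, map_smul, christoffel_smul, MultilinearMap.map_update_smul, smul_eq_mul,
    ← Finset.mul_sum]
  ring

end Nabla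

end Metric

/-! ### Push-forward of coordinate fields and the symmetry of the second derivative of a map. -/

section Pushforward

variable {d : ℕ} {M : Type*} [TopologicalSpace M] [ChartedSpace (𝔼 d) M] [IsManifold (𝓡 d) ∞ M]
variable {d' : ℕ} {N : Type*} [TopologicalSpace N] [ChartedSpace (𝔼 d') N]
  [IsManifold (𝓡 d') ∞ N]

/-- The push-forward of a coordinate field, in coordinates, is a partial derivative. -/
theorem coord_pushforward_extend (f : M → N) (hf : ContMDiff (𝓡 d) (𝓡 d') ∞ f) (p : M)
    (v : TangentSpace (𝓡 d) p) :
    (fun q => coord (f p) (f q) (mfderiv (𝓡 d) (𝓡 d') f q (FiberBundle.extend (𝔼 d) v q)))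
      =ᶠ[𝓝 p] fun q => fderiv ℝ (writtenInExtChartAt (𝓡 d) (𝓡 d') p f) (extChartAt (𝓡 d) p q)
        (coord p p v) := by
  have hc := hf.continuous
  filter_upwards [baseSet_mem_nhds (d := d) p,
    hc.continuousAt.preimage_mem_nhds (baseSet_mem_nhds (d := d') (f p))] with q hq hq'
  have hqs : q ∈ (chartAt (𝔼 d) p).source := by
    rwa [TangentBundle.trivializationAt_baseSet] at hq
  have hqs' : f q ∈ (chartAt (𝔼 d') (f p)).source := by
    have : f q ∈ (trivializationAt (𝔼 d') (TangentSpace (𝓡 d') : N → Type) (f p)).baseSet := hq'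
    rwa [TangentBundle.trivializationAt_baseSet] at this
  have hqe : extChartAt (𝓡 d) p q ∈ (extChartAt (𝓡 d) p).target :=
    (extChartAt (𝓡 d) p).map_source (by rwa [extChartAt_source])
  have hinv : (extChartAt (𝓡 d) p).symm (extChartAt (𝓡 d) p q) = q :=
    (extChartAt (𝓡 d) p).left_inv (by rwa [extChartAt_source])
  have h1 : MDifferentiableAt 𝓘(ℝ, 𝔼 d) (𝓡 d) (extChartAt (𝓡 d) p).symm
      (extChartAt (𝓡 d) p q) := by
    have := mdifferentiableWithinAt_extChartAt_symm (I := 𝓡 d) hqe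
    rwa [ModelWithCorners.range_eq_univ, mdifferentiableWithinAt_univ] at this
  have h2 : MDifferentiableAt (𝓡 d) (𝓡 d') f ((extChartAt (𝓡 d) p).symm
      (extChartAt (𝓡 d) p q)) := (hf _).mdifferentiableAt (by simp)
  have h3 : MDifferentiableAt (𝓡 d') 𝓘(ℝ, 𝔼 d') (extChartAt (𝓡 d') (f p))
      (f ((extChartAt (𝓡 d) p).symm (extChartAt (𝓡 d) p q))) := by
    rw [hinv]; exact mdifferentiableAt_extChartAt hqs'
  have hs : FiberBundle.extend (𝔼 d) v q = mfderiv 𝓘(ℝ, 𝔼 d) (𝓡 d) (extChartAt (𝓡 d) p).symm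
      (extChartAt (𝓡 d) p q) (coord p p v) := by
    have := TangentBundle.symmL_trivializationAt (I := 𝓡 d) hqs
    rw [ModelWithCorners.range_eq_univ, mfderivWithin_univ] at this
    exact (symm_eq_symmL p q hq (coord p p v)).trans (DFunLike.congr_fun this (coord p p v))
  rw [coord_eq_linearMapAt _ _ hq', TangentBundle.continuousLinearMapAt_trivializationAt hqs', hs,
    ← mfderiv_eq_fderiv]
  have h12 := mfderiv_comp_apply (extChartAt (𝓡 d) p q) h2 h1 (coord p p v)
  have hcomp := (mfderiv_comp_apply (extChartAt (𝓡 d) p q) h3 (h2.comp _ h1) (coord p p v)).trans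
    (congrArg (mfderiv (𝓡 d') 𝓘(ℝ, 𝔼 d') (extChartAt (𝓡 d') (f p))
      (f ((extChartAt (𝓡 d) p).symm (extChartAt (𝓡 d) p q)))) h12)
  -- The chain rule yields the base point `(extChartAt (𝓡 d) p).symm (extChartAt (𝓡 d) p q)`, which
  -- equals `q` only by `hinv`; a variable point makes the rewriting of the dependent types
  -- possible.
  have key : ∀ z : M, z = q → ∀ y : 𝔼 d,
      mfderiv (𝓡 d') 𝓘(ℝ, 𝔼 d') (extChartAt (𝓡 d') (f p)) (f q) (mfderiv (𝓡 d) (𝓡 d') f q y) =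
      mfderiv (𝓡 d') 𝓘(ℝ, 𝔼 d') (extChartAt (𝓡 d') (f p)) (f z)
        (mfderiv (𝓡 d) (𝓡 d') f z y) := by
    rintro z hz y
    rw [hz]
  exact (key _ hinv _).trans hcomp.symm

theorem contDiffAt_writtenInExtChartAt (f : M → N) (hf : ContMDiff (𝓡 d) (𝓡 d') ∞ f) (p : M) :
    ContDiffAt ℝ ∞ (writtenInExtChartAt (𝓡 d) (𝓡 d') p f) (extChartAt (𝓡 d) p p) := by
  have h := (contMDiffAt_iff.1 (hf p)).2
  rwa [ModelWithCorners.range_eq_univ, contDiffWithinAt_univ] at h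

/-- In charts the push-forward of a coordinate field is DF applied to a constant vector, so its
derivative is the Hessian of F. The symmetry of the Hessian is behind the symmetry of the second
fundamental form. -/
theorem mvfderiv_pushforward_extend (f : M → N) (hf : ContMDiff (𝓡 d) (𝓡 d') ∞ f) (p : M)
    (v : TangentSpace (𝓡 d) p) :
    DiffAlong d f (fun q => mfderiv (𝓡 d) (𝓡 d') f q (FiberBundle.extend (𝔼 d) v q)) p ∧
    ∀ u, mvfderiv (𝓡 d) (fun q => coord (f p) (f q)
        (mfderiv (𝓡 d) (𝓡 d') f q (FiberBundle.extend (𝔼 d) v q))) p u =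
      fderiv ℝ (fderiv ℝ (writtenInExtChartAt (𝓡 d) (𝓡 d') p f)) (extChartAt (𝓡 d) p p)
        (coord p p u) (coord p p v) := by
  set F := writtenInExtChartAt (𝓡 d) (𝓡 d') p f with hF
  have hF2 : DifferentiableAt ℝ (fderiv ℝ F) (extChartAt (𝓡 d) p p) :=
    ((contDiffAt_writtenInExtChartAt f hf p).fderiv_right (m := 1)
      (by rw [one_add_one_eq_two]; exact ENat.LEInfty.out)).differentiableAt one_ne_zero
  have hev := coord_pushforward_extend f hf p v
  have hχ : MDifferentiableAt (𝓡 d) 𝓘(ℝ, 𝔼 d) (extChartAt (𝓡 d) p) p :=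
    mdifferentiableAt_extChartAt (by simp)
  have hg : HasFDerivAt (fun y => fderiv ℝ F y (coord p p v))
      ((fderiv ℝ (fderiv ℝ F) (extChartAt (𝓡 d) p p)).flip (coord p p v))
      (extChartAt (𝓡 d) p p) := by
    have := hF2.hasFDerivAt.clm_apply (hasFDerivAt_const (coord p p v) (extChartAt (𝓡 d) p p))
    simpa using this
  have hgm := hg.hasMFDerivAt
  have hcomp := hgm.comp p hχ.hasMFDerivAt
  refine ⟨hcomp.mdifferentiableAt.congr_of_eventuallyEq hev, fun u => ?_⟩
  have h1 := hev.mfderiv_eq (I := 𝓡 d) (I' := 𝓘(ℝ, 𝔼 d'))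
  have h2 : mfderiv (𝓡 d) 𝓘(ℝ, 𝔼 d') (fun q => fderiv ℝ F (extChartAt (𝓡 d) p q) (coord p p v))
    p = _ := hcomp.mfderiv
  have h3 : coord p p u = u := by
    have h0 := FiberBundle.mem_baseSet_trivializationAt' (F := 𝔼 d)
      (E := (TangentSpace (𝓡 d) : M → Type)) p
    rw [coord_eq_linearMapAt p p h0, TangentBundle.continuousLinearMapAt_trivializationAt (by simp),
      mfderiv_extChartAt_self]
    rfl
  have h4 := congrArg (fun L => L u) (h1.trans h2)
  refine Eq.trans h4 ?_
  rw [mfderiv_extChartAt_self]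
  conv_rhs => rw [h3]
  rfl

variable [RiemannianBundle (fun x : N => TangentSpace (𝓡 d') x)]

theorem nablaAlong_def (f : M → N) (X : ∀ q, TangentSpace (𝓡 d') (f q)) (p : M)
    (u : TangentSpace (𝓡 d) p) : nablaAlong f X p u =
    (trivializationAt (𝔼 d') (TangentSpace (𝓡 d') : N → Type) (f p)).symm (f p)
      (mvfderiv (𝓡 d) (fun q => coord (f p) (f q) (X q)) p u)
    + christoffel (f p) (mfderiv (𝓡 d) (𝓡 d') f p u) (X p) := rfl

variable [IsContMDiffRiemannianBundle (𝓡 d') ∞ (𝔼 d') (fun x : N => TangentSpace (𝓡 d') x)]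

theorem nablaAlong_add (f : M → N) (X : ∀ q, TangentSpace (𝓡 d') (f q)) (p : M)
    (u v : TangentSpace (𝓡 d) p) :
    nablaAlong f X p (u + v) = nablaAlong f X p u + nablaAlong f X p v := by
  have h0 := FiberBundle.mem_baseSet_trivializationAt' (F := 𝔼 d')
    (E := (TangentSpace (𝓡 d') : N → Type)) (f p)
  simp only [nablaAlong_def, symm_eq_symmL _ _ h0, map_add, christoffel_add]
  abel

theorem nablaAlong_smul (f : M → N) (X : ∀ q, TangentSpace (𝓡 d') (f q)) (p : M)
    (c : ℝ) (u : TangentSpace (𝓡 d) p) :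
    nablaAlong f X p (c • u) = c • nablaAlong f X p u := by
  have h0 := FiberBundle.mem_baseSet_trivializationAt' (F := 𝔼 d')
    (E := (TangentSpace (𝓡 d') : N → Type)) (f p)
  simp only [nablaAlong_def, symm_eq_symmL _ _ h0, map_smul, christoffel_smul, smul_add]

/-- The second covariant derivative of a map is symmetric. -/
theorem nablaAlong_pushforward_comm (f : M → N) (hf : ContMDiff (𝓡 d) (𝓡 d') ∞ f) (p : M)
    (u v : TangentSpace (𝓡 d) p) :
    nablaAlong f (fun q => mfderiv (𝓡 d) (𝓡 d') f q (FiberBundle.extend (𝔼 d) v q)) p u =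
    nablaAlong f (fun q => mfderiv (𝓡 d) (𝓡 d') f q (FiberBundle.extend (𝔼 d) u q)) p v := by
  have hsym : IsSymmSndFDerivAt ℝ (writtenInExtChartAt (𝓡 d) (𝓡 d') p f)
      (extChartAt (𝓡 d) p p) :=
    (contDiffAt_writtenInExtChartAt f hf p).isSymmSndFDerivAt (by simpa using ENat.LEInfty.out)
  rw [nablaAlong_def, nablaAlong_def, (mvfderiv_pushforward_extend f hf p v).2,
    (mvfderiv_pushforward_extend f hf p u).2, hsym.eq, FiberBundle.extend_apply_self,
    FiberBundle.extend_apply_self, christoffel_comm]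

/-- The Leibniz rule for the scalar product of two vector fields along a map. -/
theorem mvfderiv_inner_along (f : M → N) (p : M) (hf : MDifferentiableAt (𝓡 d) (𝓡 d') f p)
    (X Y : ∀ q, TangentSpace (𝓡 d') (f q)) (hX : DiffAlong d f X p) (hY : DiffAlong d f Y p)
    (u : TangentSpace (𝓡 d) p) :
    MDifferentiableAt (𝓡 d) 𝓘(ℝ, ℝ) (fun q => ⟪X q, Y q⟫) p ∧
    mvfderiv (𝓡 d) (fun q => ⟪X q, Y q⟫) p u =
      ⟪nablaAlong f X p u, Y p⟫ + ⟪X p, nablaAlong f Y p u⟫ := by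
  -- The metric is treated as one more tensor along the map; its own derivative vanishes by
  -- `nabla_metric`.
  have h := mvfderiv_tensor_along (metricMap (d := d') (N := N)) f p hf
    (mdifferentiableAt_metric (f p)) (Fin.cons X (fun _ => Y))
    (by intro i; fin_cases i; exacts [hX, hY]) u
  refine ⟨h.1, h.2.trans ?_⟩
  have hn : nabla (fun y => ⇑(metricMap (d := d') (N := N) y)) = nabla (metricTensor d' N) := rfl
  rw [hn, nabla_metric, zero_add, Fin.sum_univ_two]
  rfl

end Pushforward

/-! ### Vector fields on the manifold itself, and a criterion for their differentiability. -/

section Intrinsic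

variable {d : ℕ} {M : Type*} [TopologicalSpace M] [ChartedSpace (𝔼 d) M] [IsManifold (𝓡 d) ∞ M]

theorem diffAlong_extend (p : M) (v : TangentSpace (𝓡 d) p) :
    DiffAlong d (fun q : M => q) (fun q => FiberBundle.extend (𝔼 d) v q) p := by
  refine MDifferentiableAt.congr_of_eventuallyEq (mdifferentiableAt_const (c := coord p p v)) ?_
  filter_upwards [baseSet_mem_nhds (d := d) p] with q hq
  exact coord_extend p q hq v

theorem mdifferentiableAt_det {k : ℕ} {A : M → Matrix (Fin k) (Fin k) ℝ} {p : M}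
    (hA : ∀ i j, MDifferentiableAt (𝓡 d) 𝓘(ℝ, ℝ) (fun q => A q i j) p) :
    MDifferentiableAt (𝓡 d) 𝓘(ℝ, ℝ) (fun q => (A q).det) p := by
  simp only [Matrix.det_apply']
  refine (mvfderiv_finset_sum _ (fun σ _ => ?_) (0 : TangentSpace (𝓡 d) p)).1
  exact mdifferentiableAt_const.mul
    (mvfderiv_finset_prod _ (fun i _ => hA (σ i) i) (0 : TangentSpace (𝓡 d) p)).1

/-- Cramer's rule: the entries of the adjugate are polynomials in the entries of the matrix. It is
applied to the Gram matrix of the coordinate fields. -/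
theorem mdifferentiableAt_matrix_inv {k : ℕ} {A : M → Matrix (Fin k) (Fin k) ℝ} {p : M}
    (hA : ∀ i j, MDifferentiableAt (𝓡 d) 𝓘(ℝ, ℝ) (fun q => A q i j) p) (h0 : (A p).det ≠ 0)
    (i j : Fin k) : MDifferentiableAt (𝓡 d) 𝓘(ℝ, ℝ) (fun q => (A q)⁻¹ i j) p := by
  have h1 : MDifferentiableAt (𝓡 d) 𝓘(ℝ, ℝ) (fun q => ((A q).det)⁻¹) p := by
    have hi : MDifferentiableAt 𝓘(ℝ, ℝ) 𝓘(ℝ, ℝ) (fun x : ℝ => x⁻¹) (A p).det :=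
      (differentiableAt_inv h0).mdifferentiableAt
    exact MDifferentiableAt.comp (g := fun x : ℝ => x⁻¹) p hi (mdifferentiableAt_det hA)
  have h2 : MDifferentiableAt (𝓡 d) 𝓘(ℝ, ℝ) (fun q => (A q).adjugate i j) p := by
    simp only [Matrix.adjugate_apply]
    refine mdifferentiableAt_det fun a b => ?_
    by_cases h : a = j
    · subst h
      simpa using mdifferentiableAt_const
    · simpa [Matrix.updateRow_ne h] using hA a b
  refine (h1.mul h2).congr_of_eventuallyEq (Filter.Eventually.of_forall fun q => ?_)
  simp [Matrix.inv_def, Ring.inverse_eq_inv']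

variable [RiemannianBundle (fun x : M => TangentSpace (𝓡 d) x)]

/-- The components are constant in the chart, so only the Christoffel term remains. -/
theorem nablaAlong_extend (p : M) (u v : TangentSpace (𝓡 d) p) :
    nablaAlong (fun q : M => q) (fun q => FiberBundle.extend (𝔼 d) v q) p u =
      christoffel p u v := by
  have h0 := FiberBundle.mem_baseSet_trivializationAt' (F := 𝔼 d)
    (E := (TangentSpace (𝓡 d) : M → Type)) p
  have hev : (fun q => coord p q (FiberBundle.extend (𝔼 d) v q)) =ᶠ[𝓝 p]
      fun _ => coord p p v := by
    filter_upwards [baseSet_mem_nhds (d := d) p] with q hq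
    exact coord_extend p q hq v
  have h1 := hev.mfderiv_eq (I := 𝓡 d) (I' := 𝓘(ℝ, 𝔼 d))
  have h2 : mvfderiv (𝓡 d) (fun q => coord p q (FiberBundle.extend (𝔼 d) v q)) p u = 0 := by
    unfold mvfderiv
    rw [h1, mfderiv_const]
    simp
    rfl
  rw [nablaAlong_def, h2, symm_eq_symmL p p h0, map_zero, zero_add, FiberBundle.extend_apply_self]
  congr 1
  exact congrArg (fun L => L u) mfderiv_id

variable [IsContMDiffRiemannianBundle (𝓡 d) ∞ (𝔼 d) (fun x : M => TangentSpace (𝓡 d) x)]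

/-- A vector field is differentiable if its scalar products with coordinate fields are. -/
theorem diffAlong_of_inner (X : ∀ q : M, TangentSpace (𝓡 d) q) (p : M)
    (h : ∀ w : TangentSpace (𝓡 d) p,
      MDifferentiableAt (𝓡 d) 𝓘(ℝ, ℝ) (fun q => ⟪X q, FiberBundle.extend (𝔼 d) w q⟫) p) :
    DiffAlong d (fun q : M => q) X p := by
  have h0 := FiberBundle.mem_baseSet_trivializationAt' (F := 𝔼 d)
    (E := (TangentSpace (𝓡 d) : M → Type)) p
  set E : Fin d → ∀ q : M, TangentSpace (𝓡 d) q :=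
    fun j q => FiberBundle.extend (𝔼 d) (coordVec p j) q with hE
  set G : M → Matrix (Fin d) (Fin d) ℝ := fun q => Matrix.of fun i j => ⟪E i q, E j q⟫ with hG
  have hGd : ∀ i j, MDifferentiableAt (𝓡 d) 𝓘(ℝ, ℝ) (fun q => G q i j) p := fun i j =>
    mdifferentiableAt_metric p ![coordVec p i, coordVec p j]
  -- A null vector of the Gram matrix gives a combination of the coordinate fields of length zero,
  -- which contradicts their independence.
  have hdet : ∀ q ∈ (trivializationAt (𝔼 d) (TangentSpace (𝓡 d) : M → Type) p).baseSet,
      (G q).det ≠ 0 := by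
    intro q hq hz
    obtain ⟨y, hy, hy0⟩ := Matrix.exists_mulVec_eq_zero_iff.2 hz
    have h1 : ⟪∑ i, y i • E i q, ∑ j, y j • E j q⟫ = 0 := by
      rw [sum_inner]
      refine Finset.sum_eq_zero fun i _ => ?_
      rw [real_inner_smul_left, inner_sum]
      have := congrFun hy0 i
      simp only [Matrix.mulVec, dotProduct, hG, Matrix.of_apply, Pi.zero_apply] at this
      simp only [real_inner_smul_right]
      rw [Finset.sum_congr rfl fun j _ => mul_comm (y j) _, this, mul_zero]
    have h2 := inner_self_eq_zero.1 h1
    have h3 := symm_eq_sum p q hq (WithLp.toLp 2 y)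
    have h4 : (trivializationAt (𝔼 d) (TangentSpace (𝓡 d) : M → Type) p).symm q
        (WithLp.toLp 2 y) = 0 := h3.trans h2
    rw [symm_eq_symmL p q hq] at h4
    have h5 := Trivialization.continuousLinearMapAt_symmL (R := ℝ) _ hq (WithLp.toLp 2 y)
    rw [h4, map_zero] at h5
    apply hy
    ext j
    have := congrArg (fun z : 𝔼 d => z j) h5
    simpa using this.symm
  -- The coordinates of `X` are the inverse Gram matrix applied to the scalar products of `X` with
  -- the coordinate fields.
  have hco : ∀ j, (fun q => coord p q (X q) j) =ᶠ[𝓝 p]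
      fun q => ∑ l, (G q)⁻¹ j l * ⟪X q, E l q⟫ := by
    intro j
    filter_upwards [baseSet_mem_nhds (d := d) p] with q hq
    have h1 : (G q).mulVec (fun i => coord p q (X q) i) = fun l => ⟪X q, E l q⟫ := by
      ext l
      conv_rhs => rw [eq_sum_coord p q hq (X q)]
      simp only [Matrix.mulVec, dotProduct, hG, Matrix.of_apply, sum_inner, real_inner_smul_left]
      exact Finset.sum_congr rfl fun i _ => by rw [mul_comm, real_inner_comm]
    have h2 : (fun i => coord p q (X q) i) = (G q)⁻¹.mulVec (fun l => ⟪X q, E l q⟫) := by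
      rw [← h1, Matrix.mulVec_mulVec, Matrix.nonsing_inv_mul _ (Ne.isUnit (hdet q hq)),
        Matrix.one_mulVec]
    exact congrFun h2 j
  have hcd : ∀ j, MDifferentiableAt (𝓡 d) 𝓘(ℝ, ℝ) (fun q => coord p q (X q) j) p := fun j =>
    ((mvfderiv_finset_sum _ (fun l _ => (mdifferentiableAt_matrix_inv hGd (hdet p h0) j l).mul
      (h (coordVec p l))) (0 : TangentSpace (𝓡 d) p)).1).congr_of_eventuallyEq (hco j)
  set b := EuclideanSpace.basisFun (Fin d) ℝ with hb
  have hsum : (fun q => coord p q (X q)) = fun q => ∑ j, coord p q (X q) j • b j := by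
    ext1 q
    have := (b.sum_repr (coord p q (X q))).symm
    simpa only [hb, EuclideanSpace.basisFun_repr] using this
  have hsm : ∀ s : Finset (Fin d), MDifferentiableAt (𝓡 d) 𝓘(ℝ, 𝔼 d)
      (fun q => ∑ j ∈ s, coord p q (X q) j • b j) p := by
    intro s
    induction s using Finset.induction_on with
    | empty => simpa using mdifferentiableAt_const
    | insert a s ha ih =>
      simp_rw [Finset.sum_insert ha]
      exact ((hcd a).smul mdifferentiableAt_const).add ih
  have := hsm Finset.univ
  rw [← hsum] at this
  exact this

end Intrinsic

/-! ### Contractions over orthonormal bases and Gram determinants. -/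

section OrthonormalSums

variable {V : Type*} [NormedAddCommGroup V] [InnerProductSpace ℝ V]
variable {ι κ : Type*} [Fintype ι] [Fintype κ]

theorem multilinear_expand {p : ℕ} (e : OrthonormalBasis ι ℝ V)
    (a : MultilinearMap ℝ (fun _ : Fin p => V) ℝ) (u : Fin p → V) :
    a u = ∑ g : Fin p → ι, (∏ i, ⟪e (g i), u i⟫) * a fun i => e (g i) := by
  classical
  conv_lhs => rw [show u = fun i => ∑ j, ⟪e j, u i⟫ • e j from
    funext fun i => (e.sum_repr' (u i)).symm]
  rw [MultilinearMap.map_sum]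
  refine Finset.sum_congr rfl fun g _ => ?_
  rw [MultilinearMap.map_smul_univ, smul_eq_mul]

/-- The contraction of two multilinear maps does not depend on the orthonormal basis. -/
theorem sum_multilinear_mul {p : ℕ} (e : OrthonormalBasis ι ℝ V) (f : OrthonormalBasis κ ℝ V)
    (a b : MultilinearMap ℝ (fun _ : Fin p => V) ℝ) :
    ∑ g : Fin p → ι, a (fun i => e (g i)) * b (fun i => e (g i)) =
      ∑ g : Fin p → κ, a (fun i => f (g i)) * b (fun i => f (g i)) := by
  classical
  have h1 : ∀ g : Fin p → ι, a (fun i => e (g i)) * b (fun i => e (g i)) =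
      ∑ h : Fin p → κ, a (fun i => f (h i)) *
        ((∏ i, ⟪e (g i), f (h i)⟫) * b (fun i => e (g i))) := by
    intro g
    rw [multilinear_expand f a, Finset.sum_mul]
    refine Finset.sum_congr rfl fun h _ => ?_
    simp_rw [real_inner_comm]
    ring
  simp_rw [h1]
  rw [Finset.sum_comm]
  refine Finset.sum_congr rfl fun h _ => ?_
  rw [← Finset.mul_sum, ← multilinear_expand e b]

theorem linear_expand {W : Type*} [AddCommGroup W] [Module ℝ W] (e : OrthonormalBasis ι ℝ V)
    (l : V →ₗ[ℝ] W) (x : V) : l x = ∑ i, ⟪e i, x⟫ • l (e i) := by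
  conv_lhs => rw [← e.sum_repr' x]
  simp

/-- All traces are defined with the arbitrary basis `onb`; this moves them to a frame adapted to φ.
-/
theorem sum_bilin (e : OrthonormalBasis ι ℝ V) (f : OrthonormalBasis κ ℝ V)
    (b : V →ₗ[ℝ] V →ₗ[ℝ] ℝ) : ∑ i, b (e i) (e i) = ∑ j, b (f j) (f j) := by
  have h1 : ∀ i, b (e i) (e i) = ∑ j, ⟪f j, e i⟫ * b (f j) (e i) := by
    intro i
    have := congrArg (fun l => l (e i)) (linear_expand f b (e i))
    simpa [LinearMap.sum_apply] using this
  have h2 : ∀ j, b (f j) (f j) = ∑ i, ⟪f j, e i⟫ * b (f j) (e i) := by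
    intro j
    rw [linear_expand e (b (f j)) (f j)]
    simp [real_inner_comm]
  simp_rw [h1, h2]
  exact Finset.sum_comm

/-- The matrix of scalar products of two families of vectors. -/
noncomputable def gramMatrix {m : ℕ} (u w : Fin m → V) : Matrix (Fin m) (Fin m) ℝ :=
  Matrix.of fun i j => ⟪u i, w j⟫

/-- The Gram matrix is Aᵀ B for the coordinate matrices A and B. The right-hand side mentions no
basis, so a product of two values of a volume form does not see the orientation. -/
theorem det_mul_det {n : ℕ} (e : OrthonormalBasis (Fin n) ℝ V) (u w : Fin n → V) :
    e.toBasis.det u * e.toBasis.det w = (gramMatrix u w).det := by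
  have : gramMatrix u w = (e.toBasis.toMatrix u).transpose * e.toBasis.toMatrix w := by
    ext i j
    simp only [gramMatrix, Matrix.of_apply, Matrix.mul_apply, Matrix.transpose_apply,
      Basis.toMatrix_apply, OrthonormalBasis.coe_toBasis_repr_apply,
      OrthonormalBasis.repr_apply_apply]
    rw [← e.sum_inner_mul_inner (u i) (w j)]
    exact Finset.sum_congr rfl fun k _ => by rw [real_inner_comm]
  rw [this, Matrix.det_mul, Matrix.det_transpose, Basis.det_apply, Basis.det_apply]

/-- The Gram determinant as an alternating map of the second family of vectors. -/
noncomputable def gramAlt {m : ℕ} (u : Fin m → V) : V [⋀^Fin m]→ₗ[ℝ] ℝ :=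
  (Matrix.detRowAlternating (n := Fin m) (R := ℝ)).compLinearMap
    (LinearMap.pi fun i => (innerSL ℝ (u i)).toLinearMap)

theorem gramAlt_apply {m : ℕ} (u w : Fin m → V) : gramAlt u w = (gramMatrix u w).det := by
  rw [← Matrix.det_transpose]
  rfl

/-- The contraction of a generalised Kronecker delta. Expand along the row of `e b`: the diagonal
entry contributes the small determinant once per basis vector, and each of the other `m + 1` entries
takes it away once. -/
theorem sum_det_gramMatrix_cons {m : ℕ} (e : OrthonormalBasis ι ℝ V) (u w : Fin (m + 1) → V) :
    ∑ b, (gramMatrix (Fin.cons (e b) u : Fin (m + 2) → V) (Fin.cons (e b) w)).det =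
      ((Fintype.card ι : ℝ) - (m + 1)) * (gramMatrix u w).det := by
  have h1 : ∀ b, (gramMatrix (Fin.cons (e b) u : Fin (m + 2) → V) (Fin.cons (e b) w)).det =
      (gramMatrix u w).det - ∑ j : Fin (m + 1), (-1 : ℝ) ^ (j : ℕ) *
        (⟪e b, w j⟫ * gramAlt u (Fin.cons (e b) (j.removeNth w))) := by
    intro b
    rw [Matrix.det_succ_row_zero, Fin.sum_univ_succ, sub_eq_add_neg, ← Finset.sum_neg_distrib]
    congr 1
    · have : (gramMatrix (Fin.cons (e b) u : Fin (m + 2) → V) (Fin.cons (e b) w)).submatrix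
          Fin.succ (Fin.succAbove 0) = gramMatrix u w := by
        ext i j; simp [gramMatrix]
      rw [this]
      simp [gramMatrix]
    · refine Finset.sum_congr rfl fun j _ => ?_
      have : (gramMatrix (Fin.cons (e b) u : Fin (m + 2) → V) (Fin.cons (e b) w)).submatrix
          Fin.succ (Fin.succAbove j.succ) = gramMatrix u (Fin.cons (e b) (j.removeNth w)) := by
        ext i l
        refine Fin.cases ?_ (fun l => ?_) l
        · simp [gramMatrix]
        · simp [gramMatrix, Fin.removeNth]
      rw [this, gramAlt_apply]
      simp [gramMatrix, pow_succ]
      ring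
  -- Summing over the basis puts `w j` in the front slot; moving it back to its place costs the sign
  -- (-1)^j, which cancels the one of the expansion.
  have h2 : ∀ j : Fin (m + 1), ∑ b, (-1 : ℝ) ^ (j : ℕ) *
        (⟪e b, w j⟫ * gramAlt u (Fin.cons (e b) (j.removeNth w))) = (gramMatrix u w).det := by
    intro j
    have h3 : ∑ b, ⟪e b, w j⟫ * gramAlt u (Fin.cons (e b) (j.removeNth w)) =
        gramAlt u (Fin.cons (w j) (j.removeNth w)) := by
      have := linear_expand e ((gramAlt u).toMultilinearMap.toLinearMap
        (Fin.cons 0 (j.removeNth w)) 0) (w j)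
      simp only [MultilinearMap.toLinearMap_apply, Fin.update_cons_zero, smul_eq_mul] at this
      exact this.symm
    rw [← Finset.mul_sum, h3]
    have h4 := (gramAlt u).map_insertNth j (w j) (j.removeNth w)
    rw [Fin.insertNth_self_removeNth] at h4
    rw [← gramAlt_apply, h4, zsmul_eq_mul]
    push_cast
    rfl
  simp_rw [h1]
  rw [Finset.sum_sub_distrib, Finset.sum_comm]
  simp_rw [h2]
  simp
  ring

theorem sum_fin_succ {p : ℕ} (F : (Fin (p + 1) → ι) → ℝ) :
    ∑ g, F g = ∑ a, ∑ g : Fin p → ι, F (Fin.cons a g) := by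
  rw [← Fintype.sum_prod_type']
  exact (Equiv.sum_comp (Fin.consEquiv fun _ => ι) F).symm

theorem sum_fin_two (F : (Fin 2 → ι) → ℝ) : ∑ g, F g = ∑ a, ∑ b, F ![a, b] := by
  rw [sum_fin_succ]
  simp_rw [sum_fin_succ (p := 0)]
  simp
  rfl

theorem sum_fin_three (F : (Fin 3 → ι) → ℝ) : ∑ g, F g = ∑ a, ∑ b, ∑ c, F ![a, b, c] := by
  rw [sum_fin_succ]
  simp_rw [sum_fin_two]
  rfl

theorem sum_fin_append {p q : ℕ} (F : (Fin (p + q) → ι) → ℝ) :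
    ∑ f, F f = ∑ g : Fin p → ι, ∑ h : Fin q → ι, F (Fin.append g h) := by
  rw [← Fintype.sum_prod_type']
  exact (Equiv.sum_comp (Fin.appendEquiv p q) F).symm

/-- Contraction of an alternating map with the Gram determinant. -/
theorem sum_gramMatrix_mul {p : ℕ} (e : OrthonormalBasis ι ℝ V) (u : Fin p → V)
    (β : V [⋀^Fin p]→ₗ[ℝ] ℝ) :
    ∑ g : Fin p → ι, (gramMatrix (fun i => e (g i)) u).det * β (fun i => e (g i)) =
      p.factorial * β u := by
  simp_rw [Matrix.det_apply', Finset.sum_mul]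
  rw [Finset.sum_comm]
  -- The sign of σ occurs twice, in the determinant and when the arguments of β are permuted. All p!
  -- summands therefore agree.
  have h1 : ∀ σ : Equiv.Perm (Fin p), ∑ g : Fin p → ι, ((Equiv.Perm.sign σ : ℤ) : ℝ) *
      (∏ i, gramMatrix (fun i => e (g i)) u (σ i) i) * β (fun i => e (g i)) = β u := by
    intro σ
    have h2 : ∀ g : Fin p → ι, ∏ i, gramMatrix (fun i => e (g i)) u (σ i) i =
        ∏ i, ⟪e (g i), u (σ⁻¹ i)⟫ := by
      intro g
      rw [← Equiv.prod_comp σ (fun i => ⟪e (g i), u (σ⁻¹ i)⟫)]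
      simp [gramMatrix]
    simp_rw [h2, mul_assoc]
    rw [← Finset.mul_sum]
    have := multilinear_expand e β.toMultilinearMap (fun i => u (σ⁻¹ i))
    have h3 : β (fun i => u (σ⁻¹ i)) = ((Equiv.Perm.sign σ : ℤ) : ℝ) * β u := by
      have := β.map_perm u σ⁻¹
      rw [Equiv.Perm.sign_inv] at this
      rw [show (fun i => u (σ⁻¹ i)) = u ∘ ⇑σ⁻¹ from rfl, this, Units.smul_def, zsmul_eq_mul]
    have h4 : ∑ g : Fin p → ι, (∏ i, ⟪e (g i), u (σ⁻¹ i)⟫) * β (fun i => e (g i)) =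
        ((Equiv.Perm.sign σ : ℤ) : ℝ) * β u := this.symm.trans h3
    rw [h4, ← mul_assoc, ← Int.cast_mul, ← Units.val_mul, Int.units_mul_self]
    simp
  simp_rw [h1]
  simp [Fintype.card_perm]

end OrthonormalSums

/-! ### The Hodge star in dimension seven. -/

section Hodge

variable {V : Type*} [NormedAddCommGroup V] [InnerProductSpace ℝ V]
variable {ι κ : Type*} [Fintype ι] [Fintype κ]

/-- An alternating map with its last arguments fixed. -/
def appendLeft {p q : ℕ} (D : V [⋀^Fin (p + q)]→ₗ[ℝ] ℝ) (v : Fin q → V) :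
    V [⋀^Fin p]→ₗ[ℝ] ℝ where
  toFun w := D (Fin.append w v)
  map_update_add' {hdec} w i a b := by
    have h : ∀ c, Fin.append (Function.update w i c) v =
        Function.update (Fin.append w v) (Fin.castAdd q i) c := by
      intro c
      ext1 j
      refine Fin.addCases (fun j => ?_) (fun j => ?_) j
      · by_cases hj : j = i
        · subst hj; simp
        · have : Fin.castAdd q j ≠ Fin.castAdd q i := fun h => hj (Fin.castAdd_injective _ _ h)
          simp [Function.update_of_ne hj, Function.update_of_ne this]
      · have : Fin.natAdd p j ≠ Fin.castAdd q i := by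
          intro h; have := congrArg Fin.val h; simp at this; omega
        simp [Function.update_of_ne this]
    change D (Fin.append _ v) = D (Fin.append _ v) + D (Fin.append _ v)
    rw [h, h, h]
    exact D.map_update_add _ _ _ _
  map_update_smul' {hdec} w i b a := by
    have h : ∀ c, Fin.append (Function.update w i c) v =
        Function.update (Fin.append w v) (Fin.castAdd q i) c := by
      intro c
      ext1 j
      refine Fin.addCases (fun j => ?_) (fun j => ?_) j
      · by_cases hj : j = i
        · subst hj; simp
        · have : Fin.castAdd q j ≠ Fin.castAdd q i := fun h => hj (Fin.castAdd_injective _ _ h)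
          simp [Function.update_of_ne hj, Function.update_of_ne this]
      · have : Fin.natAdd p j ≠ Fin.castAdd q i := by
          intro h; have := congrArg Fin.val h; simp at this; omega
        simp [Function.update_of_ne this]
    change D (Fin.append _ v) = b • D (Fin.append _ v)
    rw [h, h]
    exact D.map_update_smul _ _ _ _
  map_eq_zero_of_eq' w i j hij hne := by
    refine D.map_eq_zero_of_eq _ (i := Fin.castAdd q i) (j := Fin.castAdd q j) (by simpa using hij) ?_
    exact fun h => hne (Fin.castAdd_injective _ _ h)

theorem appendLeft_apply {p q : ℕ} (D : V [⋀^Fin (p + q)]→ₗ[ℝ] ℝ) (v : Fin q → V)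
    (w : Fin p → V) : appendLeft D v w = D (Fin.append w v) := rfl

theorem append_three (a b c : V) (k : Fin 4 → V) :
    (Fin.append ![a, b, c] k : Fin 7 → V) = Fin.cons a (Fin.cons b (Fin.cons c k)) := by
  ext i
  fin_cases i <;> rfl

/-- Contraction of two volume forms in three arguments. -/
theorem sum_vol_mul_vol (e : OrthonormalBasis (Fin 7) ℝ V) (f : OrthonormalBasis ι ℝ V)
    (k v : Fin 4 → V) :
    ∑ g : Fin 3 → ι, e.toBasis.det (Fin.append (fun i => f (g i)) k : Fin 7 → V) *
      e.toBasis.det (Fin.append (fun i => f (g i)) v : Fin 7 → V) =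
      6 * (gramMatrix k v).det := by
  have hc : (Fintype.card ι : ℝ) = 7 := by
    have h1 := Module.finrank_eq_card_basis e.toBasis
    have h2 := Module.finrank_eq_card_basis f.toBasis
    rw [← h2, h1]
    simp
  rw [sum_fin_three]
  have h3 : ∀ a b c, (fun i => f (![a, b, c] i)) = ![f a, f b, f c] := by
    intro a b c; ext i; fin_cases i <;> rfl
  have h1 : ∀ a b, ∑ c, e.toBasis.det (Fin.append (fun i => f (![a, b, c] i)) k : Fin 7 → V) *
      e.toBasis.det (Fin.append (fun i => f (![a, b, c] i)) v : Fin 7 → V) =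
      ∑ c, (gramMatrix (Fin.cons (f a) (Fin.cons (f b) (Fin.cons (f c) k)) : Fin 7 → V)
        (Fin.cons (f a) (Fin.cons (f b) (Fin.cons (f c) v)))).det := by
    intro a b
    refine Finset.sum_congr rfl fun c _ => ?_
    rw [h3, append_three, append_three, det_mul_det]
  simp_rw [h1]
  -- The sums are reordered so that the front vector is contracted each time. The factors are 7 - 6,
  -- 7 - 5 and 7 - 4, with product 6.
  rw [Finset.sum_congr rfl fun a _ => Finset.sum_comm, Finset.sum_comm]
  have s1 : ∀ b c, ∑ a, (gramMatrix (Fin.cons (f a) (Fin.cons (f b) (Fin.cons (f c) k)) :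
      Fin 7 → V) (Fin.cons (f a) (Fin.cons (f b) (Fin.cons (f c) v)))).det =
      1 * (gramMatrix (Fin.cons (f b) (Fin.cons (f c) k) : Fin 6 → V)
        (Fin.cons (f b) (Fin.cons (f c) v))).det := by
    intro b c
    refine (sum_det_gramMatrix_cons f _ _).trans ?_
    rw [hc]; norm_num
  have s2 : ∀ c, ∑ b, (gramMatrix (Fin.cons (f b) (Fin.cons (f c) k) : Fin 6 → V)
        (Fin.cons (f b) (Fin.cons (f c) v))).det =
      2 * (gramMatrix (Fin.cons (f c) k : Fin 5 → V) (Fin.cons (f c) v)).det := by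
    intro c
    refine (sum_det_gramMatrix_cons f _ _).trans ?_
    rw [hc]; norm_num
  have s3 : ∑ c, (gramMatrix (Fin.cons (f c) k : Fin 5 → V) (Fin.cons (f c) v)).det =
      3 * (gramMatrix k v).det := by
    refine (sum_det_gramMatrix_cons f _ _).trans ?_
    rw [hc]; norm_num
  have h4 : ∀ c, ∑ a, ∑ b, (gramMatrix (Fin.cons (f a) (Fin.cons (f b) (Fin.cons (f c) k)) :
      Fin 7 → V) (Fin.cons (f a) (Fin.cons (f b) (Fin.cons (f c) v)))).det =
      2 * (gramMatrix (Fin.cons (f c) k : Fin 5 → V) (Fin.cons (f c) v)).det := by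
    intro c
    rw [Finset.sum_comm]
    simp_rw [s1, one_mul, s2]
  simp_rw [h4]
  rw [← Finset.mul_sum, s3]
  ring

/-- Exchanging blocks of lengths 3 and 4 is a power of a cycle of length 7, hence an even
permutation. This is why ∗∗ = 1 carries no sign. -/
theorem det_append_comm (e : OrthonormalBasis (Fin 7) ℝ V) (g : Fin 3 → V) (k : Fin 4 → V) :
    e.toBasis.det (Fin.append k g : Fin 7 → V) = e.toBasis.det (Fin.append g k : Fin 7 → V) := by
  have h : (Fin.append k g : Fin 7 → V) = (Fin.append g k : Fin 7 → V) ∘ ⇑(finRotate 7 ^ 3) := by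
    ext i
    fin_cases i <;> rfl
  rw [h, AlternatingMap.map_perm, map_pow, sign_finRotate]
  norm_num

variable [FiniteDimensional ℝ V]

/-- The Hodge star is an involution on four-forms in dimension seven. -/
theorem sum_hodge_mul_vol (e : OrthonormalBasis (Fin 7) ℝ V) (α : V [⋀^Fin 4]→ₗ[ℝ] ℝ)
    (v : Fin 4 → V) :
    ∑ g : Fin 3 → Fin (finrank ℝ V),
      hodge (p := 4) (q := 3) (fun w => e.toBasis.det w) (⇑α) (fun i => onb V (g i)) *
      e.toBasis.det (Fin.append (fun i => onb V (g i)) v : Fin 7 → V) = 6 * α v := by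
  have h1 : ∀ g : Fin 3 → Fin (finrank ℝ V),
      hodge (p := 4) (q := 3) (fun w => e.toBasis.det w) (⇑α) (fun i => onb V (g i)) *
      e.toBasis.det (Fin.append (fun i => onb V (g i)) v : Fin 7 → V) =
      ∑ k : Fin 4 → Fin (finrank ℝ V), (1 / 24 : ℝ) * (α (fun i => onb V (k i)) *
        (e.toBasis.det (Fin.append (fun i => onb V (g i)) fun i => onb V (k i) : Fin 7 → V) *
          e.toBasis.det (Fin.append (fun i => onb V (g i)) v : Fin 7 → V))) := by
    intro g
    rw [hodge, Finset.mul_sum, Finset.sum_mul]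
    refine Finset.sum_congr rfl fun k _ => ?_
    rw [det_append_comm]
    norm_num [Nat.factorial]
    ring
  simp_rw [h1]
  rw [Finset.sum_comm]
  simp_rw [← Finset.mul_sum, sum_vol_mul_vol]
  have h2 := sum_gramMatrix_mul (onb V) v α
  have h3 : ∀ k : Fin 4 → Fin (finrank ℝ V), α (fun i => onb V (k i)) *
      (6 * (gramMatrix (fun i => onb V (k i)) v).det) =
      6 * ((gramMatrix (fun i => onb V (k i)) v).det * α (fun i => onb V (k i))) := by
    intro k; ring
  simp_rw [h3]
  rw [← Finset.mul_sum, h2]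
  norm_num [Nat.factorial]
  ring

/-- `∗(∗α ∧ φ) = (1/6) ∑ φ(e_i, e_j, e_k) α(e_i, e_j, e_k, ·)` for a four-form `α`. -/
theorem hodge_wedge_hodge (e : OrthonormalBasis (Fin 7) ℝ V) (α : V [⋀^Fin 4]→ₗ[ℝ] ℝ)
    (φ : V [⋀^Fin 3]→ₗ[ℝ] ℝ) (f : OrthonormalBasis ι ℝ V) (x : V) :
    hodge (p := 6) (q := 1) (fun w => e.toBasis.det w)
      (wedge (p := 3) (q := 3)
        (hodge (p := 4) (q := 3) (fun w => e.toBasis.det w) ⇑α) ⇑φ) ![x] =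
    (1 / 6 : ℝ) * ∑ g : Fin 3 → ι, φ (fun i => f (g i)) *
      α (Fin.append (fun i => f (g i)) ![x] : Fin 4 → V) := by
  set β := hodge (p := 4) (q := 3) (fun w => e.toBasis.det w) ⇑α with hβ
  set D : V [⋀^Fin 6]→ₗ[ℝ] ℝ := appendLeft (p := 6) (q := 1) e.toBasis.det ![x] with hD
  have h1 : hodge (p := 6) (q := 1) (fun w => e.toBasis.det w) (wedge (p := 3) (q := 3) β ⇑φ) ![x]
      = (1 / 720 : ℝ) * ∑ w : Fin 6 → Fin (finrank ℝ V), (1 / 36 : ℝ) *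
        ∑ σ : Equiv.Perm (Fin 6), ((Equiv.Perm.sign σ : ℤ) : ℝ) *
        (β (fun i => onb V (w (σ (Fin.castAdd 3 i)))) *
          φ (fun j => onb V (w (σ (Fin.natAdd 3 j))))) * D (fun i => onb V (w i)) := by
    have e1 : (1 / (Nat.factorial 6 : ℝ)) = 1 / 720 := by norm_num [Nat.factorial]
    have e2 : (1 / ((Nat.factorial 3 : ℝ) * (Nat.factorial 3 : ℝ))) = 1 / 36 := by
      norm_num [Nat.factorial]
    rw [hodge, e1]
    congr 1
    refine Finset.sum_congr rfl fun w _ => ?_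
    rw [wedge, e2, mul_assoc, Finset.sum_mul]
    rfl
  rw [h1]
  simp_rw [← Finset.mul_sum]
  rw [Finset.sum_comm]
  -- Reindexing the sum by σ moves the permutation into the volume form, whose sign cancels that of
  -- the wedge product; all 720 permutations contribute the same.
  have h2 : ∀ σ : Equiv.Perm (Fin 6), ∑ w : Fin 6 → Fin (finrank ℝ V),
        ((Equiv.Perm.sign σ : ℤ) : ℝ) * (β (fun i => onb V (w (σ (Fin.castAdd 3 i)))) *
          φ (fun j => onb V (w (σ (Fin.natAdd 3 j))))) * D (fun i => onb V (w i)) =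
      ∑ w : Fin 6 → Fin (finrank ℝ V), β (fun i => onb V (w (Fin.castAdd 3 i))) *
          φ (fun j => onb V (w (Fin.natAdd 3 j))) * D (fun i => onb V (w i)) := by
    intro σ
    refine Fintype.sum_equiv (Equiv.arrowCongr σ.symm (Equiv.refl _)) _ _ fun w => ?_
    have h3 : D (fun i => onb V (w (σ i))) = ((Equiv.Perm.sign σ : ℤ) : ℝ) *
        D (fun i => onb V (w i)) := by
      have := D.map_perm (fun i => onb V (w i)) σ
      rw [show (fun i => onb V (w (σ i))) = (fun i => onb V (w i)) ∘ ⇑σ from rfl, this,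
        Units.smul_def, zsmul_eq_mul]
    simp only [Equiv.arrowCongr_apply, Equiv.coe_refl, Function.comp_def, Equiv.symm_symm, id]
    rw [h3]
    ring
  simp_rw [h2]
  rw [Finset.sum_const, Finset.card_univ, Fintype.card_perm, sum_fin_append (p := 3) (q := 3),
    Finset.sum_comm]
  -- The contraction of ∗α with the volume form gives back 6α, as ∗∗α = α. The constants combine to
  -- 720 · 6 / (720 · 36) = 1/6.
  have h4 : ∀ h : Fin 3 → Fin (finrank ℝ V), ∑ g : Fin 3 → Fin (finrank ℝ V),
      β (fun i => onb V (Fin.append g h (Fin.castAdd 3 i))) *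
      φ (fun j => onb V (Fin.append g h (Fin.natAdd 3 j))) *
        D (fun i => onb V (Fin.append g h i)) =
      6 * (φ (fun i => onb V (h i)) *
        α (Fin.append (fun i => onb V (h i)) ![x] : Fin 4 → V)) := by
    intro h
    have h5 := sum_hodge_mul_vol e α (Fin.append (fun i => onb V (h i)) ![x] : Fin 4 → V)
    rw [← hβ] at h5
    rw [mul_left_comm, ← h5, Finset.mul_sum]
    refine Finset.sum_congr rfl fun g _ => ?_
    have h6 : D (fun i => onb V (Fin.append g h i)) = e.toBasis.det (Fin.append
        (fun i => onb V (g i)) (Fin.append (fun i => onb V (h i)) ![x] : Fin 4 → V) :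
          Fin 7 → V) := by
      rw [hD, appendLeft_apply]
      congr 1
      ext i
      fin_cases i <;> rfl
    rw [h6]
    simp only [Fin.append_left, Fin.append_right]
    ring
  simp_rw [h4]
  have h7 := sum_multilinear_mul (onb V) f φ.toMultilinearMap
    (appendLeft (p := 3) (q := 1) α ![x]).toMultilinearMap
  have h8 : ∑ h : Fin 3 → Fin (finrank ℝ V), φ (fun i => onb V (h i)) *
        α (Fin.append (fun i => onb V (h i)) ![x] : Fin 4 → V) =
      ∑ g : Fin 3 → ι, φ (fun i => f (g i)) *
      α (Fin.append (fun i => f (g i)) ![x] : Fin 4 → V) := h7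
  rw [← h8, ← Finset.mul_sum, Fintype.card_fin, nsmul_eq_mul]
  norm_num [Nat.factorial]
  ring

end Hodge

/-! ### The model forms in coordinates -/

/-- The three-form `e_a ∧ e_b ∧ e_c` in coordinates. -/
def triple (x y z : Fin 7 → ℝ) (a b c : Fin 7) : ℝ :=
  x a * (y b * z c - y c * z b) - x b * (y a * z c - y c * z a) + x c * (y a * z b - y b * z a)

/-- The four-form `e_a ∧ e_b ∧ e_c ∧ e_d` in coordinates. -/
def quadruple (x y z w : Fin 7 → ℝ) (a b c d : Fin 7) : ℝ :=
  x a * triple y z w b c d - x b * triple y z w a c d + x c * triple y z w a b d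
    - x d * triple y z w a b c

/-- The three-form `∑ e_i ∧ e_{i+1} ∧ e_{i+3}` in coordinates. -/
def phiC (x y z : Fin 7 → ℝ) : ℝ :=
  triple x y z 0 1 3 + triple x y z 1 2 4 + triple x y z 2 3 5 + triple x y z 3 4 6
    + triple x y z 4 5 0 + triple x y z 5 6 1 + triple x y z 6 0 2

/-- The Hodge dual of `phiC` in coordinates. -/
def starC (x y z w : Fin 7 → ℝ) : ℝ :=
  -quadruple x y z w 2 4 5 6 + quadruple x y z w 0 3 5 6 - quadruple x y z w 0 1 4 6
    + quadruple x y z w 0 1 2 5 + quadruple x y z w 1 2 3 6 - quadruple x y z w 0 2 3 4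
    - quadruple x y z w 1 3 4 5

/-- The vector product in coordinates. -/
def crossC (x y : Fin 7 → ℝ) : Fin 7 → ℝ := fun k => phiC x y (Pi.single k 1)

/-- The Euclidean scalar product in coordinates. -/
def dotC (x y : Fin 7 → ℝ) : ℝ := ∑ k, x k * y k

theorem crossC_eq (x y : Fin 7 → ℝ) : crossC x y =
    ![x 1 * y 3 - x 3 * y 1 + (x 4 * y 5 - x 5 * y 4) + (x 2 * y 6 - x 6 * y 2),
      x 3 * y 0 - x 0 * y 3 + (x 2 * y 4 - x 4 * y 2) + (x 5 * y 6 - x 6 * y 5),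
      x 4 * y 1 - x 1 * y 4 + (x 3 * y 5 - x 5 * y 3) + (x 6 * y 0 - x 0 * y 6),
      x 0 * y 1 - x 1 * y 0 + (x 5 * y 2 - x 2 * y 5) + (x 4 * y 6 - x 6 * y 4),
      x 1 * y 2 - x 2 * y 1 + (x 6 * y 3 - x 3 * y 6) + (x 5 * y 0 - x 0 * y 5),
      x 2 * y 3 - x 3 * y 2 + (x 0 * y 4 - x 4 * y 0) + (x 6 * y 1 - x 1 * y 6),
      x 3 * y 4 - x 4 * y 3 + (x 1 * y 5 - x 5 * y 1) + (x 0 * y 2 - x 2 * y 0)] := by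
  ext k
  fin_cases k <;> simp [crossC, phiC, triple] <;> ring

theorem phiC_eq_dotC (x y z : Fin 7 → ℝ) : phiC x y z = dotC (crossC x y) z := by
  rw [crossC_eq]
  simp [dotC, Fin.sum_univ_seven, phiC, triple]
  ring

/-- The coordinate form of P(x, P(x, y)) = ⟨x, y⟩x - ⟨x, x⟩y, the one algebraic identity on which
the construction of Cayley frames rests. -/
theorem crossC_crossC (x y z : Fin 7 → ℝ) :
    phiC x (crossC x y) z = dotC x y * dotC x z - dotC x x * dotC y z := by
  rw [crossC_eq]
  simp [dotC, Fin.sum_univ_seven, phiC, triple]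
  ring

/-- Writes the four-form with the metric and the vector product only, which frees ∗φ from the choice
of a frame and of an orientation. -/
theorem starC_eq (x y z w : Fin 7 → ℝ) :
    starC x y z w = dotC x z * dotC y w - dotC x w * dotC y z - dotC (crossC x y) (crossC z w) := by
  rw [crossC_eq, crossC_eq]
  simp [dotC, Fin.sum_univ_seven, starC, quadruple, triple]
  ring

/-! ### The forms φ and ∗φ in a Cayley frame. -/

section Cayley

variable {V : Type*} [NormedAddCommGroup V] [InnerProductSpace ℝ V]

/-- The coordinates of a vector in an orthonormal basis. -/
noncomputable def coords (e : OrthonormalBasis (Fin 7) ℝ V) (v : V) : Fin 7 → ℝ :=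
  fun k => ⟪e k, v⟫

theorem coords_basis (e : OrthonormalBasis (Fin 7) ℝ V) (i : Fin 7) :
    coords e (e i) = Pi.single i 1 := by
  ext k
  simp [coords, orthonormal_iff_ite.1 e.orthonormal, Pi.single_apply]

theorem inner_eq_dotC (e : OrthonormalBasis (Fin 7) ℝ V) (x y : V) :
    ⟪x, y⟫ = dotC (coords e x) (coords e y) := by
  rw [← e.sum_inner_mul_inner x y]
  exact Finset.sum_congr rfl fun k _ => by rw [coords, coords, real_inner_comm]

theorem IsCayleyFrame.apply {φ : (Fin 3 → V) → ℝ} {e : OrthonormalBasis (Fin 7) ℝ V}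
    (h : IsCayleyFrame φ e) (x y z : V) :
    φ ![x, y, z] = phiC (coords e x) (coords e y) (coords e z) := by
  rw [h ![x, y, z]]
  simp [Fin.sum_univ_seven, Matrix.det_fin_three, phiC, triple, coords]
  ring

theorem det_of_col_single {n : ℕ} (M : Matrix (Fin (n + 1)) (Fin (n + 1)) ℝ) (a : Fin (n + 1))
    (h : ∀ i, M i 0 = if i = a then 1 else 0) :
    M.det = (-1 : ℝ) ^ (a : ℕ) * (M.submatrix a.succAbove Fin.succ).det := by
  rw [Matrix.det_succ_column_zero, Finset.sum_eq_single a]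
  · rw [h a, if_pos rfl, mul_one]
  · intro b _ hb
    rw [h b, if_neg hb]
    ring
  · simp

/-- The volume form with three basis vectors inserted is a form in the remaining coordinates. -/
theorem vol_three_basis (e : OrthonormalBasis (Fin 7) ℝ V) (a : Fin 7) (b : Fin 6) (c : Fin 5)
    (v : Fin 4 → V) :
    e.toBasis.det (Fin.append ![e a, e (a.succAbove b), e (a.succAbove (b.succAbove c))] v :
      Fin 7 → V) = (-1 : ℝ) ^ ((a : ℕ) + b + c) * (Matrix.of fun (i j : Fin 4) =>
        ⟪e (a.succAbove (b.succAbove (c.succAbove i))), v j⟫).det := by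
  rw [append_three, Basis.det_apply]
  have ho := orthonormal_iff_ite.1 e.orthonormal
  have hM : ∀ i j, e.toBasis.toMatrix (Fin.cons (e a) (Fin.cons (e (a.succAbove b))
      (Fin.cons (e (a.succAbove (b.succAbove c))) v)) : Fin 7 → V) i j =
      ⟪e i, (Fin.cons (e a) (Fin.cons (e (a.succAbove b))
      (Fin.cons (e (a.succAbove (b.succAbove c))) v)) : Fin 7 → V) j⟫ := by
    intro i j
    rw [Basis.toMatrix_apply, OrthonormalBasis.coe_toBasis_repr_apply,
      OrthonormalBasis.repr_apply_apply]
  -- Three Laplace expansions along the first column. Since rows are deleted one after another, the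
  -- later indices are counted among the remaining rows, whence the nested `succAbove`.
  rw [det_of_col_single _ a (fun i => by rw [hM, Fin.cons_zero, ho]),
    det_of_col_single _ b, det_of_col_single _ c]
  · rw [pow_add, pow_add, mul_assoc, mul_assoc]
    congr 4
    ext i j
    simp only [Matrix.submatrix_apply, hM, Matrix.of_apply, Fin.cons_succ]
  · intro i
    simp only [Matrix.submatrix_apply, hM]
    rw [Fin.cons_succ, Fin.cons_succ, Fin.cons_zero, ho]
    simp
  · intro i
    simp only [Matrix.submatrix_apply, hM]
    rw [Fin.cons_succ, Fin.cons_zero, ho]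
    simp

theorem gramMatrix_det_comm {m : ℕ} (u w : Fin m → V) :
    (gramMatrix u w).det = (gramMatrix w u).det := by
  rw [← Matrix.det_transpose]
  congr 1
  ext i j
  exact real_inner_comm _ _

variable [FiniteDimensional ℝ V]

/-- Exposes the frame chosen in the definition of `cayleyVol`. No other frame is ever compared with
it through an element of G₂. -/
theorem exists_cayleyVol {φ : (Fin 3 → V) → ℝ}
    (h : ∃ e : OrthonormalBasis (Fin 7) ℝ V, IsCayleyFrame φ e) :
    ∃ e : OrthonormalBasis (Fin 7) ℝ V, IsCayleyFrame φ e ∧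
      cayleyVol φ = fun v => e.toBasis.det v :=
  ⟨h.choose, h.choose_spec, by rw [cayleyVol, dif_pos h]⟩

/-- Contracting the volume form with a decomposable form e_a ∧ e_b ∧ e_c inserts the vectors e_a,
e_b, e_c into it; the factor 1/3! is absorbed by `sum_gramMatrix_mul`. -/
theorem hodge_cayley {φ : (Fin 3 → V) → ℝ} {e : OrthonormalBasis (Fin 7) ℝ V}
    (h : IsCayleyFrame φ e) (v : Fin 4 → V) :
    hodge (p := 3) (q := 4) (fun w => e.toBasis.det w) φ v =
      ∑ i : Fin 7, e.toBasis.det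
        (Fin.append (fun k => e ((![i, i + 1, i + 3] : Fin 3 → Fin 7) k)) v : Fin 7 → V) := by
  have h1 : ∀ g : Fin 3 → Fin (finrank ℝ V), φ (fun i => onb V (g i)) *
      e.toBasis.det (Fin.append (fun i => onb V (g i)) v : Fin 7 → V) =
      ∑ i : Fin 7, (gramMatrix (fun k => onb V (g k))
        (fun k => e ((![i, i + 1, i + 3] : Fin 3 → Fin 7) k))).det *
        appendLeft (p := 3) (q := 4) e.toBasis.det v (fun i => onb V (g i)) := by
    intro g
    rw [h, Finset.sum_mul]
    refine Finset.sum_congr rfl fun i _ => ?_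
    rw [gramMatrix_det_comm]
    rfl
  rw [hodge]
  simp_rw [h1]
  rw [Finset.sum_comm, Finset.mul_sum]
  refine Finset.sum_congr rfl fun i _ => ?_
  rw [sum_gramMatrix_mul, ← mul_assoc, appendLeft_apply]
  norm_num [Nat.factorial]

theorem det_of_fin_four (e : OrthonormalBasis (Fin 7) ℝ V) (x y z w : V) (r : Fin 4 → Fin 7) :
    (Matrix.of fun (i j : Fin 4) => ⟪e (r i), (![x, y, z, w] : Fin 4 → V) j⟫).det =
      quadruple (coords e x) (coords e y) (coords e z) (coords e w) (r 0) (r 1) (r 2) (r 3) := by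
  rw [Matrix.det_succ_column_zero]
  simp [Fin.sum_univ_succ, Matrix.det_fin_three, quadruple, triple, coords, Fin.succAbove]
  ring

theorem hodge_cayley_apply {φ : (Fin 3 → V) → ℝ} {e : OrthonormalBasis (Fin 7) ℝ V}
    (h : IsCayleyFrame φ e) (x y z w : V) :
    hodge (p := 3) (q := 4) (fun w => e.toBasis.det w) φ ![x, y, z, w] =
      starC (coords e x) (coords e y) (coords e z) (coords e w) := by
  -- The triple `l` is coded by its successive positions `a`, `b`, `c`; `r` lists the four
  -- complementary indices and `s` is the resulting sign.
  have key : ∀ (l : Fin 3 → Fin 7) (a : Fin 7) (b : Fin 6) (c : Fin 5) (r : Fin 4 → Fin 7) (s : ℝ),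
      (∀ k, l k = (![a, a.succAbove b, a.succAbove (b.succAbove c)] : Fin 3 → Fin 7) k) →
      (∀ i, a.succAbove (b.succAbove (c.succAbove i)) = r i) →
      (-1 : ℝ) ^ ((a : ℕ) + b + c) = s →
      e.toBasis.det (Fin.append (fun k => e (l k)) ![x, y, z, w] : Fin 7 → V) =
      s * quadruple (coords e x) (coords e y) (coords e z) (coords e w)
        (r 0) (r 1) (r 2) (r 3) := by
    intro l a b c r s h1 h2 h3
    have h4 : (fun k => e (l k)) =
        ![e a, e (a.succAbove b), e (a.succAbove (b.succAbove c))] := by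
      ext1 k; rw [h1 k]; fin_cases k <;> rfl
    rw [h4, vol_three_basis, h3]
    simp_rw [h2]
    rw [det_of_fin_four]
  rw [hodge_cayley h, Fin.sum_univ_seven,
    key _ 0 0 1 ![2, 4, 5, 6] (-1) (by decide) (by decide) (by norm_num),
    key _ 1 1 2 ![0, 3, 5, 6] 1 (by decide) (by decide) (by norm_num),
    key _ 2 2 3 ![0, 1, 4, 6] (-1) (by decide) (by decide) (by norm_num),
    key _ 3 3 4 ![0, 1, 2, 5] 1 (by decide) (by decide) (by norm_num),
    key _ 4 4 0 ![1, 2, 3, 6] 1 (by decide) (by decide) (by norm_num),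
    key _ 5 5 1 ![0, 2, 3, 4] (-1) (by decide) (by decide) (by norm_num),
    key _ 6 0 1 ![1, 3, 4, 5] (-1) (by decide) (by decide) (by norm_num)]
  simp [starC]
  ring

theorem inner_cross (φ : V [⋀^Fin 3]→ₗ[ℝ] ℝ) (x y z : V) :
    ⟪cross φ x y, z⟫ = φ ![x, y, z] := by
  have h : (fun z => φ ![x, y, z]) = ⇑(φ.toMultilinearMap.toLinearMap ![x, y, 0] 2) := by
    ext z
    rw [MultilinearMap.toLinearMap_apply]
    change φ _ = φ _
    congr 1
    ext i; fin_cases i <;> rfl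
  rw [cross, h, inner_sharp, ← h]

theorem coords_cross {φ : V [⋀^Fin 3]→ₗ[ℝ] ℝ} {e : OrthonormalBasis (Fin 7) ℝ V}
    (h : IsCayleyFrame φ e) (x y : V) :
    coords e (cross φ x y) = crossC (coords e x) (coords e y) := by
  ext k
  rw [coords, real_inner_comm, inner_cross, h.apply, coords_basis]
  rfl

/-- The four-form `∗φ` in terms of the vector product. -/
theorem starForm_eq {φ : V [⋀^Fin 3]→ₗ[ℝ] ℝ}
    (h : ∃ e : OrthonormalBasis (Fin 7) ℝ V, IsCayleyFrame φ e) (x y z w : V) :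
    starForm φ ![x, y, z, w] =
      ⟪x, z⟫ * ⟪y, w⟫ - ⟪x, w⟫ * ⟪y, z⟫ - ⟪cross φ x y, cross φ z w⟫ := by
  obtain ⟨e, he, hv⟩ := exists_cayleyVol h
  rw [starForm, hv, hodge_cayley_apply he, starC_eq]
  simp only [inner_eq_dotC e, coords_cross he]

/-- Here `e` may differ from the frame inside `cayleyVol`. The frame-free formula `starForm_eq`
bridges the two, so the independence of the volume form need not be proved separately. -/
theorem starForm_apply {φ : V [⋀^Fin 3]→ₗ[ℝ] ℝ} {e : OrthonormalBasis (Fin 7) ℝ V}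
    (h : IsCayleyFrame φ e) (x y z w : V) :
    starForm φ ![x, y, z, w] =
      starC (coords e x) (coords e y) (coords e z) (coords e w) := by
  rw [starForm_eq ⟨e, h⟩, starC_eq]
  simp only [inner_eq_dotC e, coords_cross h]

end Cayley

/-! ### Algebra of the vector cross product. -/

section CrossProduct

variable {V : Type*} [NormedAddCommGroup V] [InnerProductSpace ℝ V] [FiniteDimensional ℝ V]

theorem alternating_swap_left (φ : V [⋀^Fin 3]→ₗ[ℝ] ℝ) (x y z : V) :
    φ ![y, x, z] = -φ ![x, y, z] := by
  rw [← φ.map_swap ![x, y, z] (show (0 : Fin 3) ≠ 1 by decide)]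
  congr 1
  ext i; fin_cases i <;> rfl

theorem alternating_swap_right (φ : V [⋀^Fin 3]→ₗ[ℝ] ℝ) (x y z : V) :
    φ ![x, z, y] = -φ ![x, y, z] := by
  rw [← φ.map_swap ![x, y, z] (show (1 : Fin 3) ≠ 2 by decide)]
  congr 1
  ext i; fin_cases i <;> rfl

theorem alternating_add (φ : V [⋀^Fin 3]→ₗ[ℝ] ℝ) (x x' y z : V) :
    φ ![x + x', y, z] = φ ![x, y, z] + φ ![x', y, z] := by
  have h : ∀ c, (![c, y, z] : Fin 3 → V) = Function.update ![0, y, z] 0 c := by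
    intro c; ext i; fin_cases i <;> rfl
  rw [h, h x, h x']
  exact φ.map_update_add _ _ _ _

theorem alternating_smul (φ : V [⋀^Fin 3]→ₗ[ℝ] ℝ) (c : ℝ) (x y z : V) :
    φ ![c • x, y, z] = c * φ ![x, y, z] := by
  have h : ∀ c, (![c, y, z] : Fin 3 → V) = Function.update ![0, y, z] 0 c := by
    intro c; ext i; fin_cases i <;> rfl
  rw [h, h x]
  exact φ.map_update_smul _ _ _ _

theorem cross_anticomm (φ : V [⋀^Fin 3]→ₗ[ℝ] ℝ) (x y : V) : cross φ y x = -cross φ x y := by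
  refine ext_inner_right ℝ fun z => ?_
  rw [inner_neg_left, inner_cross, inner_cross, alternating_swap_left]

theorem cross_add_left (φ : V [⋀^Fin 3]→ₗ[ℝ] ℝ) (x x' y : V) :
    cross φ (x + x') y = cross φ x y + cross φ x' y := by
  refine ext_inner_right ℝ fun z => ?_
  rw [inner_add_left, inner_cross, inner_cross, inner_cross, alternating_add]

theorem cross_smul_left (φ : V [⋀^Fin 3]→ₗ[ℝ] ℝ) (c : ℝ) (x y : V) :
    cross φ (c • x) y = c • cross φ x y := by
  refine ext_inner_right ℝ fun z => ?_
  rw [real_inner_smul_left, inner_cross, inner_cross, alternating_smul]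

/-- The vector product as a bilinear map. -/
noncomputable def crossMap (φ : V [⋀^Fin 3]→ₗ[ℝ] ℝ) : V →ₗ[ℝ] V →ₗ[ℝ] V :=
  LinearMap.mk₂ ℝ (cross φ) (cross_add_left φ) (cross_smul_left φ)
    (fun x y z => by
      rw [cross_anticomm φ (y + z) x, cross_add_left, cross_anticomm φ y x, cross_anticomm φ z x]
      abel)
    (fun c x y => by
      rw [cross_anticomm φ (c • y) x, cross_smul_left, cross_anticomm φ y x, smul_neg])

theorem crossMap_apply (φ : V [⋀^Fin 3]→ₗ[ℝ] ℝ) (x y : V) : crossMap φ x y = cross φ x y := rfl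

theorem cross_self (φ : V [⋀^Fin 3]→ₗ[ℝ] ℝ) (x : V) : cross φ x x = 0 := by
  refine ext_inner_right ℝ fun z => ?_
  rw [inner_cross, inner_zero_left]
  exact φ.map_eq_zero_of_eq _ (show (![x, x, z] : Fin 3 → V) 0 = ![x, x, z] 1 from rfl) (by decide)

theorem inner_cross_cycle (φ : V [⋀^Fin 3]→ₗ[ℝ] ℝ) (x y z : V) :
    ⟪cross φ x y, z⟫ = ⟪x, cross φ y z⟫ := by
  rw [inner_cross, real_inner_comm, inner_cross, alternating_swap_right φ y x z,
    alternating_swap_left φ x y z, neg_neg]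

theorem cross_cross {φ : V [⋀^Fin 3]→ₗ[ℝ] ℝ}
    (hφ : ∃ e : OrthonormalBasis (Fin 7) ℝ V, IsCayleyFrame φ e) (x y : V) :
    cross φ x (cross φ x y) = ⟪x, y⟫ • x - ⟪x, x⟫ • y := by
  obtain ⟨e, he⟩ := hφ
  refine ext_inner_right ℝ fun z => ?_
  rw [inner_cross, he.apply, coords_cross he, crossC_crossC, inner_sub_left, real_inner_smul_left,
    real_inner_smul_left]
  simp only [inner_eq_dotC e]

/-- Polarisation of `cross_cross` in its first argument. For orthogonal vectors it says that x × (y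
× z) changes sign when x and y are exchanged. -/
theorem cross_cross_add {φ : V [⋀^Fin 3]→ₗ[ℝ] ℝ}
    (hφ : ∃ e : OrthonormalBasis (Fin 7) ℝ V, IsCayleyFrame φ e) (x y z : V) :
    cross φ x (cross φ y z) = -cross φ y (cross φ x z) - (2 * ⟪x, y⟫) • z + ⟪x, z⟫ • y
      + ⟪y, z⟫ • x := by
  have h1 := cross_cross hφ (x + y) z
  have h2 := cross_cross hφ x z
  have h3 := cross_cross hφ y z
  simp only [← crossMap_apply] at h1 h2 h3 ⊢
  simp only [map_add, LinearMap.add_apply, h2, h3, inner_add_left, inner_add_right, add_smul,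
    smul_add, real_inner_comm x y] at h1 ⊢
  linear_combination (norm := module) h1

end CrossProduct

/-! ### Construction of a Cayley frame with prescribed first vector. -/

section AdaptedFrame

variable {V : Type*} [NormedAddCommGroup V] [InnerProductSpace ℝ V] [FiniteDimensional ℝ V]

theorem crossC_add (x x' y : Fin 7 → ℝ) : crossC (x + x') y = crossC x y + crossC x' y := by
  ext k; simp [crossC, phiC, triple]; ring

theorem crossC_smul (c : ℝ) (x y : Fin 7 → ℝ) : crossC (c • x) y = c • crossC x y := by
  ext k; simp [crossC, phiC, triple]; ring

theorem crossC_anticomm (x y : Fin 7 → ℝ) : crossC y x = -crossC x y := by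
  ext k; simp [crossC, phiC, triple]; ring

/-- The coordinates in an orthonormal basis as a linear map. -/
noncomputable def coordsMap (e : OrthonormalBasis (Fin 7) ℝ V) : V →ₗ[ℝ] Fin 7 → ℝ :=
  LinearMap.pi fun i => (innerSL ℝ (e i)).toLinearMap

theorem coordsMap_apply (e : OrthonormalBasis (Fin 7) ℝ V) (x : V) :
    coordsMap e x = coords e x := rfl

/-- The coordinate vector product as a bilinear map. -/
def crossCMap : (Fin 7 → ℝ) →ₗ[ℝ] (Fin 7 → ℝ) →ₗ[ℝ] Fin 7 → ℝ :=
  LinearMap.mk₂ ℝ crossC crossC_add crossC_smul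
    (fun x y z => by
      rw [crossC_anticomm (y + z) x, crossC_add, crossC_anticomm y x, crossC_anticomm z x]
      abel)
    (fun c x y => by
      rw [crossC_anticomm (c • y) x, crossC_smul, crossC_anticomm y x, smul_neg])

/-- Since φ(x, y, z) = ⟨P(x, y), z⟩ and both products are bilinear and skew, a multiplication table
of the basis vectors with i < j decides the matter. -/
theorem isCayleyFrame_of_cross {φ : V [⋀^Fin 3]→ₗ[ℝ] ℝ} {e : OrthonormalBasis (Fin 7) ℝ V}
    (h : ∀ i j, i < j → coords e (cross φ (e i) (e j)) =
      crossC (Pi.single i 1) (Pi.single j 1)) : IsCayleyFrame φ e := by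
  have h0 : ∀ x, crossC x x = 0 := fun x => self_eq_neg.1 (crossC_anticomm x x)
  have h1 : ∀ i j, coords e (cross φ (e i) (e j)) = crossC (Pi.single i 1) (Pi.single j 1) := by
    intro i j
    rcases lt_trichotomy i j with hij | hij | hij
    · exact h i j hij
    · subst hij
      rw [cross_self, h0, ← coordsMap_apply, map_zero]
    · rw [cross_anticomm, crossC_anticomm, ← h j i hij, ← coordsMap_apply, map_neg,
        coordsMap_apply]
  have h2 : (crossMap φ).compr₂ (coordsMap e) =
      crossCMap.compl₁₂ (coordsMap e) (coordsMap e) := by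
    refine e.toBasis.ext fun i => e.toBasis.ext fun j => ?_
    simp only [OrthonormalBasis.coe_toBasis]
    change coords e (cross φ (e i) (e j)) = crossC (coords e (e i)) (coords e (e j))
    rw [h1, coords_basis, coords_basis]
  intro v
  have h3 : coords e (cross φ (v 0) (v 1)) = crossC (coords e (v 0)) (coords e (v 1)) :=
    congrArg (fun l => l (v 0) (v 1)) h2
  have h4 : φ v = ⟪cross φ (v 0) (v 1), v 2⟫ := by
    rw [inner_cross]
    congr 1
    ext i; fin_cases i <;> rfl
  rw [h4, inner_eq_dotC e, h3, ← phiC_eq_dotC]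
  simp [Fin.sum_univ_seven, Matrix.det_fin_three, phiC, triple, coords]
  ring

/-- A Cayley frame can be built from three vectors. -/
theorem exists_cayleyFrame_of_triple {φ : V [⋀^Fin 3]→ₗ[ℝ] ℝ}
    (hφ : ∃ e : OrthonormalBasis (Fin 7) ℝ V, IsCayleyFrame φ e) {a b c : V}
    (haa : ⟪a, a⟫ = 1) (hbb : ⟪b, b⟫ = 1) (hcc : ⟪c, c⟫ = 1) (hab : ⟪a, b⟫ = 0)
    (hac : ⟪a, c⟫ = 0) (hbc : ⟪b, c⟫ = 0) (habc : ⟪cross φ a b, c⟫ = 0) :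
    ∃ e : OrthonormalBasis (Fin 7) ℝ V, IsCayleyFrame φ e ∧ e 0 = a := by
  have cc := cross_cross hφ
  have cca := cross_cross_add hφ
  have ac := cross_anticomm φ
  have cy := inner_cross_cycle φ
  have negR : ∀ x y, cross φ x (-y) = -cross φ x y := fun x y => map_neg (crossMap φ x) y
  have negL : ∀ x y, cross φ (-x) y = -cross φ x y := fun x y => by
    rw [ac, negR, ac y x, neg_neg]
  have self := cross_self φ
  have hba : ⟪b, a⟫ = 0 := by rw [real_inner_comm]; exact hab
  have hca : ⟪c, a⟫ = 0 := by rw [real_inner_comm]; exact hac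
  have hcb : ⟪c, b⟫ = 0 := by rw [real_inner_comm]; exact hbc
  -- orthogonality of a product with its factors
  have oL : ∀ x y, ⟪x, cross φ x y⟫ = 0 := fun x y => by
    rw [← cy, self, inner_zero_left]
  have oR : ∀ x y, ⟪y, cross φ x y⟫ = 0 := fun x y => by
    rw [ac, inner_neg_right, oL, neg_zero]
  -- products of orthonormal vectors
  have u : ∀ x y, ⟪x, x⟫ = 1 → ⟪y, y⟫ = 1 → ⟪x, y⟫ = 0 →
      ⟪cross φ x y, cross φ x y⟫ = 1 := fun x y hx hy hxy => by
    have h : ∀ w, ⟪cross φ x y, w⟫ = -⟪y, cross φ x w⟫ := fun w => by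
      rw [ac y x, inner_neg_left, cy]
    rw [h, cc, hxy, hx, zero_smul, zero_sub, inner_neg_right, neg_neg, one_smul, hy]
  have sq : ∀ x y, ⟪x, x⟫ = 1 → ⟪x, y⟫ = 0 → cross φ x (cross φ x y) = -y :=
    fun x y hx hxy => by rw [cc, hx, hxy]; simp
  have sq' : ∀ x y, ⟪x, x⟫ = 1 → ⟪x, y⟫ = 0 → cross φ x (cross φ y x) = y :=
    fun x y hx hxy => by rw [ac x y, negR, sq x y hx hxy, neg_neg]
  have sw : ∀ x y z, ⟪x, y⟫ = 0 → ⟪x, z⟫ = 0 → ⟪y, z⟫ = 0 →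
      cross φ x (cross φ y z) = -cross φ y (cross φ x z) := fun x y z h1 h2 h3 => by
    rw [cca, h1, h2, h3]; simp
  -- In a Cayley frame e_3 = e_0 × e_1, e_4 = e_1 × e_2, e_5 = e_2 × e_3 and e_6 = e_0 × e_2, so
  -- `a`, `b`, `c` as first three vectors force these four. All scalar products and products follow
  -- from the rules `sq`, `sq'` and `sw`.
  obtain ⟨d, hd⟩ : ∃ d, d = cross φ a b := ⟨_, rfl⟩
  obtain ⟨p, hp⟩ : ∃ p, p = cross φ b c := ⟨_, rfl⟩
  obtain ⟨q, hq⟩ : ∃ q, q = cross φ c d := ⟨_, rfl⟩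
  obtain ⟨r, hr⟩ : ∃ r, r = cross φ a c := ⟨_, rfl⟩
  have had : ⟪a, d⟫ = 0 := hd ▸ oL a b
  have hbd : ⟪b, d⟫ = 0 := hd ▸ oR a b
  have hcd : ⟪c, d⟫ = 0 := by rw [real_inner_comm, hd]; exact habc
  have hdd : ⟪d, d⟫ = 1 := hd ▸ u a b haa hbb hab
  have hpp : ⟪p, p⟫ = 1 := hp ▸ u b c hbb hcc hbc
  have hqq : ⟪q, q⟫ = 1 := hq ▸ u c d hcc hdd hcd
  have hrr : ⟪r, r⟫ = 1 := hr ▸ u a c haa hcc hac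
  have hbp : ⟪b, p⟫ = 0 := hp ▸ oL b c
  have hcp : ⟪c, p⟫ = 0 := hp ▸ oR b c
  have hcq : ⟪c, q⟫ = 0 := hq ▸ oL c d
  have hdq : ⟪d, q⟫ = 0 := hq ▸ oR c d
  have har : ⟪a, r⟫ = 0 := hr ▸ oL a c
  have hcr : ⟪c, r⟫ = 0 := hr ▸ oR a c
  have hap : ⟪a, p⟫ = 0 := by rw [hp, ← cy]; exact habc
  have t_ab : cross φ a b = d := hd.symm
  have t_bc : cross φ b c = p := hp.symm
  have t_cd : cross φ c d = q := hq.symm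
  have t_ac : cross φ a c = r := hr.symm
  have t_ad : cross φ a d = -b := by rw [hd, sq a b haa hab]
  have t_bd : cross φ b d = a := by rw [hd, sq' b a hbb hba]
  have t_bp : cross φ b p = -c := by rw [hp, sq b c hbb hbc]
  have t_cp : cross φ c p = b := by rw [hp, sq' c b hcc hcb]
  have t_ar : cross φ a r = -c := by rw [hr, sq a c haa hac]
  have t_cr : cross φ c r = a := by rw [hr, sq' c a hcc hca]
  have t_cq : cross φ c q = -d := by rw [hq, sq c d hcc hcd]
  have t_dq : cross φ d q = c := by
    rw [hq, sq' d c hdd (by rw [real_inner_comm]; exact hcd)]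
  have t_ap : cross φ a p = q := by
    rw [hp, ac c b, negR, sw a c b hac hab hcb, neg_neg, t_ab, t_cd]
  have t_br : cross φ b r = -q := by
    rw [hr, sw b a c hba hbc hac, t_bc, t_ap]
  have haq : ⟪a, q⟫ = 0 := t_ap ▸ oL a p
  have hpq : ⟪p, q⟫ = 0 := t_ap ▸ oR a p
  have hbq : ⟪b, q⟫ = 0 := by
    have := oL b r
    rw [t_br, inner_neg_right] at this
    linarith
  have hrq : ⟪r, q⟫ = 0 := by
    have := oR b r
    rw [t_br, inner_neg_right] at this
    linarith
  have hqr : ⟪q, r⟫ = 0 := by rw [real_inner_comm]; exact hrq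
  have hbr : ⟪b, r⟫ = 0 := by rw [hr, ac c a, inner_neg_right, ← cy, t_bc, real_inner_comm, hap,
    neg_zero]
  have t_aq : cross φ a q = -p := by rw [← t_ap, sq a p haa hap]
  have t_bq : cross φ b q = r := by
    have h1 : q = -cross φ b r := by rw [t_br, neg_neg]
    rw [h1, negR, sq b r hbb hbr, neg_neg]
  have hdb : ⟪d, b⟫ = 0 := by rw [real_inner_comm]; exact hbd
  have hdc : ⟪d, c⟫ = 0 := by rw [real_inner_comm]; exact hcd
  have t_dp : cross φ d p = r := by
    rw [hp, sw d b c hdb hdc hbc, ac c d, t_cd, negR, neg_neg, t_bq]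
  have hdp : ⟪d, p⟫ = 0 := by
    rw [hd, cy, t_bp, inner_neg_right, hac, neg_zero]
  have hdr : ⟪d, r⟫ = 0 := t_dp ▸ oL d p
  have hpr : ⟪p, r⟫ = 0 := t_dp ▸ oR d p
  have t_dr : cross φ d r = -p := by rw [← t_dp, sq d p hdd hdp]
  have t_pr : cross φ p r = d := by
    rw [← t_dp, sq' p d hpp (by rw [real_inner_comm]; exact hdp)]
  have t_pq : cross φ p q = a := by
    rw [← t_ap, sq' p a hpp (by rw [real_inner_comm]; exact hap)]
  have t_qr : cross φ q r = b := by
    rw [← t_bq, sq' q b hqq (by rw [real_inner_comm]; exact hbq)]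
  have hon : Orthonormal ℝ ![a, b, c, d, p, q, r] := by
    rw [orthonormal_iff_ite]
    have hlt : ∀ i j : Fin 7, i < j →
        ⟪(![a, b, c, d, p, q, r] : Fin 7 → V) i, (![a, b, c, d, p, q, r] : Fin 7 → V) j⟫ = 0 := by
      intro i j hij
      fin_cases i <;> fin_cases j <;> first | exact absurd hij (by decide) | assumption
    intro i j
    rcases lt_trichotomy i j with hij | hij | hij
    · rw [hlt i j hij, if_neg hij.ne]
    · subst hij
      rw [if_pos rfl]
      fin_cases i <;> assumption
    · rw [real_inner_comm, hlt j i hij, if_neg hij.ne']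
  obtain ⟨e0, -⟩ := hφ
  have hcard : finrank ℝ V = Fintype.card (Fin 7) := finrank_eq_card_basis e0.toBasis
  obtain ⟨e, he⟩ := Orthonormal.exists_orthonormalBasis_extension_of_card_eq (s := Set.univ) hcard
    (v := ![a, b, c, d, p, q, r]) (hon.comp _ Subtype.coe_injective)
  have he0 : ∀ i, e i = (![a, b, c, d, p, q, r] : Fin 7 → V) i := fun i => he i (Set.mem_univ i)
  refine ⟨e, isCayleyFrame_of_cross fun i j hij => ?_, he0 0⟩
  have hneg : ∀ x, coords e (-x) = -coords e x := fun x => map_neg (coordsMap e) x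
  have e0' : a = e 0 := (he0 0).symm
  have e1' : b = e 1 := (he0 1).symm
  have e2' : c = e 2 := (he0 2).symm
  have e3' : d = e 3 := (he0 3).symm
  have e4' : p = e 4 := (he0 4).symm
  have e5' : q = e 5 := (he0 5).symm
  have e6' : r = e 6 := (he0 6).symm
  -- With the definitions forgotten, the seven vectors are variables with a multiplication table and
  -- can be renamed `e 0`, ..., `e 6`.
  clear hd hp hq hr he he0
  subst e0' e1' e2' e3' e4' e5' e6'
  fin_cases i <;> fin_cases j <;> first
    | exact absurd hij (by decide)
    | (simp only [Fin.zero_eta, Fin.mk_one, Fin.reduceFinMk, t_ab, t_bc, t_cd, t_ac, t_ad, t_bd,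
        t_bp, t_cp, t_ar, t_cr, t_cq, t_dq, t_ap, t_br, t_aq, t_bq, t_dp, t_dr, t_pr, t_pq, t_qr,
        hneg, coords_basis]
       rw [crossC_eq]
       ext k
       fin_cases k <;> simp)

/-- A unit vector is the first vector of a Cayley frame. -/
theorem exists_cayleyFrame {φ : V [⋀^Fin 3]→ₗ[ℝ] ℝ}
    (hφ : ∃ e : OrthonormalBasis (Fin 7) ℝ V, IsCayleyFrame φ e) {a : V} (ha : ‖a‖ = 1) :
    ∃ e : OrthonormalBasis (Fin 7) ℝ V, IsCayleyFrame φ e ∧ e 0 = a := by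
  obtain ⟨e0, he0⟩ := id hφ
  have hcard : finrank ℝ V = Fintype.card (Fin 7) := finrank_eq_card_basis e0.toBasis
  have haa : ⟪a, a⟫ = 1 := by rw [real_inner_self_eq_norm_sq, ha]; norm_num
  obtain ⟨f, hf⟩ := Orthonormal.exists_orthonormalBasis_extension_of_card_eq (s := {0}) hcard
    (v := fun _ => a) (by
      rw [orthonormal_iff_ite]
      intro i j
      rw [if_pos (Subsingleton.elim i j)]
      exact haa)
  have hf0 : f 0 = a := hf 0 rfl
  have hfo := orthonormal_iff_ite.1 f.orthonormal
  have hab : ⟪a, f 1⟫ = 0 := by rw [← hf0, hfo]; rfl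
  have hbb : ⟪f 1, f 1⟫ = 1 := by rw [hfo]; rfl
  set d := cross φ a (f 1) with hd
  have hdd : ⟪d, d⟫ = 1 := by
    have h : ∀ w, ⟪cross φ a (f 1), w⟫ = -⟪f 1, cross φ a w⟫ := fun w => by
      rw [cross_anticomm φ (f 1) a, inner_neg_left, inner_cross_cycle]
    rw [hd, h, cross_cross hφ, hab, haa, zero_smul, zero_sub, inner_neg_right, neg_neg, one_smul,
      hbb]
  have had : ⟪a, d⟫ = 0 := by rw [hd, ← inner_cross_cycle, cross_self, inner_zero_left]
  have hbd : ⟪f 1, d⟫ = 0 := by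
    rw [hd, cross_anticomm φ (f 1) a, inner_neg_right, ← inner_cross_cycle, cross_self,
      inner_zero_left, neg_zero]
  -- A further basis vector `g 3` is orthogonal to `a`, `f 1` and their product, as the construction
  -- from three vectors demands. The zeros are padding outside the index set {0, 1, 2}.
  obtain ⟨g, hg⟩ := Orthonormal.exists_orthonormalBasis_extension_of_card_eq (s := {0, 1, 2}) hcard
    (v := ![a, f 1, d, 0, 0, 0, 0]) (by
      rw [orthonormal_iff_ite]
      rintro ⟨i, hi⟩ ⟨j, hj⟩
      simp only [Set.mem_insert_iff, Set.mem_singleton_iff] at hi hj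
      rcases hi with rfl | rfl | rfl <;> rcases hj with rfl | rfl | rfl <;>
        simp [Set.domRestrict, -inner_self_eq_norm_sq_to_K, haa, hbb, hdd,
          hab, had, hbd, real_inner_comm a, real_inner_comm (f 1)])
  have hgo := orthonormal_iff_ite.1 g.orthonormal
  have hg0 : g 0 = a := hg 0 (by simp)
  have hg1 : g 1 = f 1 := hg 1 (by simp)
  have hg2 : g 2 = d := hg 2 (by simp)
  refine exists_cayleyFrame_of_triple hφ (b := f 1) (c := g 3) haa hbb ?_ hab ?_ ?_ ?_
  · rw [hgo]; rfl
  · rw [← hg0, hgo]; rfl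
  · rw [← hg1, hgo]; rfl
  · rw [← hd, ← hg2, hgo]; rfl

end AdaptedFrame

/-! ### The seven-dimensional space of three-forms v ⌟ ∗φ. -/

section SevenForms

/-- The interior product of a vector with the model four-form. -/
def starCAlt (r : Fin 7 → ℝ) : (Fin 7 → ℝ) [⋀^Fin 3]→ₗ[ℝ] ℝ where
  toFun v := starC r (v 0) (v 1) (v 2)
  map_update_add' := by
    intro inst v i x y
    obtain rfl : inst = instDecidableEqFin 3 := Subsingleton.elim _ _
    fin_cases i <;> simp [starC, quadruple, triple, Function.update] <;> ring
  map_update_smul' := by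
    intro inst v i c x
    obtain rfl : inst = instDecidableEqFin 3 := Subsingleton.elim _ _
    fin_cases i <;> simp [starC, quadruple, triple, Function.update] <;> ring
  map_eq_zero_of_eq' v i j h hij := by
    fin_cases i <;> fin_cases j <;> first
      | exact absurd rfl hij
      | (simp only [Fin.zero_eta, Fin.mk_one, Fin.reduceFinMk] at h ⊢
         rw [h]
         simp only [starC, quadruple, triple]
         ring)

variable {V : Type*} [NormedAddCommGroup V] [InnerProductSpace ℝ V] [FiniteDimensional ℝ V]

/-- Reduces an equality of three-forms to the 35 increasing triples of basis vectors. -/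
theorem alternating_ext_basis {α β : V [⋀^Fin 3]→ₗ[ℝ] ℝ} (e : OrthonormalBasis (Fin 7) ℝ V)
    (h : ∀ i j k, i < j → j < k → α ![e i, e j, e k] = β ![e i, e j, e k]) : α = β := by
  refine Basis.ext_alternating e.toBasis fun v hv => ?_
  have hs : ∀ a b c : Fin 7, α ![e a, e b, e c] = β ![e a, e b, e c] →
      α ![e b, e a, e c] = β ![e b, e a, e c] ∧ α ![e a, e c, e b] = β ![e a, e c, e b] ∧
      α ![e b, e c, e a] = β ![e b, e c, e a] ∧ α ![e c, e a, e b] = β ![e c, e a, e b] ∧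
      α ![e c, e b, e a] = β ![e c, e b, e a] := by
    intro a b c h
    have l1 := alternating_swap_left α
    have r1 := alternating_swap_right α
    have l2 := alternating_swap_left β
    have r2 := alternating_swap_right β
    refine ⟨?_, ?_, ?_, ?_, ?_⟩
    · rw [l1, l2, h]
    · rw [r1, r2, h]
    · rw [r1, r2, l1, l2, h]
    · rw [l1, l2, r1, r2, h]
    · rw [l1, l2, r1, r2, l1, l2, h]
  have h01 : v 0 ≠ v 1 := fun hh => absurd (hv hh) (by decide)
  have h02 : v 0 ≠ v 2 := fun hh => absurd (hv hh) (by decide)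
  have h12 : v 1 ≠ v 2 := fun hh => absurd (hv hh) (by decide)
  have hv3 : (fun i => e.toBasis (v i)) = ![e (v 0), e (v 1), e (v 2)] := by
    ext i; fin_cases i <;> simp
  rw [hv3]
  rcases lt_or_gt_of_ne h01 with a | a <;> rcases lt_or_gt_of_ne h02 with b | b <;>
    rcases lt_or_gt_of_ne h12 with c | c
  · exact h _ _ _ a c
  · exact (hs _ _ _ (h _ _ _ b c)).2.1
  · exact absurd (a.trans c) b.not_gt
  · exact (hs _ _ _ (h _ _ _ b a)).2.2.1
  · exact (hs _ _ _ (h _ _ _ a b)).1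
  · exact absurd (a.trans b) c.not_gt
  · exact (hs _ _ _ (h _ _ _ c b)).2.2.2.1
  · exact (hs _ _ _ (h _ _ _ c a)).2.2.2.2

theorem sum_mul_triple (α : V [⋀^Fin 3]→ₗ[ℝ] ℝ) (e : OrthonormalBasis (Fin 7) ℝ V)
    (a b c : Fin 7) :
    ∑ g : Fin 3 → Fin 7, α (fun i => e (g i)) *
      triple (coords e (e (g 0))) (coords e (e (g 1))) (coords e (e (g 2))) a b c =
    6 * α ![e a, e b, e c] := by
  have := sum_gramMatrix_mul e ![e a, e b, e c] α
  rw [show ((Nat.factorial 3 : ℕ) : ℝ) = 6 by norm_num [Nat.factorial]] at this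
  rw [← this]
  refine Finset.sum_congr rfl fun g _ => ?_
  rw [mul_comm, Matrix.det_fin_three]
  simp only [gramMatrix, triple, coords, Matrix.of_apply, real_inner_comm (e (g _))]
  simp
  left
  ring

/-- The pairing of a three-form with the interior product of a vector and the four-form. -/
theorem sum_mul_starC (α : V [⋀^Fin 3]→ₗ[ℝ] ℝ) (e : OrthonormalBasis (Fin 7) ℝ V)
    (s : Fin 7 → ℝ) (A : Fin 7 → Fin 7 → Fin 7 → ℝ) (hA : ∀ a b c, A a b c = α ![e a, e b, e c]) :
    (1 / 6 : ℝ) * ∑ g : Fin 3 → Fin 7, α (fun i => e (g i)) *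
      starC s (coords e (e (g 0))) (coords e (e (g 1))) (coords e (e (g 2))) =
    -(s 2 * A 4 5 6 - s 4 * A 2 5 6 + s 5 * A 2 4 6 - s 6 * A 2 4 5)
    + (s 0 * A 3 5 6 - s 3 * A 0 5 6 + s 5 * A 0 3 6 - s 6 * A 0 3 5)
    - (s 0 * A 1 4 6 - s 1 * A 0 4 6 + s 4 * A 0 1 6 - s 6 * A 0 1 4)
    + (s 0 * A 1 2 5 - s 1 * A 0 2 5 + s 2 * A 0 1 5 - s 5 * A 0 1 2)
    + (s 1 * A 2 3 6 - s 2 * A 1 3 6 + s 3 * A 1 2 6 - s 6 * A 1 2 3)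
    - (s 0 * A 2 3 4 - s 2 * A 0 3 4 + s 3 * A 0 2 4 - s 4 * A 0 2 3)
    - (s 1 * A 3 4 5 - s 3 * A 1 4 5 + s 4 * A 1 3 5 - s 5 * A 1 3 4) := by
  have h6 : ∀ a b c, A a b c = (1 / 6 : ℝ) * ∑ g : Fin 3 → Fin 7, α (fun i => e (g i)) *
      triple (coords e (e (g 0))) (coords e (e (g 1))) (coords e (e (g 2))) a b c := by
    intro a b c
    rw [sum_mul_triple, hA]
    ring
  simp only [h6, Finset.mul_sum, ← Finset.sum_add_distrib, ← Finset.sum_sub_distrib,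
    ← Finset.sum_neg_distrib]
  refine Finset.sum_congr rfl fun g _ => ?_
  rw [starC]
  simp only [quadruple]
  ring

/-- The multiplication table. The six other vectors fall into the pairs (i+1, i+3), (i+2, i+6),
(i+4, i+5), the three lines of the Fano plane through i. -/
theorem cross_basis {φ : V [⋀^Fin 3]→ₗ[ℝ] ℝ} {e : OrthonormalBasis (Fin 7) ℝ V}
    (he : IsCayleyFrame φ e) (i : Fin 7) :
    cross φ (e i) (e (i + 1)) = e (i + 3) ∧ cross φ (e i) (e (i + 2)) = e (i + 6) ∧
    cross φ (e i) (e (i + 4)) = e (i + 5) ∧ cross φ (e i) (e (i + 3)) = -e (i + 1) ∧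
    cross φ (e i) (e (i + 6)) = -e (i + 2) ∧ cross φ (e i) (e (i + 5)) = -e (i + 4) := by
  have hinj : ∀ x y : V, coords e x = coords e y → x = y := fun x y h => by
    rw [← e.sum_repr' x, ← e.sum_repr' y]
    exact Finset.sum_congr rfl fun k _ => by rw [show ⟪e k, x⟫ = ⟪e k, y⟫ from congrFun h k]
  have hneg : ∀ x, coords e (-x) = -coords e x := fun x => map_neg (coordsMap e) x
  refine ⟨hinj _ _ ?_, hinj _ _ ?_, hinj _ _ ?_, hinj _ _ ?_, hinj _ _ ?_, hinj _ _ ?_⟩ <;>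
  · simp only [hneg, coords_cross he, coords_basis]
    rw [crossC_eq]
    fin_cases i <;> ext k <;> fin_cases k <;> simp

/-- Turns the condition, quadratic in `y`, into linear relations between components of α on basis
vectors. -/
theorem alternating_polarize {φ α : V [⋀^Fin 3]→ₗ[ℝ] ℝ}
    (hα : ∀ x y, α ![x, y, cross φ x y] = 0) (x y y' : V) :
    α ![x, y, cross φ x y'] + α ![x, y', cross φ x y] = 0 := by
  have ha : ∀ x y y' z : V, α ![x, y + y', z] = α ![x, y, z] + α ![x, y', z] := by
    intro x y y' z
    rw [← neg_inj, ← alternating_swap_left, alternating_add, neg_add, ← alternating_swap_left,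
      ← alternating_swap_left]
  have hb : ∀ x y z z' : V, α ![x, y, z + z'] = α ![x, y, z] + α ![x, y, z'] := by
    intro x y z z'
    rw [← neg_inj, ← alternating_swap_right, ha, neg_add, ← alternating_swap_right,
      ← alternating_swap_right]
  have h := hα x (y + y')
  rw [← crossMap_apply, map_add, crossMap_apply, crossMap_apply, ha, hb, hb, hα, hα] at h
  linarith

/-- A three-form `α` with `α(x, y, P(x, y)) = 0` is the interior product of a vector with `∗φ`. -/
theorem eq_starC_of_cross {φ α : V [⋀^Fin 3]→ₗ[ℝ] ℝ} {e : OrthonormalBasis (Fin 7) ℝ V}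
    (he : IsCayleyFrame φ e) (hα : ∀ x y, α ![x, y, cross φ x y] = 0) {R : Fin 7 → ℝ}
    (hR : ∀ j, R j = (1 / 4 : ℝ) * formInner α (interior (e j) (starForm φ))) (x y z : V) :
    α ![x, y, z] = starC R (coords e x) (coords e y) (coords e z) := by
  obtain ⟨A, hA⟩ : ∃ A : Fin 7 → Fin 7 → Fin 7 → ℝ, ∀ a b c, A a b c = α ![e a, e b, e c] :=
    ⟨_, fun _ _ _ => rfl⟩
  have h1 : ∀ a b c, b < a → A a b c = -A b a c := fun a b c _ => by
    rw [hA, hA, alternating_swap_left]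
  have h2 : ∀ a b c, c < b → A a b c = -A a c b := fun a b c _ => by
    rw [hA, hA, alternating_swap_right]
  have hn : ∀ x y z : V, α ![x, y, -z] = -α ![x, y, z] := fun x y z => by
    have h : -z = (-1 : ℝ) • z := by simp
    rw [alternating_swap_right, alternating_swap_left, h, alternating_smul,
      alternating_swap_left α x z, alternating_swap_right]
    ring
  -- The condition on the pair (e_i, e_{i+1}) and its polarisation at e_i over pairs taken from
  -- different lines through i.
  have rel : ∀ i, A i (i + 1) (i + 3) = 0 ∧ A i (i + 1) (i + 6) + A i (i + 2) (i + 3) = 0 ∧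
      A i (i + 1) (i + 5) + A i (i + 4) (i + 3) = 0 ∧
      A i (i + 2) (i + 5) + A i (i + 4) (i + 6) = 0 ∧
      -A i (i + 1) (i + 2) + A i (i + 6) (i + 3) = 0 ∧
      -A i (i + 1) (i + 4) + A i (i + 5) (i + 3) = 0 ∧
      -A i (i + 2) (i + 4) + A i (i + 5) (i + 6) = 0 := by
    intro i
    obtain ⟨c1, c2, c4, c3, c6, c5⟩ := cross_basis he i
    have hp := alternating_polarize hα (e i)
    refine ⟨?_, ?_, ?_, ?_, ?_, ?_, ?_⟩
    · rw [hA, ← c1, hα]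
    · simpa only [← hA, c1, c2, c4, c3, c6, c5, hn] using hp (e (i + 1)) (e (i + 2))
    · simpa only [← hA, c1, c2, c4, c3, c6, c5, hn] using hp (e (i + 1)) (e (i + 4))
    · simpa only [← hA, c1, c2, c4, c3, c6, c5, hn] using hp (e (i + 2)) (e (i + 4))
    · simpa only [← hA, c1, c2, c4, c3, c6, c5, hn] using hp (e (i + 1)) (e (i + 6))
    · simpa only [← hA, c1, c2, c4, c3, c6, c5, hn] using hp (e (i + 1)) (e (i + 5))
    · simpa only [← hA, c1, c2, c4, c3, c6, c5, hn] using hp (e (i + 2)) (e (i + 5))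
  have hR' : ∀ j, R j = (1 / 4 : ℝ) * ((1 / 6 : ℝ) * ∑ g : Fin 3 → Fin 7, α (fun i => e (g i)) *
      starC (Pi.single j 1) (coords e (e (g 0))) (coords e (e (g 1))) (coords e (e (g 2)))) := by
    intro j
    have hst : ∀ w, interior (e j) (starForm φ) w =
        ((starCAlt (Pi.single j 1)).compLinearMap (coordsMap e)) w := by
      intro w
      have : (Fin.cons (e j) w : Fin 4 → V) = ![e j, w 0, w 1, w 2] := by
        ext i; fin_cases i <;> rfl
      rw [interior, this, starForm_apply he, coords_basis]
      rfl
    rw [hR, formInner]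
    simp only [hst]
    rw [show ((Nat.factorial 3 : ℕ) : ℝ) = 6 by norm_num [Nat.factorial]]
    congr 2
    exact sum_multilinear_mul (onb V) e α.toMultilinearMap
      ((starCAlt (Pi.single j 1)).compLinearMap (coordsMap e)).toMultilinearMap
  simp only [sum_mul_starC α e _ A hA] at hR'
  have r0 := rel 0
  have r1 := rel 1
  have r2 := rel 2
  have r3 := rel 3
  have r4 := rel 4
  have r5 := rel 5
  have r6 := rel 6
  clear rel
  simp (disch := decide) only [Fin.isValue, Fin.reduceAdd, zero_add, h1, h2, neg_neg] at r0 r1 r2 r3 r4 r5 r6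
  have key : α = (starCAlt R).compLinearMap (coordsMap e) := by
    refine alternating_ext_basis e fun i j k hij hjk => ?_
    rw [← hA]
    change A i j k = starC R (coords e (e i)) (coords e (e j)) (coords e (e k))
    rw [coords_basis, coords_basis, coords_basis]
    obtain ⟨a0, a1, a2, a3, a4, a5, a6⟩ := r0
    obtain ⟨b0, b1, b2, b3, b4, b5, b6⟩ := r1
    obtain ⟨c0, c1, c2, c3, c4, c5, c6⟩ := r2
    obtain ⟨d0, d1, d2, d3, d4, d5, d6⟩ := r3
    obtain ⟨f0, f1, f2, f3, f4, f5, f6⟩ := r4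
    obtain ⟨g0, g1, g2, g3, g4, g5, g6⟩ := r5
    obtain ⟨m0, m1, m2, m3, m4, m5, m6⟩ := r6
    have R0 := hR' 0
    have R1 := hR' 1
    have R2 := hR' 2
    have R3 := hR' 3
    have R4 := hR' 4
    have R5 := hR' 5
    have R6 := hR' 6
    clear hR' h1 h2 hn hA hα hR
    simp at R0 R1 R2 R3 R4 R5 R6
    -- Seven of the 35 components belong to the lines of φ and vanish. The other 28 fall into groups
    -- of four, one group for each `R j`; `R j` is the signed mean of its group, and the relations
    -- make the four entries equal up to sign. Hence each is ±`R j` plus a quarter of three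
    -- relations.
    fin_cases i <;> fin_cases j <;> (try exact absurd hij (by decide)) <;> fin_cases k <;>
      (try exact absurd hjk (by decide)) <;> simp [starC, quadruple, triple]
    · linear_combination R5 + 1/4 * c6 - 1/4 * a4 + 1/4 * b1
    · linear_combination a0
    · linear_combination -R6 - 1/4 * f2 - 1/4 * a5 - 1/4 * b4
    · linear_combination -R2 + 1/4 * g1 + 1/4 * b3 + 1/4 * a2
    · linear_combination R4 - 1/4 * m4 + 1/4 * a1 + 1/4 * b6
    · linear_combination -R4 + 1/4 * c2 + 1/4 * a1 + 1/4 * d3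
    · linear_combination R3 - 1/4 * a6 + 1/4 * c3 - 1/4 * f5
    · linear_combination R1 + 1/4 * a3 - 1/4 * c5 - 1/4 * g6
    · linear_combination m0
    · linear_combination -R2 - 1/4 * f4 - 1/4 * a2 - 1/4 * d5
    · linear_combination R6 + 1/4 * g3 - 1/4 * a5 - 1/4 * d6
    · linear_combination -R5 - 1/4 * m5 - 1/4 * a4 - 1/4 * d2
    · linear_combination f0
    · linear_combination -R1 + 1/4 * a3 + 1/4 * m2 + 1/4 * f1
    · linear_combination R3 + 1/4 * m1 + 1/4 * a6 - 1/4 * g4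
    · linear_combination R6 + 1/4 * c1 + 1/4 * d6 - 1/4 * b4
    · linear_combination b0
    · linear_combination -R0 - 1/4 * g2 - 1/4 * b5 - 1/4 * c4
    · linear_combination -R3 + 1/4 * m1 + 1/4 * c3 + 1/4 * b2
    · linear_combination -R5 + 1/4 * f3 + 1/4 * d2 + 1/4 * b1
    · linear_combination R4 - 1/4 * g5 - 1/4 * b6 + 1/4 * d3
    · linear_combination R2 - 1/4 * m6 + 1/4 * b3 - 1/4 * d5
    · linear_combination -R3 - 1/4 * g4 - 1/4 * b2 - 1/4 * f5
    · linear_combination R0 + 1/4 * m3 - 1/4 * b5 - 1/4 * f6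
    · linear_combination g0
    · linear_combination R0 + 1/4 * d1 + 1/4 * f6 - 1/4 * c4
    · linear_combination c0
    · linear_combination -R1 - 1/4 * m2 - 1/4 * c5 - 1/4 * d4
    · linear_combination -R6 + 1/4 * g3 + 1/4 * f2 + 1/4 * c1
    · linear_combination R5 - 1/4 * m5 - 1/4 * c6 + 1/4 * f3
    · linear_combination -R4 - 1/4 * m4 - 1/4 * c2 - 1/4 * g5
    · linear_combination R1 + 1/4 * f1 + 1/4 * g6 - 1/4 * d4
    · linear_combination d0
    · linear_combination -R0 + 1/4 * m3 + 1/4 * g2 + 1/4 * d1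
    · linear_combination R2 + 1/4 * g1 + 1/4 * m6 - 1/4 * f4
  rw [key]
  rfl

end SevenForms

/-! ### Three-forms along maps, and the exterior derivative as an alternating form. -/

section ThreeForms

variable {d' : ℕ} {N : Type*} [TopologicalSpace N] [ChartedSpace (𝔼 d') N]
  [IsManifold (𝓡 d') ∞ N] [RiemannianBundle (fun x : N => TangentSpace (𝓡 d') x)]
  {d : ℕ} {M : Type*} [TopologicalSpace M] [ChartedSpace (𝔼 d) M] [IsManifold (𝓡 d) ∞ M]

theorem IsSmoothTensor.mdifferentiableAt {k : ℕ} {α : CovTensor d' N k} (h : IsSmoothTensor α)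
    (p : N) (w : Fin k → TangentSpace (𝓡 d') p) :
    MDifferentiableAt (𝓡 d') 𝓘(ℝ, ℝ) (component α p w) p :=
  (h p w).mdifferentiableAt (by simp)

/-- The Leibniz rule for a three-form along a map. -/
theorem mvfderiv_threeForm_along (φ : ∀ y : N, (TangentSpace (𝓡 d') y) [⋀^Fin 3]→ₗ[ℝ] ℝ)
    (f : M → N) (p : M) (hf : MDifferentiableAt (𝓡 d) (𝓡 d') f p)
    (hφ : ∀ w, MDifferentiableAt (𝓡 d') 𝓘(ℝ, ℝ) (component (fun y => ⇑(φ y)) (f p) w) (f p))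
    {X Y Z : ∀ q, TangentSpace (𝓡 d') (f q)} (hX : DiffAlong d f X p) (hY : DiffAlong d f Y p)
    (hZ : DiffAlong d f Z p) (u : TangentSpace (𝓡 d) p) :
    MDifferentiableAt (𝓡 d) 𝓘(ℝ, ℝ) (fun q => φ (f q) ![X q, Y q, Z q]) p ∧
    mvfderiv (𝓡 d) (fun q => φ (f q) ![X q, Y q, Z q]) p u =
      nabla (fun y => ⇑(φ y)) (f p) (mfderiv (𝓡 d) (𝓡 d') f p u) ![X p, Y p, Z p] +
        (φ (f p) ![nablaAlong f X p u, Y p, Z p] + φ (f p) ![X p, nablaAlong f Y p u, Z p] +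
          φ (f p) ![X p, Y p, nablaAlong f Z p u]) := by
  have h := mvfderiv_tensor_along (fun y => (φ y).toMultilinearMap) f p hf hφ
    (Fin.cons X (Fin.cons Y (fun _ => Z))) (by intro i; fin_cases i; exacts [hX, hY, hZ]) u
  have e1 : ∀ q, (fun i : Fin 3 => (Fin.cons X (Fin.cons Y (fun _ => Z)) :
      Fin 3 → ∀ q, TangentSpace (𝓡 d') (f q)) i q) = ![X q, Y q, Z q] := by
    intro q; ext i; fin_cases i <;> rfl
  simp only [e1] at h
  refine ⟨h.1, h.2.trans ?_⟩
  rw [Fin.sum_univ_three]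
  congr 2
  · congr 1
    · change φ (f p) _ = φ (f p) _
      congr 1; ext i; fin_cases i <;> rfl
    · change φ (f p) _ = φ (f p) _
      congr 1; ext i; fin_cases i <;> rfl
  · change φ (f p) _ = φ (f p) _
    congr 1; ext i; fin_cases i <;> rfl

theorem nabla_three (α : CovTensor d' N 3) (p : N) (u a b c : TangentSpace (𝓡 d') p) :
    nabla α p u ![a, b, c] = mvfderiv (𝓡 d') (component α p ![a, b, c]) p u -
      (α p ![christoffel p u a, b, c] + α p ![a, christoffel p u b, c] +
        α p ![a, b, christoffel p u c]) := by
  rw [nabla, Fin.sum_univ_three]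
  congr 2
  · congr 1
    · congr 1; ext i; fin_cases i <;> rfl
    · congr 1; ext i; fin_cases i <;> rfl
  · congr 1; ext i; fin_cases i <;> rfl

theorem nabla_two (α : CovTensor d' N 2) (p : N) (u a b : TangentSpace (𝓡 d') p) :
    nabla α p u ![a, b] = mvfderiv (𝓡 d') (component α p ![a, b]) p u -
      (α p ![christoffel p u a, b] + α p ![a, christoffel p u b]) := by
  rw [nabla, Fin.sum_univ_two]
  congr 2
  · congr 1; ext i; fin_cases i <;> rfl
  · congr 1; ext i; fin_cases i <;> rfl

variable [IsContMDiffRiemannianBundle (𝓡 d') ∞ (𝔼 d') (fun x : N => TangentSpace (𝓡 d') x)]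

/-- The exterior derivative in terms of the Levi-Civita derivative. -/
theorem extDer_threeForm (φ : ∀ y : N, (TangentSpace (𝓡 d') y) [⋀^Fin 3]→ₗ[ℝ] ℝ) (p : N)
    (a b c x : TangentSpace (𝓡 d') p) :
    extDer (fun y => ⇑(φ y)) p ![a, b, c, x] =
      nabla (fun y => ⇑(φ y)) p a ![b, c, x] - nabla (fun y => ⇑(φ y)) p b ![a, c, x] +
      nabla (fun y => ⇑(φ y)) p c ![a, b, x] - nabla (fun y => ⇑(φ y)) p x ![a, b, c] := by
  have h0 : (fun j => (![a, b, c, x] : Fin 4 → TangentSpace (𝓡 d') p) (Fin.succAbove 0 j)) =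
      ![b, c, x] := by ext i; fin_cases i <;> rfl
  have h1 : (fun j => (![a, b, c, x] : Fin 4 → TangentSpace (𝓡 d') p) (Fin.succAbove 1 j)) =
      ![a, c, x] := by ext i; fin_cases i <;> rfl
  have h2 : (fun j => (![a, b, c, x] : Fin 4 → TangentSpace (𝓡 d') p) (Fin.succAbove 2 j)) =
      ![a, b, x] := by ext i; fin_cases i <;> rfl
  have h3 : (fun j => (![a, b, c, x] : Fin 4 → TangentSpace (𝓡 d') p) (Fin.succAbove 3 j)) =
      ![a, b, c] := by ext i; fin_cases i <;> rfl
  have l := alternating_swap_left (φ p)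
  have r := alternating_swap_right (φ p)
  have cy : ∀ u v w, φ p ![u, v, w] = φ p ![w, u, v] := fun u v w => by
    rw [r, l, neg_neg]
  rw [extDer, Fin.sum_univ_four, h0, h1, h2, h3]
  -- The connection is torsion-free: once the lower indices are ordered, the Christoffel terms
  -- cancel in pairs by skew-symmetry.
  simp only [nabla_three, christoffel_comm p b a, christoffel_comm p c a,
    christoffel_comm p c b, christoffel_comm p x a, christoffel_comm p x b, christoffel_comm p x c]
  have e1 := l a (christoffel p a b)
  have s1 := l (christoffel p a c) b x
  have s2 := cy b c (christoffel p a x)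
  have s3 := l (christoffel p b c) a x
  have s4 := cy a c (christoffel p b x)
  have s5 := r a (christoffel p b c) x
  have s6 := cy a b (christoffel p c x)
  have s7 := l (christoffel p b x) a c
  simp
  linarith

/-- The covariant derivative of a three-form, as a linear map of the direction. -/
noncomputable def nablaAltMap (φ : ∀ y : N, (TangentSpace (𝓡 d') y) [⋀^Fin 3]→ₗ[ℝ] ℝ) (p : N)
    (hφ : ∀ w, MDifferentiableAt (𝓡 d') 𝓘(ℝ, ℝ) (component (fun y => ⇑(φ y)) p w) p) :
    TangentSpace (𝓡 d') p →ₗ[ℝ] (TangentSpace (𝓡 d') p) [⋀^Fin 3]→ₗ[ℝ] ℝ where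
  toFun u := nablaAlt φ p hφ u
  map_add' u v := by
    ext w
    rw [AlternatingMap.add_apply, nablaAlt_coe, nablaAlt_coe, nablaAlt_coe]
    exact nabla_add (fun y => (φ y).toMultilinearMap) p u v w
  map_smul' c u := by
    ext w
    rw [AlternatingMap.smul_apply, nablaAlt_coe, nablaAlt_coe, smul_eq_mul]
    exact nabla_smul (fun y => (φ y).toMultilinearMap) p c u w

/-- The exterior derivative of a three-form as an alternating map. -/
noncomputable def extDerAlt (φ : ∀ y : N, (TangentSpace (𝓡 d') y) [⋀^Fin 3]→ₗ[ℝ] ℝ) (p : N)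
    (hφ : ∀ w, MDifferentiableAt (𝓡 d') 𝓘(ℝ, ℝ) (component (fun y => ⇑(φ y)) p w) p) :
    (TangentSpace (𝓡 d') p) [⋀^Fin 4]→ₗ[ℝ] ℝ :=
  AlternatingMap.alternatizeUncurryFin (nablaAltMap φ p hφ)

/-- The Hodge identities are stated for alternating maps, whereas `extDer` is a bare function of
four vectors. -/
theorem extDerAlt_coe (φ : ∀ y : N, (TangentSpace (𝓡 d') y) [⋀^Fin 3]→ₗ[ℝ] ℝ) (p : N)
    (hφ : ∀ w, MDifferentiableAt (𝓡 d') 𝓘(ℝ, ℝ) (component (fun y => ⇑(φ y)) p w) p) :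
    extDer (fun y => ⇑(φ y)) p = ⇑(extDerAlt φ p hφ) := by
  ext v
  have hv : v = ![v 0, v 1, v 2, v 3] := by ext i; fin_cases i <;> rfl
  rw [hv, extDer_threeForm, extDerAlt, AlternatingMap.alternatizeUncurryFin_apply,
    Fin.sum_univ_four]
  generalize v 0 = a
  generalize v 1 = b
  generalize v 2 = c
  generalize v 3 = x
  have h0 : (0 : Fin 4).removeNth (![a, b, c, x] : Fin 4 → TangentSpace (𝓡 d') p) =
      ![b, c, x] := by ext i; fin_cases i <;> rfl
  have h1 : (1 : Fin 4).removeNth (![a, b, c, x] : Fin 4 → TangentSpace (𝓡 d') p) =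
      ![a, c, x] := by ext i; fin_cases i <;> rfl
  have h2 : (2 : Fin 4).removeNth (![a, b, c, x] : Fin 4 → TangentSpace (𝓡 d') p) =
      ![a, b, x] := by ext i; fin_cases i <;> rfl
  have h3 : (3 : Fin 4).removeNth (![a, b, c, x] : Fin 4 → TangentSpace (𝓡 d') p) =
      ![a, b, c] := by ext i; fin_cases i <;> rfl
  have hA : ∀ u w, nablaAltMap φ p hφ u w = nabla (fun y => ⇑(φ y)) p u w :=
    fun u w => nablaAlt_coe φ p hφ u w
  rw [h0, h1, h2, h3]
  simp [hA]
  ring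

end ThreeForms

/-! ### The derivative of φ has no component off the forms v ⌟ ∗φ. -/

section G2

variable {N : Type*} [TopologicalSpace N] [ChartedSpace (𝔼 7) N] [IsManifold (𝓡 7) ∞ N]
  [RiemannianBundle (fun x : N => TangentSpace (𝓡 7) x)]
  [IsContMDiffRiemannianBundle (𝓡 7) ∞ (𝔼 7) (fun x : N => TangentSpace (𝓡 7) x)]

/-- A polarised form of |P(x, y)|² = |x|²|y|² - ⟨x, y⟩²; it evaluates the terms in which the
derivative falls on an argument of φ. -/
theorem inner_cross_same {V : Type*} [NormedAddCommGroup V] [InnerProductSpace ℝ V]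
    [FiniteDimensional ℝ V] {φ : V [⋀^Fin 3]→ₗ[ℝ] ℝ}
    (hφ : ∃ e : OrthonormalBasis (Fin 7) ℝ V, IsCayleyFrame φ e) (a x y : V) :
    φ ![a, y, cross φ x y] = ⟪a, x⟫ * ⟪y, y⟫ - ⟪a, y⟫ * ⟪x, y⟫ := by
  rw [← inner_cross, inner_cross_cycle, cross_anticomm φ y x, ← crossMap_apply, map_neg,
    crossMap_apply, cross_cross hφ, inner_neg_right, inner_sub_right, real_inner_smul_right,
    real_inner_smul_right, real_inner_comm x y]
  ring

/-- The derivative of the three-form of a `G₂`-structure is orthogonal to all `(x, y, P(x, y))`. -/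
theorem nabla_cross_eq_zero {φ : ∀ x : N, (TangentSpace (𝓡 7) x) [⋀^Fin 3]→ₗ[ℝ] ℝ}
    (hφ : IsG2Structure φ) (p : N) (u x y : TangentSpace (𝓡 7) p) :
    nabla (fun y => ⇑(φ y)) p u ![x, y, cross (φ p) x y] = 0 := by
  set X : ∀ q : N, TangentSpace (𝓡 7) q := fun q => FiberBundle.extend (𝔼 7) x q with hX
  set Y : ∀ q : N, TangentSpace (𝓡 7) q := fun q => FiberBundle.extend (𝔼 7) y q with hY
  set P : ∀ q : N, TangentSpace (𝓡 7) q := fun q => cross (φ q) (X q) (Y q) with hP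
  have hXp : X p = x := FiberBundle.extend_apply_self _ _
  have hYp : Y p = y := FiberBundle.extend_apply_self _ _
  have hPp : P p = cross (φ p) x y := by rw [hP]; simp only [hXp, hYp]
  have hid : MDifferentiableAt (𝓡 7) (𝓡 7) (fun q : N => q) p := mdifferentiableAt_id
  have hdX : DiffAlong 7 (fun q : N => q) X p := diffAlong_extend p x
  have hdY : DiffAlong 7 (fun q : N => q) Y p := diffAlong_extend p y
  have hsm := hφ.smooth.mdifferentiableAt p
  have hdP : DiffAlong 7 (fun q : N => q) P p := by
    refine diffAlong_of_inner P p fun w => ?_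
    have h := (mvfderiv_threeForm_along φ (fun q : N => q) p hid hsm hdX hdY
      (diffAlong_extend p w) u).1
    simpa only [hP, inner_cross] using h
  have hidu : mfderiv (𝓡 7) (𝓡 7) (fun q : N => q) p u = u := congrArg (fun L => L u) mfderiv_id
  obtain ⟨a, ha⟩ : ∃ a, a = nablaAlong (fun q : N => q) X p u := ⟨_, rfl⟩
  obtain ⟨b, hb⟩ : ∃ b, b = nablaAlong (fun q : N => q) Y p u := ⟨_, rfl⟩
  obtain ⟨c, hc⟩ : ∃ c, c = nablaAlong (fun q : N => q) P p u := ⟨_, rfl⟩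
  have h1 := (mvfderiv_threeForm_along φ (fun q : N => q) p hid hsm hdX hdY hdP u).2
  have h2 := (mvfderiv_inner_along (fun q : N => q) p hid P P hdP hdP u).2
  have hXX := mvfderiv_inner_along (fun q : N => q) p hid X X hdX hdX u
  have hXY := mvfderiv_inner_along (fun q : N => q) p hid X Y hdX hdY u
  have hYY := mvfderiv_inner_along (fun q : N => q) p hid Y Y hdY hdY u
  rw [← ha, ← hb, ← hc, hidu, hXp, hYp, hPp] at h1
  rw [← hc, hPp] at h2
  rw [← ha, hXp] at hXX
  rw [← ha, ← hb, hXp, hYp] at hXY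
  rw [← hb, hYp] at hYY
  -- The function |P|² is differentiated in three ways. As ⟨P, P⟩ it gives twice ⟨P, c⟩; as φ(X, Y,
  -- P) it gives ∇φ, two algebraic terms and ⟨P, c⟩; as |X|²|Y|² - ⟨X, Y⟩² it gives twice those
  -- algebraic terms. Comparison leaves ∇φ = 0.
  have e1 : (fun q => φ q ![X q, Y q, P q]) = fun q => ⟪P q, P q⟫ := by
    ext q; rw [← inner_cross]
  have e2 : (fun q => ⟪P q, P q⟫) = fun q => ⟪X q, X q⟫ * ⟪Y q, Y q⟫ - ⟪X q, Y q⟫ * ⟪X q, Y q⟫ := by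
    ext q
    rw [hP]
    simp only
    rw [inner_cross, inner_cross_same (hφ.cayley q)]
  have h3 : mvfderiv (𝓡 7) (fun q => ⟪P q, P q⟫) p u =
      (⟪x, x⟫ * (⟪b, y⟫ + ⟪y, b⟫) + ⟪y, y⟫ * (⟪a, x⟫ + ⟪x, a⟫))
      - (⟪x, y⟫ * (⟪a, y⟫ + ⟪x, b⟫) + ⟪x, y⟫ * (⟪a, y⟫ + ⟪x, b⟫)) := by
    rw [e2]
    rw [mvfderiv_fun_sub (g := fun q => ⟪X q, X q⟫ * ⟪Y q, Y q⟫)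
      (g' := fun q => ⟪X q, Y q⟫ * ⟪X q, Y q⟫) (hXX.1.mul hYY.1) (hXY.1.mul hXY.1), mvfderiv_fun_mul hXX.1 hYY.1,
      mvfderiv_fun_mul hXY.1 hXY.1]
    simp only [sub_apply, add_apply, smul_apply, smul_eq_mul, hXX.2, hXY.2, hYY.2, hXp, hYp]
  rw [e1, h2] at h1
  rw [h2] at h3
  have h4 := inner_cross_same (hφ.cayley p) a x y
  have h5 := inner_cross_same (hφ.cayley p) b y x
  have h6 : φ p ![x, b, cross (φ p) x y] = φ p ![b, x, cross (φ p) y x] := by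
    rw [cross_anticomm, ← inner_cross, inner_neg_right, inner_cross, alternating_swap_left, neg_neg]
  have h7 : φ p ![x, y, c] = ⟪cross (φ p) x y, c⟫ := (inner_cross _ _ _ _).symm
  rw [h6, h5, h4, h7] at h1
  simp only [real_inner_comm x y, real_inner_comm a x, real_inner_comm b y, real_inner_comm b x,
    real_inner_comm c (cross (φ p) x y)] at h1 h3
  linarith

end G2

theorem starC_add (x x' y z w : Fin 7 → ℝ) :
    starC (x + x') y z w = starC x y z w + starC x' y z w := by
  simp [starC, quadruple, triple]; ring

theorem starC_smul (c : ℝ) (x y z w : Fin 7 → ℝ) :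
    starC (c • x) y z w = c * starC x y z w := by
  simp [starC, quadruple, triple]; ring

/-- Contraction with φ picks the components of α on the seven lines, each with coefficient one. -/
theorem sum_mul_phiC {V : Type*} [NormedAddCommGroup V] [InnerProductSpace ℝ V]
    [FiniteDimensional ℝ V] (α : V [⋀^Fin 3]→ₗ[ℝ] ℝ) (e : OrthonormalBasis (Fin 7) ℝ V) :
    (1 / 6 : ℝ) * ∑ g : Fin 3 → Fin 7,
      phiC (coords e (e (g 0))) (coords e (e (g 1))) (coords e (e (g 2))) *
        α (fun i => e (g i)) =
    α ![e 0, e 1, e 3] + α ![e 1, e 2, e 4] + α ![e 2, e 3, e 5] + α ![e 3, e 4, e 6]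
      + α ![e 4, e 5, e 0] + α ![e 5, e 6, e 1] + α ![e 6, e 0, e 2] := by
  have h6 : ∀ a b c, α ![e a, e b, e c] = (1 / 6 : ℝ) * ∑ g : Fin 3 → Fin 7,
      α (fun i => e (g i)) *
      triple (coords e (e (g 0))) (coords e (e (g 1))) (coords e (e (g 2))) a b c := by
    intro a b c
    rw [sum_mul_triple]
    ring
  simp only [h6, Finset.mul_sum, ← Finset.sum_add_distrib]
  refine Finset.sum_congr rfl fun g _ => ?_
  rw [phiC]
  ring

/-! ### The tensor r̄(φ) determines ∇φ and p d*φ. -/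

section G2

variable {N : Type*} [TopologicalSpace N] [ChartedSpace (𝔼 7) N] [IsManifold (𝓡 7) ∞ N]
  [RiemannianBundle (fun x : N => TangentSpace (𝓡 7) x)]
  [IsContMDiffRiemannianBundle (𝓡 7) ∞ (𝔼 7) (fun x : N => TangentSpace (𝓡 7) x)]
  {φ : ∀ x : N, (TangentSpace (𝓡 7) x) [⋀^Fin 3]→ₗ[ℝ] ℝ}

theorem interior_starForm_apply {V : Type*} [NormedAddCommGroup V] [InnerProductSpace ℝ V]
    [FiniteDimensional ℝ V] {φ : V [⋀^Fin 3]→ₗ[ℝ] ℝ} {e : OrthonormalBasis (Fin 7) ℝ V}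
    (h : IsCayleyFrame φ e) (y : V) (w : Fin 3 → V) :
    interior y (starForm φ) w =
      starC (coords e y) (coords e (w 0)) (coords e (w 1)) (coords e (w 2)) := by
  have : (Fin.cons y w : Fin 4 → V) = ![y, w 0, w 1, w 2] := by
    ext i; fin_cases i <;> rfl
  rw [interior, this, starForm_apply h]

/-- The tensor `r̄(φ)` as a bilinear map. -/
noncomputable def rG2Map (hφ : IsG2Structure φ) (p : N) :
    TangentSpace (𝓡 7) p →ₗ[ℝ] TangentSpace (𝓡 7) p →ₗ[ℝ] ℝ :=
  LinearMap.mk₂ ℝ (rG2 (fun x => ⇑(φ x)) p)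
    (fun u v y => by
      simp only [rG2, formInner, nabla_add (fun y => (φ y).toMultilinearMap) p u v, add_mul,
        Finset.sum_add_distrib, mul_add,
        show ∀ u, nabla (fun x => ⇑(φ x)) p u = nabla (fun y => ⇑(φ y).toMultilinearMap) p u
          from fun _ => rfl])
    (fun c u y => by
      simp only [rG2, formInner, nabla_smul (fun y => (φ y).toMultilinearMap) p c u, smul_eq_mul,
        show ∀ u, nabla (fun x => ⇑(φ x)) p u = nabla (fun y => ⇑(φ y).toMultilinearMap) p u
          from fun _ => rfl, mul_assoc, ← Finset.mul_sum]
      ring)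
    (fun u y z => by
      obtain ⟨e, he⟩ := hφ.cayley p
      have h : ∀ w, interior (y + z) (starForm (φ p)) w =
          interior y (starForm (φ p)) w + interior z (starForm (φ p)) w := fun w => by
        rw [interior_starForm_apply he, interior_starForm_apply he, interior_starForm_apply he,
          ← starC_add]
        congr 1
        exact map_add (coordsMap e) y z
      simp only [rG2, formInner, h, mul_add, Finset.sum_add_distrib])
    (fun c u y => by
      obtain ⟨e, he⟩ := hφ.cayley p
      have h : ∀ w, interior (c • y) (starForm (φ p)) w =
          c * interior y (starForm (φ p)) w := fun w => by
        rw [interior_starForm_apply he, interior_starForm_apply he, ← starC_smul]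
        congr 1
        exact map_smul (coordsMap e) c y
      simp only [rG2, formInner, h, mul_left_comm _ c, ← Finset.mul_sum, smul_eq_mul])

/-- The derivative of the three-form is determined by `r̄(φ)`. -/
theorem nabla_eq_starC (hφ : IsG2Structure φ) {p : N}
    {e : OrthonormalBasis (Fin 7) ℝ (TangentSpace (𝓡 7) p)} (he : IsCayleyFrame (φ p) e)
    (u x y z : TangentSpace (𝓡 7) p) :
    nabla (fun y => ⇑(φ y)) p u ![x, y, z] =
      starC (fun j => rG2Map hφ p u (e j)) (coords e x) (coords e y) (coords e z) := by
  have hsm := hφ.smooth.mdifferentiableAt p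
  have h := eq_starC_of_cross he (α := nablaAlt φ p hsm u) (R := fun j => rG2Map hφ p u (e j))
    (fun x y => by rw [nablaAlt_coe, nabla_cross_eq_zero hφ])
    (fun j => by
      rw [show ⇑(nablaAlt φ p hsm u) = nabla (fun y => ⇑(φ y)) p u from
        funext fun w => nablaAlt_coe φ p hsm u w]
      rfl) x y z
  rw [← h, nablaAlt_coe]

/-- The one-form `p d*φ` in terms of `r̄(φ)`. -/
theorem pdStar_eq (hφ : IsG2Structure φ) {p : N}
    {e : OrthonormalBasis (Fin 7) ℝ (TangentSpace (𝓡 7) p)} (he : IsCayleyFrame (φ p) e)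
    (x : TangentSpace (𝓡 7) p) :
    pdStar (fun y => ⇑(φ y)) p x = -2 * ∑ i, ∑ j, rG2Map hφ p (e i) (e j) *
      phiC (Pi.single i 1) (Pi.single j 1) (coords e x) := by
  have hsm := hφ.smooth.mdifferentiableAt p
  -- The volume form comes from a frame `f` that need not be `e`. The star acts twice, and the value
  -- found by `hodge_wedge_hodge` no longer involves `f`.
  obtain ⟨f, -, hv⟩ := exists_cayleyVol (hφ.cayley p)
  have h1 : pdStar (fun y => ⇑(φ y)) p x = (1 / 6 : ℝ) * ∑ g : Fin 3 → Fin 7,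
      phiC (coords e (e (g 0))) (coords e (e (g 1))) (coords e (e (g 2))) *
        appendLeft (p := 3) (q := 1) (extDerAlt φ p hsm) ![x] (fun i => e (g i)) := by
    rw [pdStar, hv, extDerAlt_coe φ p hsm, hodge_wedge_hodge f (extDerAlt φ p hsm) (φ p) e x]
    congr 1
    refine Finset.sum_congr rfl fun g _ => ?_
    rw [← he.apply, appendLeft_apply]
    congr 2
    ext i; fin_cases i <;> rfl
  have h2 : ∀ a b c, appendLeft (p := 3) (q := 1) (extDerAlt φ p hsm) ![x] ![a, b, c] =
      nabla (fun y => ⇑(φ y)) p a ![b, c, x] - nabla (fun y => ⇑(φ y)) p b ![a, c, x] +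
      nabla (fun y => ⇑(φ y)) p c ![a, b, x] - nabla (fun y => ⇑(φ y)) p x ![a, b, c] := by
    intro a b c
    rw [appendLeft_apply, ← extDer_threeForm, extDerAlt_coe φ p hsm]
    congr 1
    ext i; fin_cases i <;> rfl
  rw [h1, sum_mul_phiC]
  simp only [h2, nabla_eq_starC hφ he, coords_basis]
  generalize coords e x = X
  obtain ⟨R, hR⟩ : ∃ R : Fin 7 → Fin 7 → ℝ, ∀ i j, rG2Map hφ p (e i) (e j) = R i j :=
    ⟨_, fun _ _ => rfl⟩
  simp only [hR]
  simp only [Fin.sum_univ_seven]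
  simp [starC, quadruple, triple, phiC]
  ring

end G2

/-! ### The Gauss and Weingarten formulas. -/

section Hypersurface

variable {N : Type*} [TopologicalSpace N] [ChartedSpace (𝔼 7) N] [IsManifold (𝓡 7) ∞ N]
  [RiemannianBundle (fun x : N => TangentSpace (𝓡 7) x)]
  [IsContMDiffRiemannianBundle (𝓡 7) ∞ (𝔼 7) (fun x : N => TangentSpace (𝓡 7) x)]
  {M : Type*} [TopologicalSpace M] [ChartedSpace (𝔼 6) M] [IsManifold (𝓡 6) ∞ M]
  [RiemannianBundle (fun x : M => TangentSpace (𝓡 6) x)]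
  [IsContMDiffRiemannianBundle (𝓡 6) ∞ (𝔼 6) (fun x : M => TangentSpace (𝓡 6) x)]
  {ι : M → N} {n : ∀ x : M, TangentSpace (𝓡 7) (ι x)}

/-- The ambient derivative of the push-forward of the coordinate field extending `v`. -/
noncomputable def pushDeriv (ι : M → N) (p : M) (u v : TangentSpace (𝓡 6) p) :
    TangentSpace (𝓡 7) (ι p) :=
  nablaAlong ι (fun q => push ι q (FiberBundle.extend (𝔼 6) v q)) p u

theorem finrank_tangentSpace (d : ℕ) {X : Type*} [TopologicalSpace X] [ChartedSpace (𝔼 d) X]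
    (x : X) : finrank ℝ (TangentSpace (𝓡 d) x) = d :=
  finrank_euclideanSpace_fin (𝕜 := ℝ) (n := d)

theorem extend_self {d : ℕ} {X : Type*} [TopologicalSpace X] [ChartedSpace (𝔼 d) X]
    [IsManifold (𝓡 d) ∞ X] (p : X) (v : TangentSpace (𝓡 d) p) :
    FiberBundle.extend (𝔼 d) v p = v := FiberBundle.extend_apply_self _ _

theorem mfderiv_fun_id {d : ℕ} {X : Type*} [TopologicalSpace X] [ChartedSpace (𝔼 d) X]
    (p : X) (u : TangentSpace (𝓡 d) p) : mfderiv (𝓡 d) (𝓡 d) (fun q : X => q) p u = u :=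
  congrArg (fun L => L u) mfderiv_id


/-- A vector orthogonal to `n` is tangent to the hypersurface. -/
theorem IsHypersurface.exists_push (hι : IsHypersurface ι n) (p : M)
    {y : TangentSpace (𝓡 7) (ι p)} (hy : ⟪n p, y⟫ = 0) : ∃ v, push ι p v = y := by
  have hinj : Function.Injective (push ι p : TangentSpace (𝓡 6) p →ₗ[ℝ] TangentSpace (𝓡 7) (ι p)) := by
    rw [← LinearMap.ker_eq_bot, LinearMap.ker_eq_bot']
    intro v hv
    have := hι.isometric p v v
    rw [show push ι p v = 0 from hv, inner_zero_left] at this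
    exact inner_self_eq_zero.1 this.symm
  have hn : n p ≠ 0 := fun h => by simpa [h] using hι.unit p
  have : Fact (finrank ℝ (TangentSpace (𝓡 7) (ι p)) = 6 + 1) := ⟨finrank_tangentSpace 7 _⟩
  have hle : LinearMap.range (push ι p : TangentSpace (𝓡 6) p →ₗ[ℝ] TangentSpace (𝓡 7) (ι p)) ≤
      (ℝ ∙ n p)ᗮ := by
    rintro _ ⟨v, rfl⟩
    rw [Submodule.mem_orthogonal_singleton_iff_inner_right]
    exact hι.normal p v
  have heq := Submodule.eq_of_le_of_finrank_eq hle (by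
    rw [Submodule.finrank_orthogonal_span_singleton (n := 6) hn, LinearMap.finrank_range_of_inj hinj,
      finrank_tangentSpace])
  have hm : y ∈ (ℝ ∙ n p)ᗮ := (Submodule.mem_orthogonal_singleton_iff_inner_right).2 hy
  rw [← heq] at hm
  exact hm

/-- The difference of the two vectors is orthogonal to `n`, hence tangent, and also orthogonal to
all tangent vectors. -/
theorem IsHypersurface.ext (hι : IsHypersurface ι n) (p : M) {y z : TangentSpace (𝓡 7) (ι p)}
    (h0 : ⟪y, n p⟫ = ⟪z, n p⟫) (h : ∀ w, ⟪y, push ι p w⟫ = ⟪z, push ι p w⟫) : y = z := by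
  rw [← sub_eq_zero]
  obtain ⟨v, hv⟩ := hι.exists_push p (y := y - z) (by
    rw [real_inner_comm, inner_sub_left, h0, sub_self])
  have : ⟪y - z, y - z⟫ = 0 := by
    nth_rewrite 2 [← hv]
    rw [inner_sub_left, h, sub_self]
  exact inner_self_eq_zero.1 this

theorem IsHypersurface.inner_normal (hι : IsHypersurface ι n) (p : M) : ⟪n p, n p⟫ = 1 := by
  rw [real_inner_self_eq_norm_sq, hι.unit]
  norm_num

theorem IsHypersurface.normal' (hι : IsHypersurface ι n) (p : M) (v : TangentSpace (𝓡 6) p) :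
    ⟪push ι p v, n p⟫ = 0 := by
  rw [real_inner_comm]
  exact hι.normal p v

theorem IsHypersurface.mdifferentiableAt (hι : IsHypersurface ι n) (p : M) :
    MDifferentiableAt (𝓡 6) (𝓡 7) ι p := hι.smooth.mdifferentiableAt (by simp)

theorem IsHypersurface.diffAlong_push (hι : IsHypersurface ι n) (p : M)
    (v : TangentSpace (𝓡 6) p) :
    DiffAlong 6 ι (fun q => push ι q (FiberBundle.extend (𝔼 6) v q)) p :=
  (mvfderiv_pushforward_extend ι hι.smooth p v).1

theorem IsHypersurface.diffAlong_normal (hι : IsHypersurface ι n) (p : M) : DiffAlong 6 ι n p :=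
  ((contMDiffAt_totalSpace.1 (hι.smooth_normal p)).2).mdifferentiableAt (by simp)

/-- The tangential part of the ambient derivative is the intrinsic one. -/
theorem IsHypersurface.inner_pushDeriv (hι : IsHypersurface ι n) (p : M)
    (u v w : TangentSpace (𝓡 6) p) :
    ⟪pushDeriv ι p u v, push ι p w⟫ = ⟪christoffel p u v, w⟫ := by
  -- Uniqueness of the Levi-Civita connection: the difference `t` is symmetric in its first two
  -- arguments (both connections are torsion-free) and skew in its last two (both are metric), and
  -- such a tensor vanishes.
  obtain ⟨t, ht⟩ : ∃ t : TangentSpace (𝓡 6) p → TangentSpace (𝓡 6) p → TangentSpace (𝓡 6) p → ℝ,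
      ∀ u v w, t u v w = ⟪pushDeriv ι p u v, push ι p w⟫ - ⟪christoffel p u v, w⟫ :=
    ⟨_, fun _ _ _ => rfl⟩
  have h1 : ∀ u v w, t u v w = t v u w := by
    intro u v w
    rw [ht, ht, christoffel_comm p u v, pushDeriv, nablaAlong_pushforward_comm ι hι.smooth]
    rfl
  have h2 : ∀ u v w, t u v w = -t u w v := by
    intro u v w
    have e1 := (mvfderiv_inner_along ι p (hι.mdifferentiableAt p) _ _ (hι.diffAlong_push p v)
      (hι.diffAlong_push p w) u).2
    have e2 := (mvfderiv_inner_along (fun q : M => q) p mdifferentiableAt_id _ _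
      (diffAlong_extend p v) (diffAlong_extend p w) u).2
    have e3 : (fun q => ⟪push ι q (FiberBundle.extend (𝔼 6) v q),
        push ι q (FiberBundle.extend (𝔼 6) w q)⟫) =
        fun q => ⟪FiberBundle.extend (𝔼 6) v q, FiberBundle.extend (𝔼 6) w q⟫ := by
      ext q
      rw [hι.isometric]
    rw [e3, e2] at e1
    rw [nablaAlong_extend, nablaAlong_extend] at e1
    simp only [extend_self] at e1
    rw [ht, ht, real_inner_comm v, real_inner_comm (push ι p v)]
    change _ = ⟪pushDeriv ι p u v, push ι p w⟫ + ⟪push ι p v, pushDeriv ι p u w⟫ at e1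
    linarith
  have h3 : t u v w = 0 := by
    linarith [h1 u v w, h2 v u w, h1 v w u, h2 w v u, h1 w u v, h2 u w v]
  rw [ht] at h3
  linarith

/-- The orthogonal projection in `secondFund` is invisible after pairing with `n`, which lies in the
space projected onto. -/
theorem IsHypersurface.scalarSecondFund_eq (hι : IsHypersurface ι n) (p : M)
    (u v : TangentSpace (𝓡 6) p) :
    scalarSecondFund ι n p u v = ⟪pushDeriv ι p u v, n p⟫ := by
  have hn : n p ∈ (LinearMap.range
      (push ι p : TangentSpace (𝓡 6) p →ₗ[ℝ] TangentSpace (𝓡 7) (ι p)))ᗮ := by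
    rw [Submodule.mem_orthogonal]
    rintro _ ⟨w, rfl⟩
    exact hι.normal' p w
  have := Submodule.starProjection_inner_eq_zero (K := (LinearMap.range
      (push ι p : TangentSpace (𝓡 6) p →ₗ[ℝ] TangentSpace (𝓡 7) (ι p)))ᗮ) (pushDeriv ι p u v) (n p) hn
  rw [inner_sub_left, sub_eq_zero] at this
  exact this.symm

/-- The Gauss formula. -/
theorem IsHypersurface.pushDeriv_eq (hι : IsHypersurface ι n) (p : M)
    (u v : TangentSpace (𝓡 6) p) :
    pushDeriv ι p u v = push ι p (christoffel p u v) + scalarSecondFund ι n p u v • n p := by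
  refine hι.ext p ?_ fun w => ?_
  · rw [inner_add_left, hι.normal', real_inner_smul_left, hι.inner_normal,
      hι.scalarSecondFund_eq]
    ring
  · rw [inner_add_left, real_inner_smul_left, hι.normal, hι.isometric, hι.inner_pushDeriv]
    ring

theorem IsHypersurface.scalarSecondFund_comm (hι : IsHypersurface ι n) (p : M)
    (u v : TangentSpace (𝓡 6) p) : scalarSecondFund ι n p u v = scalarSecondFund ι n p v u := by
  rw [hι.scalarSecondFund_eq, hι.scalarSecondFund_eq, pushDeriv,
    nablaAlong_pushforward_comm ι hι.smooth]
  rfl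

/-- The second fundamental form as a bilinear map. -/
noncomputable def IsHypersurface.secondFundMap (hι : IsHypersurface ι n) (p : M) :
    TangentSpace (𝓡 6) p →ₗ[ℝ] TangentSpace (𝓡 6) p →ₗ[ℝ] ℝ :=
  have ha : ∀ u v w, scalarSecondFund ι n p (u + v) w =
      scalarSecondFund ι n p u w + scalarSecondFund ι n p v w := fun u v w => by
    simp only [hι.scalarSecondFund_eq, pushDeriv, nablaAlong_add, inner_add_left]
  have hs : ∀ (c : ℝ) u w, scalarSecondFund ι n p (c • u) w =
      c • scalarSecondFund ι n p u w := fun c u w => by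
    simp only [hι.scalarSecondFund_eq, pushDeriv, nablaAlong_smul, real_inner_smul_left,
      smul_eq_mul]
  LinearMap.mk₂ ℝ (scalarSecondFund ι n p) ha hs
    (fun u v w => by simp only [hι.scalarSecondFund_comm p u, ha])
    (fun c u w => by simp only [hι.scalarSecondFund_comm p u, hs])

theorem IsHypersurface.secondFundMap_apply (hι : IsHypersurface ι n) (p : M)
    (u v : TangentSpace (𝓡 6) p) :
    hι.secondFundMap p u v = scalarSecondFund ι n p u v := rfl

/-- The derivative of the unit normal. -/
noncomputable def normalDeriv (ι : M → N) (n : ∀ x : M, TangentSpace (𝓡 7) (ι x)) (p : M)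
    (u : TangentSpace (𝓡 6) p) : TangentSpace (𝓡 7) (ι p) := nablaAlong ι n p u

theorem IsHypersurface.inner_normalDeriv_normal (hι : IsHypersurface ι n) (p : M)
    (u : TangentSpace (𝓡 6) p) : ⟪normalDeriv ι n p u, n p⟫ = 0 := by
  have e1 := (mvfderiv_inner_along ι p (hι.mdifferentiableAt p) _ _ (hι.diffAlong_normal p)
    (hι.diffAlong_normal p) u).2
  have e2 : (fun q => ⟪n q, n q⟫) = fun _ => (1 : ℝ) := funext hι.inner_normal
  rw [e2, mvfderiv_const] at e1
  have e3 : (0 : ℝ) = ⟪normalDeriv ι n p u, n p⟫ + ⟪n p, normalDeriv ι n p u⟫ := e1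
  rw [real_inner_comm (normalDeriv ι n p u)] at e3
  linarith

/-- The Weingarten formula. -/
theorem IsHypersurface.inner_normalDeriv_push (hι : IsHypersurface ι n) (p : M)
    (u v : TangentSpace (𝓡 6) p) :
    ⟪normalDeriv ι n p u, push ι p v⟫ = -scalarSecondFund ι n p u v := by
  have e1 := (mvfderiv_inner_along ι p (hι.mdifferentiableAt p) _ _ (hι.diffAlong_normal p)
    (hι.diffAlong_push p v) u).2
  have e2 : (fun q => ⟪n q, push ι q (FiberBundle.extend (𝔼 6) v q)⟫) = fun _ => (0 : ℝ) :=
    funext fun q => hι.normal q _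
  rw [e2, mvfderiv_const] at e1
  simp only [extend_self] at e1
  have e3 : (0 : ℝ) = ⟪normalDeriv ι n p u, push ι p v⟫ + ⟪n p, pushDeriv ι p u v⟫ := e1
  rw [hι.scalarSecondFund_eq, real_inner_comm (n p)]
  linarith

theorem normalDeriv_add (p : M) (u v : TangentSpace (𝓡 6) p) :
    normalDeriv ι n p (u + v) = normalDeriv ι n p u + normalDeriv ι n p v :=
  nablaAlong_add ι n p u v

theorem normalDeriv_smul (p : M) (c : ℝ) (u : TangentSpace (𝓡 6) p) :
    normalDeriv ι n p (c • u) = c • normalDeriv ι n p u := nablaAlong_smul ι n p c u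

/-- An orthonormal basis of the tangent space of a hypersurface, completed by the normal to a
Cayley frame. -/
theorem IsHypersurface.exists_adaptedFrame (hι : IsHypersurface ι n)
    {φ : ∀ x : N, (TangentSpace (𝓡 7) x) [⋀^Fin 3]→ₗ[ℝ] ℝ} (hφ : IsG2Structure φ) (p : M) :
    ∃ (e : OrthonormalBasis (Fin 7) ℝ (TangentSpace (𝓡 7) (ι p)))
      (f : OrthonormalBasis (Fin 6) ℝ (TangentSpace (𝓡 6) p)),
      IsCayleyFrame (φ (ι p)) e ∧ e 0 = n p ∧ ∀ i : Fin 6, push ι p (f i) = e i.succ := by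
  obtain ⟨e, he, he0⟩ := exists_cayleyFrame (hφ.cayley (ι p)) (hι.unit p)
  have ho := orthonormal_iff_ite.1 e.orthonormal
  have h1 : ∀ i : Fin 6, ∃ v, push ι p v = e i.succ := fun i => hι.exists_push p (by
    rw [← he0, ho, if_neg (Fin.succ_ne_zero i).symm])
  choose f hf using h1
  have hfo : Orthonormal ℝ f := by
    rw [orthonormal_iff_ite]
    intro i j
    rw [← hι.isometric, hf, hf, ho]
    simp
  have hcard : Fintype.card (Fin 6) = finrank ℝ (TangentSpace (𝓡 6) p) := by
    rw [finrank_tangentSpace]; rfl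
  have hsp : ⊤ ≤ Submodule.span ℝ (Set.range f) := by
    rw [LinearIndependent.span_eq_top_of_card_eq_finrank' hfo.linearIndependent hcard]
  refine ⟨e, OrthonormalBasis.mk hfo hsp, he, he0, fun i => ?_⟩
  rw [OrthonormalBasis.coe_mk, hf]

end Hypersurface

/-! ### The induced structure on the hypersurface and its derivatives. -/

section InducedStructure

variable {N : Type*} [TopologicalSpace N] [ChartedSpace (𝔼 7) N] [IsManifold (𝓡 7) ∞ N]
  [RiemannianBundle (fun x : N => TangentSpace (𝓡 7) x)]
  [IsContMDiffRiemannianBundle (𝓡 7) ∞ (𝔼 7) (fun x : N => TangentSpace (𝓡 7) x)]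
  {M : Type*} [TopologicalSpace M] [ChartedSpace (𝔼 6) M] [IsManifold (𝓡 6) ∞ M]
  [RiemannianBundle (fun x : M => TangentSpace (𝓡 6) x)]
  [IsContMDiffRiemannianBundle (𝓡 6) ∞ (𝔼 6) (fun x : M => TangentSpace (𝓡 6) x)]
  {ι : M → N} {n : ∀ x : M, TangentSpace (𝓡 7) (ι x)}
  {φ : ∀ x : N, (TangentSpace (𝓡 7) x) [⋀^Fin 3]→ₗ[ℝ] ℝ}

theorem inner_inducedI (p : M) (v w : TangentSpace (𝓡 6) p) :
    ⟪(inducedI (fun y => ⇑(φ y)) ι n) p v, w⟫ = φ (ι p) ![n p, push ι p v, push ι p w] := by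
  have h := inner_sharp (((innerSL ℝ (cross (φ (ι p)) (n p) (push ι p v))).comp
    (push ι p)).toLinearMap) w
  rw [← inner_cross]
  exact h

theorem IsHypersurface.push_inducedI (hι : IsHypersurface ι n) (p : M)
    (v : TangentSpace (𝓡 6) p) :
    push ι p ((inducedI (fun y => ⇑(φ y)) ι n) p v) = cross (φ (ι p)) (n p) (push ι p v) := by
  refine hι.ext p ?_ fun w => ?_
  · rw [hι.normal', inner_cross, alternating_swap_right, ← inner_cross, cross_self,
      inner_zero_left, neg_zero]
  · rw [hι.isometric, inner_inducedI, inner_cross]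

theorem IsHypersurface.push_injective (hι : IsHypersurface ι n) (p : M)
    {v w : TangentSpace (𝓡 6) p} (h : push ι p v = push ι p w) : v = w := by
  refine ext_inner_right ℝ fun z => ?_
  rw [← hι.isometric, h, hι.isometric]

theorem IsHypersurface.inducedI_inducedI (hι : IsHypersurface ι n) (hφ : IsG2Structure φ) (p : M)
    (v : TangentSpace (𝓡 6) p) : (inducedI (fun y => ⇑(φ y)) ι n) p ((inducedI (fun y => ⇑(φ y)) ι n) p v) = -v := by
  refine hι.push_injective p ?_
  rw [hι.push_inducedI, hι.push_inducedI, cross_cross (hφ.cayley _), hι.normal, hι.inner_normal,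
    map_neg]
  simp

theorem inner_inducedI_left (p : M) (v w : TangentSpace (𝓡 6) p) :
    ⟪(inducedI (fun y => ⇑(φ y)) ι n) p v, w⟫ = -⟪v, (inducedI (fun y => ⇑(φ y)) ι n) p w⟫ := by
  rw [real_inner_comm _ v, inner_inducedI, inner_inducedI, alternating_swap_right]

/-- The induced almost complex structure as a linear map. -/
noncomputable def inducedIMap (φ : ∀ x : N, (TangentSpace (𝓡 7) x) [⋀^Fin 3]→ₗ[ℝ] ℝ) (ι : M → N)
    (n : ∀ x : M, TangentSpace (𝓡 7) (ι x)) (p : M) :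
    TangentSpace (𝓡 6) p →ₗ[ℝ] TangentSpace (𝓡 6) p where
  toFun := (inducedI (fun y => ⇑(φ y)) ι n) p
  map_add' v w := by
    refine ext_inner_right ℝ fun z => ?_
    rw [inner_inducedI_left, inner_add_left, inner_add_left, inner_inducedI_left,
      inner_inducedI_left]
    ring
  map_smul' c v := by
    refine ext_inner_right ℝ fun z => ?_
    rw [inner_inducedI_left, RingHom.id_apply, real_inner_smul_left, real_inner_smul_left,
      inner_inducedI_left]
    ring

theorem inducedIMap_apply (p : M) (v : TangentSpace (𝓡 6) p) :
    inducedIMap φ ι n p v = (inducedI (fun y => ⇑(φ y)) ι n) p v := rfl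

theorem kahler_apply (p : M) (v w : TangentSpace (𝓡 6) p) :
    kahler (inducedI (fun y => ⇑(φ y)) ι n) p ![v, w] = φ (ι p) ![n p, push ι p w, push ι p v] := by
  rw [← inner_inducedI]
  exact real_inner_comm _ _

/-- Presents ω as φ evaluated on three fields along ι, which brings it within reach of the Leibniz
rule. -/
theorem component_kahler (p : M) (v w : TangentSpace (𝓡 6) p) :
    component (kahler (inducedI (fun y => ⇑(φ y)) ι n)) p ![v, w] = fun q => φ (ι q) ![n q,
      push ι q (FiberBundle.extend (𝔼 6) w q), push ι q (FiberBundle.extend (𝔼 6) v q)] := by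
  ext q
  rw [← kahler_apply]
  simp only [component]
  congr 1
  ext i; fin_cases i <;> rfl

theorem IsHypersurface.mvfderiv_kahler (hι : IsHypersurface ι n) (hφ : IsG2Structure φ) (p : M)
    (u v w : TangentSpace (𝓡 6) p) :
    MDifferentiableAt (𝓡 6) 𝓘(ℝ, ℝ) (component (kahler (inducedI (fun y => ⇑(φ y)) ι n)) p ![v, w]) p ∧
    mvfderiv (𝓡 6) (component (kahler (inducedI (fun y => ⇑(φ y)) ι n)) p ![v, w]) p u =
      nabla (fun y => ⇑(φ y)) (ι p) (push ι p u) ![n p, push ι p w, push ι p v] +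
        (φ (ι p) ![normalDeriv ι n p u, push ι p w, push ι p v] +
          φ (ι p) ![n p, pushDeriv ι p u w, push ι p v] +
          φ (ι p) ![n p, push ι p w, pushDeriv ι p u v]) := by
  have h := mvfderiv_threeForm_along φ ι p (hι.mdifferentiableAt p)
    (hφ.smooth.mdifferentiableAt (ι p)) (hι.diffAlong_normal p) (hι.diffAlong_push p w)
    (hι.diffAlong_push p v) u
  rw [component_kahler]
  simp only [extend_self] at h
  exact h

theorem threeForm_add_right {V : Type*} [NormedAddCommGroup V] [InnerProductSpace ℝ V]
    [FiniteDimensional ℝ V] (φ : V [⋀^Fin 3]→ₗ[ℝ] ℝ) (x y z z' : V) :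
    φ ![x, y, z + z'] = φ ![x, y, z] + φ ![x, y, z'] := by
  rw [← inner_cross, inner_add_right, inner_cross, inner_cross]

theorem threeForm_smul_right {V : Type*} [NormedAddCommGroup V] [InnerProductSpace ℝ V]
    [FiniteDimensional ℝ V] (φ : V [⋀^Fin 3]→ₗ[ℝ] ℝ) (c : ℝ) (x y z : V) :
    φ ![x, y, c • z] = c * φ ![x, y, z] := by
  rw [← inner_cross, real_inner_smul_right, inner_cross]

theorem threeForm_add_middle {V : Type*} [NormedAddCommGroup V] [InnerProductSpace ℝ V]
    [FiniteDimensional ℝ V] (φ : V [⋀^Fin 3]→ₗ[ℝ] ℝ) (x y y' z : V) :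
    φ ![x, y + y', z] = φ ![x, y, z] + φ ![x, y', z] := by
  rw [alternating_swap_right, threeForm_add_right, alternating_swap_right φ x z,
    alternating_swap_right φ x z]
  ring

theorem threeForm_smul_middle {V : Type*} [NormedAddCommGroup V] [InnerProductSpace ℝ V]
    [FiniteDimensional ℝ V] (φ : V [⋀^Fin 3]→ₗ[ℝ] ℝ) (c : ℝ) (x y z : V) :
    φ ![x, c • y, z] = c * φ ![x, y, z] := by
  rw [alternating_swap_right, threeForm_smul_right, alternating_swap_right φ x z]
  ring

theorem threeForm_self_left {V : Type*} [NormedAddCommGroup V] [InnerProductSpace ℝ V]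
    [FiniteDimensional ℝ V] (φ : V [⋀^Fin 3]→ₗ[ℝ] ℝ) (x y : V) : φ ![x, x, y] = 0 := by
  rw [← inner_cross, cross_self, inner_zero_left]

theorem threeForm_self_outer {V : Type*} [NormedAddCommGroup V] [InnerProductSpace ℝ V]
    [FiniteDimensional ℝ V] (φ : V [⋀^Fin 3]→ₗ[ℝ] ℝ) (x y : V) : φ ![x, y, x] = 0 := by
  rw [alternating_swap_right, threeForm_self_left, neg_zero]

/-- In the Gauss formula the tangential parts cancel the Christoffel terms of M, and the normal
parts die because `n` then occurs twice in φ. The extrinsic geometry survives only in the derivative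
of the normal. -/
theorem IsHypersurface.nabla_kahler (hι : IsHypersurface ι n) (hφ : IsG2Structure φ) (p : M)
    (u v w : TangentSpace (𝓡 6) p) :
    nabla (kahler (inducedI (fun y => ⇑(φ y)) ι n)) p u ![v, w] =
      nabla (fun y => ⇑(φ y)) (ι p) (push ι p u) ![n p, push ι p w, push ι p v] +
        φ (ι p) ![normalDeriv ι n p u, push ι p w, push ι p v] := by
  rw [nabla_two, (hι.mvfderiv_kahler hφ p u v w).2, kahler_apply, kahler_apply,
    hι.pushDeriv_eq, hι.pushDeriv_eq, threeForm_add_right, threeForm_smul_right,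
    threeForm_add_middle, threeForm_smul_middle, threeForm_self_left, threeForm_self_outer]
  ring

theorem IsHypersurface.diffAlong_inducedI (hι : IsHypersurface ι n) (hφ : IsG2Structure φ) (p : M)
    (v : TangentSpace (𝓡 6) p) :
    DiffAlong 6 (fun q : M => q) (fun q => inducedI (fun y => ⇑(φ y)) ι n q (FiberBundle.extend (𝔼 6) v q)) p := by
  refine diffAlong_of_inner _ p fun w => ?_
  have h := (hι.mvfderiv_kahler hφ p 0 w v).1
  rw [component_kahler] at h
  simpa only [inner_inducedI] using h

/-- The metric is parallel, so differentiating ω amounts to differentiating I; the differentiability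
of I applied to a coordinate field is needed for this. -/
theorem IsHypersurface.inner_nablaEnd (hι : IsHypersurface ι n) (hφ : IsG2Structure φ) (p : M)
    (u v w : TangentSpace (𝓡 6) p) :
    ⟪w, nablaEnd (inducedI (fun y => ⇑(φ y)) ι n) p u v⟫ = nabla (kahler (inducedI (fun y => ⇑(φ y)) ι n)) p u ![w, v] := by
  have h := (mvfderiv_inner_along (fun q : M => q) p mdifferentiableAt_id _ _
    (diffAlong_extend p w) (hι.diffAlong_inducedI hφ p v) u).2
  have hc : component (kahler (inducedI (fun y => ⇑(φ y)) ι n)) p ![w, v] = fun q => ⟪FiberBundle.extend (𝔼 6) w q,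
      (inducedI (fun y => ⇑(φ y)) ι n) q (FiberBundle.extend (𝔼 6) v q)⟫ := rfl
  rw [nabla_two, hc, h, nablaAlong_extend]
  simp only [extend_self]
  rw [nablaEnd, inner_sub_right]
  have e1 : kahler (inducedI (fun y => ⇑(φ y)) ι n) p ![christoffel p u w, v] = ⟪christoffel p u w, (inducedI (fun y => ⇑(φ y)) ι n) p v⟫ := rfl
  have e2 : kahler (inducedI (fun y => ⇑(φ y)) ι n) p ![w, christoffel p u v] = ⟪w, (inducedI (fun y => ⇑(φ y)) ι n) p (christoffel p u v)⟫ := rfl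
  rw [e1, e2]
  ring

/-- The pulled back three-form as an alternating map. -/
noncomputable def pullAlt (φ : ∀ x : N, (TangentSpace (𝓡 7) x) [⋀^Fin 3]→ₗ[ℝ] ℝ) (ι : M → N)
    (x : M) : (TangentSpace (𝓡 6) x) [⋀^Fin 3]→ₗ[ℝ] ℝ :=
  (φ (ι x)).compLinearMap (push ι x : TangentSpace (𝓡 6) x →ₗ[ℝ] TangentSpace (𝓡 7) (ι x))

theorem pullAlt_apply (p : M) (a b c : TangentSpace (𝓡 6) p) :
    pullAlt φ ι p ![a, b, c] = φ (ι p) ![push ι p a, push ι p b, push ι p c] := by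
  change φ (ι p) _ = _
  congr 1
  ext i; fin_cases i <;> rfl

theorem IsHypersurface.mvfderiv_pullAlt (hι : IsHypersurface ι n) (hφ : IsG2Structure φ) (p : M)
    (u a b c : TangentSpace (𝓡 6) p) :
    MDifferentiableAt (𝓡 6) 𝓘(ℝ, ℝ) (component (fun x => ⇑(pullAlt φ ι x)) p ![a, b, c]) p ∧
    mvfderiv (𝓡 6) (component (fun x => ⇑(pullAlt φ ι x)) p ![a, b, c]) p u =
      nabla (fun y => ⇑(φ y)) (ι p) (push ι p u) ![push ι p a, push ι p b, push ι p c] +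
        (φ (ι p) ![pushDeriv ι p u a, push ι p b, push ι p c] +
          φ (ι p) ![push ι p a, pushDeriv ι p u b, push ι p c] +
          φ (ι p) ![push ι p a, push ι p b, pushDeriv ι p u c]) := by
  have h := mvfderiv_threeForm_along φ ι p (hι.mdifferentiableAt p)
    (hφ.smooth.mdifferentiableAt (ι p)) (hι.diffAlong_push p a) (hι.diffAlong_push p b)
    (hι.diffAlong_push p c) u
  simp only [extend_self] at h
  have hc : component (fun x => ⇑(pullAlt φ ι x)) p ![a, b, c] = fun q => φ (ι q)
      ![push ι q (FiberBundle.extend (𝔼 6) a q), push ι q (FiberBundle.extend (𝔼 6) b q),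
        push ι q (FiberBundle.extend (𝔼 6) c q)] := by
    ext q
    rw [← pullAlt_apply]
    simp only [component]
    congr 1
    ext i; fin_cases i <;> rfl
  rw [hc]
  exact h

/-- No argument of ι^*φ is normal, so now the normal parts of the Gauss formula survive. -/
theorem IsHypersurface.nabla_pullAlt (hι : IsHypersurface ι n) (hφ : IsG2Structure φ) (p : M)
    (u a b c : TangentSpace (𝓡 6) p) :
    nabla (fun x => ⇑(pullAlt φ ι x)) p u ![a, b, c] =
      nabla (fun y => ⇑(φ y)) (ι p) (push ι p u) ![push ι p a, push ι p b, push ι p c] +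
        (scalarSecondFund ι n p u a * φ (ι p) ![n p, push ι p b, push ι p c] +
          scalarSecondFund ι n p u b * φ (ι p) ![push ι p a, n p, push ι p c] +
          scalarSecondFund ι n p u c * φ (ι p) ![push ι p a, push ι p b, n p]) := by
  rw [nabla_three, (hι.mvfderiv_pullAlt hφ p u a b c).2]
  simp only [pullAlt_apply]
  rw [hι.pushDeriv_eq, hι.pushDeriv_eq, hι.pushDeriv_eq, threeForm_add_right, threeForm_smul_right,
    threeForm_add_middle, threeForm_smul_middle, alternating_add, alternating_smul]
  ring

/-- From `starForm_eq`: the metric terms contain scalar products of `n` with tangent vectors and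
vanish, leaving -⟨P(n, x), P(y, z)⟩. Because of this formula ∗φ never has to be differentiated. -/
theorem IsHypersurface.pullStar_apply (hι : IsHypersurface ι n) (hφ : IsG2Structure φ) (p : M)
    (w : Fin 3 → TangentSpace (𝓡 6) p) :
    pullStar (fun y => ⇑(φ y)) ι n p w = -pullAlt φ ι p ![(inducedI (fun y => ⇑(φ y)) ι n) p (w 0), w 1, w 2] := by
  have hw : (Fin.cons (n p) (fun i => push ι p (w i)) : Fin 4 → TangentSpace (𝓡 7) (ι p)) =
      ![n p, push ι p (w 0), push ι p (w 1), push ι p (w 2)] := by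
    ext i; fin_cases i <;> rfl
  rw [pullStar, interior, hw, starForm_eq (hφ.cayley _), hι.normal, hι.normal, pullAlt_apply,
    hι.push_inducedI, ← inner_cross, inner_cross_cycle _ (cross (φ (ι p)) (n p) _)]
  ring

theorem IsHypersurface.component_pullStar (hι : IsHypersurface ι n) (hφ : IsG2Structure φ) (p : M)
    (a b c : TangentSpace (𝓡 6) p) :
    component (pullStar (fun y => ⇑(φ y)) ι n) p ![a, b, c] =
      -fun q => pullAlt φ ι q ![(inducedI (fun y => ⇑(φ y)) ι n) q (FiberBundle.extend (𝔼 6) a q),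
        FiberBundle.extend (𝔼 6) b q, FiberBundle.extend (𝔼 6) c q] := by
  ext q
  rw [component, hι.pullStar_apply hφ]
  rfl

theorem IsHypersurface.mdifferentiableAt_pullAlt (hι : IsHypersurface ι n) (hφ : IsG2Structure φ)
    (p : M) (w : Fin 3 → TangentSpace (𝓡 6) p) :
    MDifferentiableAt (𝓡 6) 𝓘(ℝ, ℝ) (component (fun x => ⇑(pullAlt φ ι x)) p w) p := by
  have hw : w = ![w 0, w 1, w 2] := by ext i; fin_cases i <;> rfl
  rw [hw]
  exact (hι.mvfderiv_pullAlt hφ p 0 _ _ _).1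

theorem IsHypersurface.mvfderiv_pullStar (hι : IsHypersurface ι n) (hφ : IsG2Structure φ) (p : M)
    (u a b c : TangentSpace (𝓡 6) p) :
    MDifferentiableAt (𝓡 6) 𝓘(ℝ, ℝ) (component (pullStar (fun y => ⇑(φ y)) ι n) p ![a, b, c]) p ∧
    nabla (pullStar (fun y => ⇑(φ y)) ι n) p u ![a, b, c] =
      -(nabla (fun x => ⇑(pullAlt φ ι x)) p u ![(inducedI (fun y => ⇑(φ y)) ι n) p a, b, c] +
        pullAlt φ ι p ![nablaEnd (inducedI (fun y => ⇑(φ y)) ι n) p u a, b, c]) := by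
  have h := mvfderiv_threeForm_along (pullAlt φ ι) (fun q : M => q) p mdifferentiableAt_id
    (hι.mdifferentiableAt_pullAlt hφ p) (hι.diffAlong_inducedI hφ p a) (diffAlong_extend p b)
    (diffAlong_extend p c) u
  rw [nabla_three, hι.component_pullStar hφ]
  refine ⟨h.1.neg, ?_⟩
  have h2 := h.2
  rw [nablaAlong_extend, nablaAlong_extend] at h2
  simp only [extend_self, mfderiv_fun_id] at h2
  have hs : ∀ y z : TangentSpace (𝓡 6) p, pullAlt φ ι p ![y - z, b, c] =
      pullAlt φ ι p ![y, b, c] - pullAlt φ ι p ![z, b, c] := fun y z => by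
    rw [sub_eq_add_neg, ← neg_one_smul ℝ z, alternating_add, alternating_smul]
    ring
  rw [mvfderiv_neg, neg_apply, h2, hι.pullStar_apply hφ, hι.pullStar_apply hφ,
    hι.pullStar_apply hφ, nablaEnd, hs]
  simp only [Matrix.cons_val_zero, Matrix.cons_val_one, Matrix.cons_val]
  ring

end InducedStructure

/-! ### Algebra in an adapted Cayley frame -/

section Model

/-- The coordinates of a vector tangent to the hypersurface. -/
def tang (y : Fin 6 → ℝ) : Fin 7 → ℝ := ![0, y 0, y 1, y 2, y 3, y 4, y 5]

/-- The derivative of the Kähler form in coordinates, from the derivative `R` of the three-form and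
the second fundamental form `b`. -/
def kahlerC (R : Fin 7 → ℝ) (b v w : Fin 6 → ℝ) : ℝ :=
  starC R (Pi.single 0 1) (tang w) (tang v) - phiC (tang b) (tang w) (tang v)

/-- The almost complex structure in coordinates. -/
def cplxC (y : Fin 6 → ℝ) : Fin 6 → ℝ := ![-y 2, -y 5, y 0, -y 4, y 3, y 1]

theorem crossC_single_zero (y : Fin 6 → ℝ) :
    crossC (Pi.single 0 1) (tang y) = tang (cplxC y) := by
  rw [crossC_eq]
  ext i; fin_cases i <;> simp [tang, cplxC]

/-- The factor 1/4 is the 1/2 of r(ω) times the 1/2! of the scalar product of two-forms. -/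
theorem model_rSU3 (R : Fin 7 → ℝ) (b y : Fin 6 → ℝ) (C S : ℝ) :
    (1 / 4 : ℝ) * ∑ i : Fin 6, ∑ j : Fin 6, kahlerC R b (Pi.single i 1) (Pi.single j 1) *
      (C * phiC (tang y) (tang (Pi.single i 1)) (tang (Pi.single j 1)) -
        S * starC (Pi.single 0 1) (tang y) (tang (Pi.single i 1)) (tang (Pi.single j 1))) =
    C * (∑ k, tang (cplxC y) k * R k + ∑ i, y i * b i) -
      S * (∑ k, tang y k * R k - ∑ i, cplxC y i * b i) := by
  simp only [Fin.sum_univ_seven, Fin.sum_univ_six]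
  simp [kahlerC, starC, quadruple, triple, phiC, tang, cplxC]
  ring

/-- The left-hand side sees only tangential entries of R. The last two sums remove from the
seven-dimensional contraction the row and the column of the normal index 0. The contribution of b
contracts a symmetric tensor with a skew one. -/
theorem model_coderiv (R : Fin 7 → Fin 7 → ℝ) (b : Fin 6 → Fin 6 → ℝ)
    (hb : ∀ i j, b i j = b j i) (y : Fin 6 → ℝ) :
    2 * ∑ i : Fin 6, kahlerC (R i.succ) (b i) (Pi.single i 1) (cplxC y) =
    -2 * ∑ i, ∑ j, R i j * phiC (Pi.single i 1) (Pi.single j 1) (tang y)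
      - 2 * ∑ k, tang (cplxC y) k * R 0 k + 2 * ∑ k, tang (cplxC y) k * R k 0 := by
  simp only [Fin.sum_univ_seven, Fin.sum_univ_six]
  simp [kahlerC, starC, quadruple, triple, phiC, tang, cplxC]
  simp only [hb 1 0, hb 3 0, hb 4 0, hb 5 0, hb 2 1, hb 3 1, hb 4 1, hb 3 2, hb 4 2, hb 5 2, hb 5 3,
    hb 5 4]
  ring

/-- ∇ω has no part of type (1, 1), equivalently ∇I anticommutes with I. -/
theorem model_type (R : Fin 7 → ℝ) (b v w : Fin 6 → ℝ) :
    kahlerC R b w (cplxC v) = kahlerC R b (cplxC w) v := by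
  simp [kahlerC, starC, quadruple, triple, phiC, tang, cplxC]
  ring

/-- The derivative of the almost complex structure in coordinates. -/
def cplxDerivC (R : Fin 7 → ℝ) (b v : Fin 6 → ℝ) : Fin 6 → ℝ :=
  fun i => kahlerC R b (Pi.single i 1) v

/-- The heart of the torsion formula: after the correction by ξ the second fundamental form drops
out, and of the derivative of φ only the normal entry `R 0` is left, as a multiple of n ⌟ ∗φ. -/
theorem model_torsion (R : Fin 7 → ℝ) (b x y z : Fin 6 → ℝ) :
    starC R (tang x) (tang y) (tang z) +
      ((∑ i, x i * b i) * phiC (Pi.single 0 1) (tang y) (tang z) +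
        (∑ i, y i * b i) * phiC (tang x) (Pi.single 0 1) (tang z) +
        (∑ i, z i * b i) * phiC (tang x) (tang y) (Pi.single 0 1)) +
      (1 / 2 : ℝ) * (phiC (tang (cplxC (cplxDerivC R b x))) (tang y) (tang z) +
        phiC (tang x) (tang (cplxC (cplxDerivC R b y))) (tang z) +
        phiC (tang x) (tang y) (tang (cplxC (cplxDerivC R b z)))) =
    R 0 * starC (Pi.single 0 1) (tang x) (tang y) (tang z) := by
  simp only [Fin.sum_univ_six]
  simp [cplxDerivC, kahlerC, starC, quadruple, triple, phiC, tang, cplxC]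
  ring

theorem model_trace (R : Fin 7 → Fin 7 → ℝ) :
    -2 * ∑ i, ∑ j, R i j * phiC (Pi.single i 1) (Pi.single j 1) (Pi.single 0 1) =
    -2 * ∑ i : Fin 6, ∑ k, tang (cplxC (Pi.single i 1)) k * R i.succ k := by
  simp only [Fin.sum_univ_seven, Fin.sum_univ_six]
  simp [triple, phiC, tang, cplxC]

/-- I is skew and b is symmetric, so their contraction is zero. -/
theorem model_symm (b : Fin 6 → Fin 6 → ℝ) (hb : ∀ i j, b i j = b j i) :
    ∑ i : Fin 6, ∑ k, cplxC (Pi.single i 1) k * b i k = 0 := by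
  simp only [Fin.sum_univ_six]
  simp [cplxC]
  simp only [hb 2 0, hb 5 1, hb 4 3]
  ring

end Model

/-! ### From the coordinate identities to r(ω) and the coderivative. -/

section Adapted

variable {N : Type*} [TopologicalSpace N] [ChartedSpace (𝔼 7) N] [IsManifold (𝓡 7) ∞ N]
  [RiemannianBundle (fun x : N => TangentSpace (𝓡 7) x)]
  [IsContMDiffRiemannianBundle (𝓡 7) ∞ (𝔼 7) (fun x : N => TangentSpace (𝓡 7) x)]
  {M : Type*} [TopologicalSpace M] [ChartedSpace (𝔼 6) M] [IsManifold (𝓡 6) ∞ M]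
  [RiemannianBundle (fun x : M => TangentSpace (𝓡 6) x)]
  [IsContMDiffRiemannianBundle (𝓡 6) ∞ (𝔼 6) (fun x : M => TangentSpace (𝓡 6) x)]
  {ι : M → N} {n : ∀ x : M, TangentSpace (𝓡 7) (ι x)}
  {φ : ∀ x : N, (TangentSpace (𝓡 7) x) [⋀^Fin 3]→ₗ[ℝ] ℝ}

/-- A Cayley frame `e` with `e₀ = n`, whose other vectors are the images of the orthonormal basis
`f` of the tangent space of the hypersurface. -/
structure IsAdapted (φ : ∀ x : N, (TangentSpace (𝓡 7) x) [⋀^Fin 3]→ₗ[ℝ] ℝ) (ι : M → N)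
    (n : ∀ x : M, TangentSpace (𝓡 7) (ι x)) (p : M)
    (e : OrthonormalBasis (Fin 7) ℝ (TangentSpace (𝓡 7) (ι p)))
    (f : OrthonormalBasis (Fin 6) ℝ (TangentSpace (𝓡 6) p)) : Prop where
  cayley : IsCayleyFrame (φ (ι p)) e
  zero : e 0 = n p
  push_apply : ∀ i : Fin 6, push ι p (f i) = e i.succ

/-- The coordinates of a tangent vector of the hypersurface. -/
noncomputable def tcoords {V : Type*} [NormedAddCommGroup V] [InnerProductSpace ℝ V]
    (f : OrthonormalBasis (Fin 6) ℝ V) (a : V) : Fin 6 → ℝ := fun i => ⟪f i, a⟫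

theorem tcoords_basis {V : Type*} [NormedAddCommGroup V] [InnerProductSpace ℝ V]
    (f : OrthonormalBasis (Fin 6) ℝ V) (i : Fin 6) : tcoords f (f i) = Pi.single i 1 := by
  ext k
  simp [tcoords, orthonormal_iff_ite.1 f.orthonormal, Pi.single_apply]

theorem tang_zero (y : Fin 6 → ℝ) : tang y 0 = 0 := rfl

theorem tang_succ (y : Fin 6 → ℝ) (i : Fin 6) : tang y i.succ = y i := by
  fin_cases i <;> rfl

theorem tang_single (i : Fin 6) : tang (Pi.single i 1) = Pi.single i.succ 1 := by
  ext k
  refine Fin.cases ?_ (fun j => ?_) k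
  · rw [tang_zero, Pi.single_apply, if_neg (Fin.succ_ne_zero i).symm]
  · rw [tang_succ, Pi.single_apply, Pi.single_apply]
    simp

variable {p : M} {e : OrthonormalBasis (Fin 7) ℝ (TangentSpace (𝓡 7) (ι p))}
  {f : OrthonormalBasis (Fin 6) ℝ (TangentSpace (𝓡 6) p)}

theorem IsAdapted.coords_push (h : IsAdapted φ ι n p e f) (hι : IsHypersurface ι n)
    (a : TangentSpace (𝓡 6) p) : coords e (push ι p a) = tang (tcoords f a) := by
  ext k
  refine Fin.cases ?_ (fun j => ?_) k
  · rw [tang_zero, coords, h.zero, hι.normal]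
  · rw [tang_succ, coords, ← h.push_apply, hι.isometric]
    rfl

theorem IsAdapted.coords_normal (h : IsAdapted φ ι n p e f) :
    coords e (n p) = Pi.single 0 1 := by
  rw [← h.zero, coords_basis]

theorem IsAdapted.coords_normalDeriv (h : IsAdapted φ ι n p e f) (hι : IsHypersurface ι n)
    (u : TangentSpace (𝓡 6) p) :
    coords e (normalDeriv ι n p u) = -tang (fun i => hι.secondFundMap p u (f i)) := by
  ext k
  refine Fin.cases ?_ (fun j => ?_) k
  · rw [Pi.neg_apply, tang_zero, neg_zero, coords, h.zero, real_inner_comm,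
      hι.inner_normalDeriv_normal]
  · rw [Pi.neg_apply, tang_succ, coords, ← h.push_apply, real_inner_comm,
      hι.inner_normalDeriv_push]
    rfl

theorem IsAdapted.nabla_kahler (h : IsAdapted φ ι n p e f) (hι : IsHypersurface ι n)
    (hφ : IsG2Structure φ) (u v w : TangentSpace (𝓡 6) p) :
    nabla (kahler (inducedI (fun y => ⇑(φ y)) ι n)) p u ![v, w] =
      kahlerC (fun j => rG2Map hφ (ι p) (push ι p u) (e j))
        (fun i => hι.secondFundMap p u (f i)) (tcoords f v) (tcoords f w) := by
  have hneg : ∀ x y z : Fin 7 → ℝ, phiC (-x) y z = -phiC x y z := fun x y z => by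
    simp [phiC, triple]; ring
  rw [hι.nabla_kahler hφ, nabla_eq_starC hφ h.cayley, h.cayley.apply, h.coords_normalDeriv hι,
    h.coords_normal, h.coords_push hι, h.coords_push hι, kahlerC, hneg]
  ring

theorem IsAdapted.tcoords_inducedI (h : IsAdapted φ ι n p e f) (hι : IsHypersurface ι n)
    (v : TangentSpace (𝓡 6) p) :
    tcoords f (inducedI (fun y => ⇑(φ y)) ι n p v) = cplxC (tcoords f v) := by
  have h1 : tang (tcoords f (inducedI (fun y => ⇑(φ y)) ι n p v)) = tang (cplxC (tcoords f v)) := by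
    rw [← h.coords_push hι, hι.push_inducedI, coords_cross h.cayley, h.coords_normal,
      h.coords_push hι, crossC_single_zero]
  ext i
  rw [← tang_succ (tcoords f _) i, h1, tang_succ]

theorem IsAdapted.tcoords_nablaEnd (h : IsAdapted φ ι n p e f) (hι : IsHypersurface ι n)
    (hφ : IsG2Structure φ) (u v : TangentSpace (𝓡 6) p) :
    tcoords f (nablaEnd (inducedI (fun y => ⇑(φ y)) ι n) p u v) =
      cplxDerivC (fun j => rG2Map hφ (ι p) (push ι p u) (e j))
        (fun i => hι.secondFundMap p u (f i)) (tcoords f v) := by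
  ext i
  rw [tcoords, hι.inner_nablaEnd hφ, h.nabla_kahler hι hφ, tcoords_basis]
  rfl

theorem rG2Map_expand (hφ : IsG2Structure φ) {q : N}
    (e : OrthonormalBasis (Fin 7) ℝ (TangentSpace (𝓡 7) q)) (x y : TangentSpace (𝓡 7) q) :
    rG2Map hφ q x y = ∑ k, coords e y k * rG2Map hφ q x (e k) :=
  linear_expand e (rG2Map hφ q x) y

theorem IsHypersurface.secondFundMap_expand (hι : IsHypersurface ι n)
    (f : OrthonormalBasis (Fin 6) ℝ (TangentSpace (𝓡 6) p)) (x y : TangentSpace (𝓡 6) p) :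
    hι.secondFundMap p x y = ∑ k, tcoords f y k * hι.secondFundMap p x (f k) :=
  linear_expand f (hι.secondFundMap p x) y

/-- The bilinear form on the right-hand side of the formula for `r(ω)`. -/
noncomputable def rMap (hφ : IsG2Structure φ) (hι : IsHypersurface ι n) (θ : M → ℝ) (p : M) :
    TangentSpace (𝓡 6) p →ₗ[ℝ] TangentSpace (𝓡 6) p →ₗ[ℝ] ℝ :=
  Real.cos (θ p) • ((rG2Map hφ (ι p)).compl₁₂ (push ι p).toLinearMap
      ((push ι p).toLinearMap ∘ₗ inducedIMap φ ι n p) + hι.secondFundMap p) -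
    Real.sin (θ p) • ((rG2Map hφ (ι p)).compl₁₂ (push ι p).toLinearMap (push ι p).toLinearMap -
      (hι.secondFundMap p).compl₂ (inducedIMap φ ι n p))

theorem rMap_apply (hφ : IsG2Structure φ) (hι : IsHypersurface ι n) (θ : M → ℝ) (p : M)
    (X Y : TangentSpace (𝓡 6) p) : rMap hφ hι θ p X Y =
    Real.cos (θ p) * (rG2Map hφ (ι p) (push ι p X)
      (push ι p (inducedI (fun y => ⇑(φ y)) ι n p Y)) + hι.secondFundMap p X Y) -
    Real.sin (θ p) * (rG2Map hφ (ι p) (push ι p X) (push ι p Y) -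
      hι.secondFundMap p X (inducedI (fun y => ⇑(φ y)) ι n p Y)) := rfl

/-- The formula for `r(ω)`. -/
theorem IsAdapted.rSU3_eq (h : IsAdapted φ ι n p e f) (hι : IsHypersurface ι n)
    (hφ : IsG2Structure φ) (θ : M → ℝ) (X Y : TangentSpace (𝓡 6) p) :
    rSU3 (kahler (inducedI (fun y => ⇑(φ y)) ι n)) (psiPlus (fun y => ⇑(φ y)) ι n θ) p X Y =
      rMap hφ hι θ p X Y := by
  have hsm := hφ.smooth.mdifferentiableAt (ι p)
  -- Both factors of the scalar product are exhibited as alternating maps, because the passage from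
  -- `onb` to the adapted basis `f` requires multilinearity.
  obtain ⟨K, hK⟩ : ∃ K : (TangentSpace (𝓡 6) p) [⋀^Fin 2]→ₗ[ℝ] ℝ, ∀ w,
      nabla (kahler (inducedI (fun y => ⇑(φ y)) ι n)) p X w = K w := by
    refine ⟨-(((nablaAlt φ (ι p) hsm (push ι p X)).curryLeft (n p) +
      (φ (ι p)).curryLeft (normalDeriv ι n p X)).compLinearMap (push ι p).toLinearMap),
      fun w => ?_⟩
    have hw : w = ![w 0, w 1] := by ext i; fin_cases i <;> rfl
    have h1 : ∀ (z : TangentSpace (𝓡 7) (ι p)),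
        (Matrix.vecCons z fun i => push ι p (w i) : Fin 3 → TangentSpace (𝓡 7) (ι p)) =
        ![z, push ι p (w 0), push ι p (w 1)] := fun z => by
      ext i; fin_cases i <;> rfl
    rw [hw, hι.nabla_kahler hφ, ← hw, ← nablaAlt_coe φ (ι p) hsm,
      alternating_swap_right _ _ (push ι p (w 0)), alternating_swap_right _ _ (push ι p (w 0)),
      ← h1, ← h1]
    change _ = -(nablaAlt φ (ι p) hsm (push ι p X) (Matrix.vecCons (n p) fun i => push ι p (w i)) +
      φ (ι p) (Matrix.vecCons (normalDeriv ι n p X) fun i => push ι p (w i)))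
    ring
  obtain ⟨W, hW, hWf⟩ : ∃ W : (TangentSpace (𝓡 6) p) [⋀^Fin 2]→ₗ[ℝ] ℝ,
      (∀ w, interior Y (psiPlus (fun y => ⇑(φ y)) ι n θ p) w = W w) ∧
      ∀ i j, W ![f i, f j] = Real.cos (θ p) * phiC (tang (tcoords f Y)) (tang (Pi.single i 1))
          (tang (Pi.single j 1)) - Real.sin (θ p) * starC (Pi.single 0 1) (tang (tcoords f Y))
          (tang (Pi.single i 1)) (tang (Pi.single j 1)) := by
    refine ⟨(Real.cos (θ p) • pullAlt φ ι p - Real.sin (θ p) •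
      (starCAlt (coords e (n p))).compLinearMap
        (coordsMap e ∘ₗ (push ι p).toLinearMap)).curryLeft Y, fun w => ?_, fun i j => ?_⟩
    · rw [interior, psiPlus, pullStar, interior_starForm_apply h.cayley]
      rfl
    · have h1 : pullAlt φ ι p ![Y, f i, f j] = phiC (tang (tcoords f Y)) (tang (Pi.single i 1))
          (tang (Pi.single j 1)) := by
        rw [pullAlt_apply, h.cayley.apply, h.coords_push hι, h.coords_push hι, h.coords_push hι,
          tcoords_basis, tcoords_basis]
      change Real.cos (θ p) * pullAlt φ ι p ![Y, f i, f j] - Real.sin (θ p) * starC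
        (coords e (n p)) (coords e (push ι p Y)) (coords e (push ι p (f i)))
          (coords e (push ι p (f j))) = _
      rw [h1, h.coords_normal, h.coords_push hι, h.coords_push hι, h.coords_push hι,
        tcoords_basis, tcoords_basis]
  have hfg : ∀ a b : Fin 6, (fun i => f ((![a, b] : Fin 2 → Fin 6) i)) = ![f a, f b] := by
    intro a b; ext i; fin_cases i <;> rfl
  have hsum : (1 / 2 : ℝ) * formInner (nabla (kahler (inducedI (fun y => ⇑(φ y)) ι n)) p X)
      (interior Y (psiPlus (fun y => ⇑(φ y)) ι n θ p)) =
      (1 / 4 : ℝ) * ∑ a, ∑ b, K ![f a, f b] * W ![f a, f b] := by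
    rw [formInner]
    simp only [hK, hW]
    have hs := sum_multilinear_mul (onb _) f K.toMultilinearMap W.toMultilinearMap
    simp only [AlternatingMap.coe_multilinearMap] at hs
    rw [hs, sum_fin_two]
    simp only [hfg]
    norm_num [Nat.factorial]
    ring
  rw [rSU3, hsum]
  simp only [← hK, hWf, h.nabla_kahler hι hφ, tcoords_basis]
  rw [model_rSU3, rMap_apply, rG2Map_expand hφ e _ (push ι p _), rG2Map_expand hφ e _ (push ι p Y),
    hι.secondFundMap_expand f X Y, hι.secondFundMap_expand f X (inducedI _ _ _ _ _),
    h.coords_push hι, h.coords_push hι, h.tcoords_inducedI hι]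

/-- The formula for `I d*ω`. -/
theorem IsAdapted.coderiv_eq (h : IsAdapted φ ι n p e f) (hι : IsHypersurface ι n)
    (hφ : IsG2Structure φ) (X : TangentSpace (𝓡 6) p) :
    2 * twist₁ (inducedI (fun y => ⇑(φ y)) ι n p)
        (coderiv₂ (kahler (inducedI (fun y => ⇑(φ y)) ι n)) p) X =
      pdStar (fun y => ⇑(φ y)) (ι p) (push ι p X) -
      2 * rG2Map hφ (ι p) (n p) (push ι p (inducedI (fun y => ⇑(φ y)) ι n p X)) +
      2 * rG2Map hφ (ι p) (push ι p (inducedI (fun y => ⇑(φ y)) ι n p X)) (n p) := by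
  obtain ⟨Z, hZ⟩ : ∃ Z, Z = inducedI (fun y => ⇑(φ y)) ι n p X := ⟨_, rfl⟩
  have hsm := hφ.smooth.mdifferentiableAt (ι p)
  -- With the last argument frozen, the derivative is bilinear in the direction and the first
  -- argument, so that its trace may be taken in the adapted basis.
  obtain ⟨K, hK⟩ : ∃ K : TangentSpace (𝓡 6) p →ₗ[ℝ] TangentSpace (𝓡 6) p →ₗ[ℝ] ℝ, ∀ u v,
      nabla (kahler (inducedI (fun y => ⇑(φ y)) ι n)) p u ![v, Z] = K u v := by
    refine ⟨LinearMap.mk₂ ℝ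
      (fun u v => nablaAltMap φ (ι p) hsm (push ι p u) ![n p, push ι p Z, push ι p v] +
        φ (ι p) ![normalDeriv ι n p u, push ι p Z, push ι p v]) ?_ ?_ ?_ ?_, fun u v => ?_⟩
    · intro u u' v
      have h1 : nablaAltMap φ (ι p) hsm (push ι p (u + u')) ![n p, push ι p Z, push ι p v] =
          nablaAltMap φ (ι p) hsm (push ι p u) ![n p, push ι p Z, push ι p v] +
          nablaAltMap φ (ι p) hsm (push ι p u') ![n p, push ι p Z, push ι p v] := by
        rw [(push ι p).map_add, (nablaAltMap φ (ι p) hsm).map_add]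
        rfl
      rw [h1, normalDeriv_add, alternating_add]
      ring
    · intro c u v
      have h1 : nablaAltMap φ (ι p) hsm (push ι p (c • u)) ![n p, push ι p Z, push ι p v] =
          c * nablaAltMap φ (ι p) hsm (push ι p u) ![n p, push ι p Z, push ι p v] := by
        rw [(push ι p).map_smul, (nablaAltMap φ (ι p) hsm).map_smul]
        rfl
      rw [h1, normalDeriv_smul, alternating_smul, smul_eq_mul]
      ring
    · intro u v v'
      rw [(push ι p).map_add, threeForm_add_right, threeForm_add_right]
      ring
    · intro c u v
      rw [(push ι p).map_smul, threeForm_smul_right, threeForm_smul_right, smul_eq_mul]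
      ring
    · have h1 : nablaAltMap φ (ι p) hsm (push ι p u) ![n p, push ι p Z, push ι p v] =
          nabla (fun y => ⇑(φ y)) (ι p) (push ι p u) ![n p, push ι p Z, push ι p v] :=
        nablaAlt_coe φ (ι p) hsm _ _
      refine (hι.nabla_kahler hφ p u v Z).trans ?_
      rw [LinearMap.mk₂_apply, h1]
  have h1 : twist₁ (inducedI (fun y => ⇑(φ y)) ι n p)
      (coderiv₂ (kahler (inducedI (fun y => ⇑(φ y)) ι n)) p) X = ∑ i, K (f i) (f i) := by
    rw [twist₁, ← hZ, coderiv₂, neg_neg]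
    simp only [hK]
    exact sum_bilin (onb _) f K
  have h2 := model_coderiv (fun i j => rG2Map hφ (ι p) (e i) (e j))
    (fun i j => hι.secondFundMap p (f i) (f j))
    (fun i j => hι.scalarSecondFund_comm p (f i) (f j)) (tcoords f X)
  rw [h1, pdStar_eq hφ h.cayley, ← hZ]
  simp only [← hK, h.nabla_kahler hι hφ, tcoords_basis, h.push_apply]
  rw [hZ, h.tcoords_inducedI hι, h2, h.coords_push hι, rG2Map_expand hφ e (n p),
    h.coords_push hι, h.tcoords_inducedI hι, ← h.zero]
  congr 2
  rw [← LinearMap.flip_apply, linear_expand e]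
  refine Finset.sum_congr rfl fun k _ => ?_
  rw [← h.tcoords_inducedI hι, ← h.coords_push hι]
  rfl

end Adapted

/-- ι^*φ is of type (3, 0) + (0, 3): I may be moved from one argument to another. -/
theorem model_threeForm_type (x y z : Fin 6 → ℝ) :
    phiC (tang x) (tang (cplxC y)) (tang z) = phiC (tang (cplxC x)) (tang y) (tang z) ∧
    phiC (tang x) (tang y) (tang (cplxC z)) = phiC (tang (cplxC x)) (tang y) (tang z) := by
  constructor <;>
  · simp [triple, phiC, tang, cplxC]
    ring

section Derivatives

variable {d : ℕ} {M : Type*} [TopologicalSpace M] [ChartedSpace (𝔼 d) M]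

theorem mvfderiv_comp_real {θ : M → ℝ} {p : M} (hθ : MDifferentiableAt (𝓡 d) 𝓘(ℝ, ℝ) θ p)
    {g : ℝ → ℝ} {g' : ℝ} (hg : HasDerivAt g g' (θ p)) (u : TangentSpace (𝓡 d) p) :
    MDifferentiableAt (𝓡 d) 𝓘(ℝ, ℝ) (fun q => g (θ q)) p ∧
    mvfderiv (𝓡 d) (fun q => g (θ q)) p u = g' * mvfderiv (𝓡 d) θ p u := by
  have h := hg.hasFDerivAt.hasMFDerivAt.comp p hθ.hasMFDerivAt
  refine ⟨h.mdifferentiableAt, ?_⟩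
  have h1 : mvfderiv (𝓡 d) (g ∘ θ) p = _ := h.mfderiv
  rw [show (fun q => g (θ q)) = g ∘ θ from rfl, h1]
  change mvfderiv (𝓡 d) θ p u * g' = _
  ring

end Derivatives

/-! ### Traces, and derivatives for the connection with torsion. -/

section Torsion

variable {N : Type*} [TopologicalSpace N] [ChartedSpace (𝔼 7) N] [IsManifold (𝓡 7) ∞ N]
  [RiemannianBundle (fun x : N => TangentSpace (𝓡 7) x)]
  [IsContMDiffRiemannianBundle (𝓡 7) ∞ (𝔼 7) (fun x : N => TangentSpace (𝓡 7) x)]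
  {M : Type*} [TopologicalSpace M] [ChartedSpace (𝔼 6) M] [IsManifold (𝓡 6) ∞ M]
  [RiemannianBundle (fun x : M => TangentSpace (𝓡 6) x)]
  [IsContMDiffRiemannianBundle (𝓡 6) ∞ (𝔼 6) (fun x : M => TangentSpace (𝓡 6) x)]
  {ι : M → N} {n : ∀ x : M, TangentSpace (𝓡 7) (ι x)}
  {φ : ∀ x : N, (TangentSpace (𝓡 7) x) [⋀^Fin 3]→ₗ[ℝ] ℝ}
  {p : M} {e : OrthonormalBasis (Fin 7) ℝ (TangentSpace (𝓡 7) (ι p))}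
  {f : OrthonormalBasis (Fin 6) ℝ (TangentSpace (𝓡 6) p)}

/-- The trace of the composition of `r̄(φ)` with the almost complex structure. -/
theorem IsAdapted.pdStar_normal (h : IsAdapted φ ι n p e f) (hι : IsHypersurface ι n)
    (hφ : IsG2Structure φ) :
    pdStar (fun y => ⇑(φ y)) (ι p) (n p) = -2 * ∑ i, rG2Map hφ (ι p)
      (push ι p (onb (TangentSpace (𝓡 6) p) i))
      (push ι p (inducedI (fun y => ⇑(φ y)) ι n p (onb (TangentSpace (𝓡 6) p) i))) := by
  have h1 := sum_bilin (onb (TangentSpace (𝓡 6) p)) f ((rG2Map hφ (ι p)).compl₁₂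
    (push ι p).toLinearMap ((push ι p).toLinearMap ∘ₗ inducedIMap φ ι n p))
  have h2 : ∑ i, rG2Map hφ (ι p) (push ι p (onb (TangentSpace (𝓡 6) p) i))
      (push ι p (inducedI (fun y => ⇑(φ y)) ι n p (onb (TangentSpace (𝓡 6) p) i))) =
      ∑ i, rG2Map hφ (ι p) (push ι p (f i))
        (push ι p (inducedI (fun y => ⇑(φ y)) ι n p (f i))) := h1
  rw [h2, pdStar_eq hφ h.cayley, h.coords_normal,
    model_trace (fun i j => rG2Map hφ (ι p) (e i) (e j))]
  congr 1
  refine Finset.sum_congr rfl fun i _ => ?_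
  rw [rG2Map_expand hφ e, h.coords_push hι, h.tcoords_inducedI hι, tcoords_basis, h.push_apply]

theorem IsAdapted.sum_secondFundMap_inducedI (h : IsAdapted φ ι n p e f)
    (hι : IsHypersurface ι n) :
    ∑ i, hι.secondFundMap p (onb (TangentSpace (𝓡 6) p) i)
      (inducedI (fun y => ⇑(φ y)) ι n p (onb (TangentSpace (𝓡 6) p) i)) = 0 := by
  have h1 := sum_bilin (onb (TangentSpace (𝓡 6) p)) f
    ((hι.secondFundMap p).compl₂ (inducedIMap φ ι n p))
  refine h1.trans ?_
  rw [← model_symm (fun i j => hι.secondFundMap p (f i) (f j))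
    (fun i j => hι.scalarSecondFund_comm p (f i) (f j))]
  refine Finset.sum_congr rfl fun i _ => ?_
  change hι.secondFundMap p (f i) (inducedI (fun y => ⇑(φ y)) ι n p (f i)) = _
  rw [hι.secondFundMap_expand f, h.tcoords_inducedI hι, tcoords_basis]

/-- The sign comes from ω(e_i, e_j) = ⟨e_i, I e_j⟩ = -⟨I e_i, e_j⟩. -/
theorem bilinContract_kahler (b : TangentSpace (𝓡 6) p →ₗ[ℝ] TangentSpace (𝓡 6) p →ₗ[ℝ] ℝ) :
    bilinContract (kahler (inducedI (fun y => ⇑(φ y)) ι n) p) (fun x y => b x y) =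
      -∑ i, b (onb (TangentSpace (𝓡 6) p) i)
        (inducedI (fun y => ⇑(φ y)) ι n p (onb (TangentSpace (𝓡 6) p) i)) := by
  rw [bilinContract, ← Finset.sum_neg_distrib]
  refine Finset.sum_congr rfl fun i _ => ?_
  rw [linear_expand (onb (TangentSpace (𝓡 6) p)) (b _) (inducedI _ _ _ _ _),
    ← Finset.sum_neg_distrib]
  refine Finset.sum_congr rfl fun j _ => ?_
  have h1 := inner_inducedI_left (φ := φ) (ι := ι) (n := n) p (onb (TangentSpace (𝓡 6) p) i)
    (onb (TangentSpace (𝓡 6) p) j)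
  change ⟪onb (TangentSpace (𝓡 6) p) i, inducedI (fun y => ⇑(φ y)) ι n p
    (onb (TangentSpace (𝓡 6) p) j)⟫ * b (onb (TangentSpace (𝓡 6) p) i)
      (onb (TangentSpace (𝓡 6) p) j) = _
  rw [real_inner_comm] at h1
  rw [smul_eq_mul]
  linear_combination b (onb (TangentSpace (𝓡 6) p) i) (onb (TangentSpace (𝓡 6) p) j) * h1

theorem IsHypersurface.scalarMeanCurvature_eq (hι : IsHypersurface ι n) :
    12 * scalarMeanCurvature ι n p = 2 * ∑ i, hι.secondFundMap p (onb (TangentSpace (𝓡 6) p) i)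
      (onb (TangentSpace (𝓡 6) p) i) := by
  rw [scalarMeanCurvature, meanCurvature, real_inner_smul_left, sum_inner]
  simp only [hι.secondFundMap_apply, scalarSecondFund]
  push_cast
  ring

/-- The almost complex structure anticommutes with its derivative. -/
theorem IsAdapted.nablaEnd_inducedI (h : IsAdapted φ ι n p e f) (hι : IsHypersurface ι n)
    (hφ : IsG2Structure φ) (u v : TangentSpace (𝓡 6) p) :
    nablaEnd (inducedI (fun y => ⇑(φ y)) ι n) p u (inducedI (fun y => ⇑(φ y)) ι n p v) =
      -inducedI (fun y => ⇑(φ y)) ι n p (nablaEnd (inducedI (fun y => ⇑(φ y)) ι n) p u v) := by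
  refine ext_inner_left ℝ fun w => ?_
  rw [inner_neg_right, ← inner_inducedI_left, hι.inner_nablaEnd hφ, hι.inner_nablaEnd hφ,
    h.nabla_kahler hι hφ, h.nabla_kahler hι hφ, h.tcoords_inducedI hι, h.tcoords_inducedI hι,
    model_type]

theorem IsAdapted.nabla_kahler_comm (h : IsAdapted φ ι n p e f) (hι : IsHypersurface ι n)
    (hφ : IsG2Structure φ) (u v w : TangentSpace (𝓡 6) p) :
    nabla (kahler (inducedI (fun y => ⇑(φ y)) ι n)) p u ![w, v] =
      -nabla (kahler (inducedI (fun y => ⇑(φ y)) ι n)) p u ![v, w] := by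
  rw [h.nabla_kahler hι hφ, h.nabla_kahler hι hφ]
  simp [kahlerC, starC, quadruple, phiC, triple]
  ring

theorem sum_update_three {V : Type*} (α : (Fin 3 → V) → ℝ) (T : V → V) (a b c : V) :
    ∑ i, α (Function.update ![a, b, c] i (T ((![a, b, c] : Fin 3 → V) i))) =
      α ![T a, b, c] + α ![a, T b, c] + α ![a, b, T c] := by
  rw [Fin.sum_univ_three]
  congr 1
  · congr 1
    · congr 1; ext i; fin_cases i <;> rfl
    · congr 1; ext i; fin_cases i <;> rfl
  · congr 1; ext i; fin_cases i <;> rfl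

theorem sum_update_two {V : Type*} (α : (Fin 2 → V) → ℝ) (T : V → V) (a b : V) :
    ∑ i, α (Function.update ![a, b] i (T ((![a, b] : Fin 2 → V) i))) =
      α ![T a, b] + α ![a, T b] := by
  rw [Fin.sum_univ_two]
  congr 1
  · congr 1; ext i; fin_cases i <;> rfl
  · congr 1; ext i; fin_cases i <;> rfl

/-- The Kähler form is parallel for the connection with torsion. -/
theorem IsAdapted.isParallelAt_kahler (h : IsAdapted φ ι n p e f) (hι : IsHypersurface ι n)
    (hφ : IsG2Structure φ) (η : TangentSpace (𝓡 6) p →ₗ[ℝ] ℝ) :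
    IsParallelAt (kahler (inducedI (fun y => ⇑(φ y)) ι n)) p
      (torsionSU3 (inducedI (fun y => ⇑(φ y)) ι n) η) := by
  intro u w
  obtain ⟨v, hv⟩ : ∃ v, v = w 0 := ⟨_, rfl⟩
  obtain ⟨z, hz⟩ : ∃ z, z = w 1 := ⟨_, rfl⟩
  have hw : w = ![v, z] := by rw [hv, hz]; ext i; fin_cases i <;> rfl
  rw [hw, sum_update_two]
  set J := inducedIMap φ ι n p with hJ
  set s := twist₁ (inducedI (fun y => ⇑(φ y)) ι n p) η u with hs
  have hT : ∀ y, torsionSU3 (inducedI (fun y => ⇑(φ y)) ι n) η u y = s • J y +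
      (-(1 / 2 : ℝ)) • J (nablaEnd (inducedI (fun y => ⇑(φ y)) ι n) p u y) := fun _ => rfl
  have hk : ∀ a b, kahler (inducedI (fun y => ⇑(φ y)) ι n) p ![a, b] = ⟪a, J b⟫ := fun _ _ => rfl
  have hJJ : ∀ y, J (J y) = -y := hι.inducedI_inducedI hφ p
  have hJi : ∀ a b, ⟪J a, b⟫ = -⟪a, J b⟫ := inner_inducedI_left p
  have h1 := hι.inner_nablaEnd hφ p u v z
  have h2 := hι.inner_nablaEnd hφ p u z v
  -- The η-terms cancel because I is skew. In each of the two slots ξ contributes half of ∇ω.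
  rw [h.nabla_kahler_comm hι hφ] at h1
  rw [hk, hk, hT, hT]
  simp only [map_add, map_smul, inner_add_left, inner_add_right, real_inner_smul_left,
    real_inner_smul_right, hJJ, hJi, inner_neg_right]
  rw [h2, real_inner_comm z (nablaEnd (inducedI (fun y => ⇑(φ y)) ι n) p u v), h1]
  ring

theorem IsAdapted.pullStar_eq (h : IsAdapted φ ι n p e f) (hι : IsHypersurface ι n)
    (a b c : TangentSpace (𝓡 6) p) :
    pullStar (fun y => ⇑(φ y)) ι n p ![a, b, c] =
      starC (Pi.single 0 1) (tang (tcoords f a)) (tang (tcoords f b)) (tang (tcoords f c)) := by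
  rw [pullStar, interior_starForm_apply h.cayley, h.coords_normal, h.coords_push hι,
    h.coords_push hι, h.coords_push hι]
  rfl

theorem IsAdapted.pullAlt_eq (h : IsAdapted φ ι n p e f) (hι : IsHypersurface ι n)
    (a b c : TangentSpace (𝓡 6) p) :
    pullAlt φ ι p ![a, b, c] =
      phiC (tang (tcoords f a)) (tang (tcoords f b)) (tang (tcoords f c)) := by
  rw [pullAlt_apply, h.cayley.apply, h.coords_push hι, h.coords_push hι, h.coords_push hι]

/-- The derivative of `ι^*φ` for the connection with torsion. -/
theorem IsAdapted.nabla_pullAlt_sub (h : IsAdapted φ ι n p e f) (hι : IsHypersurface ι n)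
    (hφ : IsG2Structure φ) (η : TangentSpace (𝓡 6) p →ₗ[ℝ] ℝ) (u a b c : TangentSpace (𝓡 6) p) :
    nabla (fun x => ⇑(pullAlt φ ι x)) p u ![a, b, c] -
      (pullAlt φ ι p ![torsionSU3 (inducedI (fun y => ⇑(φ y)) ι n) η u a, b, c] +
        pullAlt φ ι p ![a, torsionSU3 (inducedI (fun y => ⇑(φ y)) ι n) η u b, c] +
        pullAlt φ ι p ![a, b, torsionSU3 (inducedI (fun y => ⇑(φ y)) ι n) η u c]) =
    (rG2Map hφ (ι p) (push ι p u) (n p) + 3 * twist₁ (inducedI (fun y => ⇑(φ y)) ι n p) η u) *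
      pullStar (fun y => ⇑(φ y)) ι n p ![a, b, c] := by
  set s := twist₁ (inducedI (fun y => ⇑(φ y)) ι n p) η u with hs
  have hT : ∀ y, torsionSU3 (inducedI (fun y => ⇑(φ y)) ι n) η u y =
      s • inducedI (fun y => ⇑(φ y)) ι n p y + (-(1 / 2 : ℝ)) •
        inducedI (fun y => ⇑(φ y)) ι n p (nablaEnd (inducedI (fun y => ⇑(φ y)) ι n) p u y) :=
    fun _ => rfl
  have h0 : pullStar (fun y => ⇑(φ y)) ι n p ![a, b, c] =
      -phiC (tang (cplxC (tcoords f a))) (tang (tcoords f b)) (tang (tcoords f c)) := by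
    rw [hι.pullStar_apply hφ, h.pullAlt_eq hι, h.tcoords_inducedI hι]
    rfl
  have h1 := model_torsion (fun j => rG2Map hφ (ι p) (push ι p u) (e j))
    (fun i => hι.secondFundMap p u (f i)) (tcoords f a) (tcoords f b) (tcoords f c)
  rw [← h.pullStar_eq hι, h.zero] at h1
  rw [hT, hT, hT, alternating_add, alternating_smul, alternating_smul, threeForm_add_middle,
    threeForm_smul_middle, threeForm_smul_middle, threeForm_add_right, threeForm_smul_right,
    threeForm_smul_right, hι.nabla_pullAlt hφ, nabla_eq_starC hφ h.cayley]
  simp only [h.pullAlt_eq hι, h.cayley.apply, h.coords_push hι, h.coords_normal,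
    h.tcoords_inducedI hι, h.tcoords_nablaEnd hι hφ, ← hι.secondFundMap_apply]
  rw [hι.secondFundMap_expand f u a, hι.secondFundMap_expand f u b, hι.secondFundMap_expand f u c]
  -- The η-term applies I in each slot in turn; by type the three contributions are equal, which is
  -- the origin of the factor 3.
  have m1 := (model_threeForm_type (tcoords f a) (tcoords f b) (tcoords f c)).1
  have m2 := (model_threeForm_type (tcoords f a) (tcoords f b) (tcoords f c)).2
  rw [m1, m2]
  linear_combination h1 - 3 * s * h0

/-- The derivative of `ι^*(n ⌟ ∗φ)` for the connection with torsion. -/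
theorem IsAdapted.nabla_pullStar_sub (h : IsAdapted φ ι n p e f) (hι : IsHypersurface ι n)
    (hφ : IsG2Structure φ) (η : TangentSpace (𝓡 6) p →ₗ[ℝ] ℝ) (u a b c : TangentSpace (𝓡 6) p) :
    nabla (pullStar (fun y => ⇑(φ y)) ι n) p u ![a, b, c] -
      (pullStar (fun y => ⇑(φ y)) ι n p
          ![torsionSU3 (inducedI (fun y => ⇑(φ y)) ι n) η u a, b, c] +
        pullStar (fun y => ⇑(φ y)) ι n p
          ![a, torsionSU3 (inducedI (fun y => ⇑(φ y)) ι n) η u b, c] +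
        pullStar (fun y => ⇑(φ y)) ι n p
          ![a, b, torsionSU3 (inducedI (fun y => ⇑(φ y)) ι n) η u c]) =
    -(rG2Map hφ (ι p) (push ι p u) (n p) + 3 * twist₁ (inducedI (fun y => ⇑(φ y)) ι n p) η u) *
      pullAlt φ ι p ![a, b, c] := by
  have h1 := h.nabla_pullAlt_sub hι hφ η u (inducedI (fun y => ⇑(φ y)) ι n p a) b c
  have hps : ∀ a b c, pullStar (fun y => ⇑(φ y)) ι n p ![a, b, c] =
      -pullAlt φ ι p ![inducedI (fun y => ⇑(φ y)) ι n p a, b, c] := fun a b c =>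
    hι.pullStar_apply hφ p _
  have hneg : ∀ x, pullAlt φ ι p ![-x, b, c] = -pullAlt φ ι p ![x, b, c] := fun x => by
    rw [← neg_one_smul ℝ x, alternating_smul]
    ring
  -- This says that I is parallel for ∇ + η + ξ. The formula for ι^*φ, applied with I a in place of
  -- a, then yields the one for ι^*(n ⌟ ∗φ).
  have h2 : torsionSU3 (inducedI (fun y => ⇑(φ y)) ι n) η u
      (inducedI (fun y => ⇑(φ y)) ι n p a) = inducedI (fun y => ⇑(φ y)) ι n p
        (torsionSU3 (inducedI (fun y => ⇑(φ y)) ι n) η u a) +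
        -nablaEnd (inducedI (fun y => ⇑(φ y)) ι n) p u a := by
    have hJJ : ∀ y, inducedIMap φ ι n p (inducedIMap φ ι n p y) = -y :=
      hι.inducedI_inducedI hφ p
    rw [torsionSU3, torsionSU3, h.nablaEnd_inducedI hι hφ]
    simp only [← inducedIMap_apply, map_add, map_smul, map_neg, hJJ]
    module
  rw [(hι.mvfderiv_pullStar hφ p u a b c).2]
  simp only [hps] at h1 ⊢
  rw [h2, alternating_add, hneg, hι.inducedI_inducedI hφ, hneg] at h1
  linear_combination -h1

/-- Product rule with coefficients that are functions of θ; the Christoffel corrections are linear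
in the tensor, so the only new term is a multiple of dθ. -/
theorem nabla_cos_sin {α β : CovTensor 6 M 3} {θ : M → ℝ} {g h : ℝ → ℝ} {g' h' : ℝ}
    (hθ : MDifferentiableAt (𝓡 6) 𝓘(ℝ, ℝ) θ p) (hg : HasDerivAt g g' (θ p))
    (hh : HasDerivAt h h' (θ p)) (u a b c : TangentSpace (𝓡 6) p)
    (hα : MDifferentiableAt (𝓡 6) 𝓘(ℝ, ℝ) (component α p ![a, b, c]) p)
    (hβ : MDifferentiableAt (𝓡 6) 𝓘(ℝ, ℝ) (component β p ![a, b, c]) p) :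
    nabla (fun x w => g (θ x) * α x w + h (θ x) * β x w) p u ![a, b, c] =
      g (θ p) * nabla α p u ![a, b, c] + h (θ p) * nabla β p u ![a, b, c] +
      mvfderiv (𝓡 6) θ p u * (g' * α p ![a, b, c] + h' * β p ![a, b, c]) := by
  have h1 := mvfderiv_comp_real hθ hg u
  have h2 := mvfderiv_comp_real hθ hh u
  have e1 : component (fun x w => g (θ x) * α x w + h (θ x) * β x w) p ![a, b, c] =
      fun q => g (θ q) * component α p ![a, b, c] q + h (θ q) * component β p ![a, b, c] q := rfl
  have e2 : ∀ γ : CovTensor 6 M 3, component γ p ![a, b, c] p = γ p ![a, b, c] := by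
    intro γ
    rw [component]
    congr 1
    ext1 i
    exact extend_self p _
  rw [nabla_three, nabla_three, nabla_three, e1,
    mvfderiv_fun_add (g := fun q => g (θ q) * component α p ![a, b, c] q)
      (g' := fun q => h (θ q) * component β p ![a, b, c] q) (h1.1.mul hα) (h2.1.mul hβ),
    mvfderiv_fun_mul h1.1 hα, mvfderiv_fun_mul h2.1 hβ]
  simp only [add_apply, smul_apply, smul_eq_mul, h1.2, h2.2, e2]
  ring

end Torsion

/-! ### The W₅-part of the torsion and the trace formulas. -/

section Parallel

variable {N : Type*} [TopologicalSpace N] [ChartedSpace (𝔼 7) N] [IsManifold (𝓡 7) ∞ N]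
  [RiemannianBundle (fun x : N => TangentSpace (𝓡 7) x)]
  [IsContMDiffRiemannianBundle (𝓡 7) ∞ (𝔼 7) (fun x : N => TangentSpace (𝓡 7) x)]
  {M : Type*} [TopologicalSpace M] [ChartedSpace (𝔼 6) M] [IsManifold (𝓡 6) ∞ M]
  [RiemannianBundle (fun x : M => TangentSpace (𝓡 6) x)]
  [IsContMDiffRiemannianBundle (𝓡 6) ∞ (𝔼 6) (fun x : M => TangentSpace (𝓡 6) x)]
  {ι : M → N} {n : ∀ x : M, TangentSpace (𝓡 7) (ι x)}
  {φ : ∀ x : N, (TangentSpace (𝓡 7) x) [⋀^Fin 3]→ₗ[ℝ] ℝ} {p : M}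
  {e : OrthonormalBasis (Fin 7) ℝ (TangentSpace (𝓡 7) (ι p))}
  {f : OrthonormalBasis (Fin 6) ℝ (TangentSpace (𝓡 6) p)}

/-- The derivative of a combination of `ι^*φ` and `ι^*(n ⌟ ∗φ)` for the connection with torsion. -/
theorem IsAdapted.nabla_comb_sub (h : IsAdapted φ ι n p e f) (hι : IsHypersurface ι n)
    (hφ : IsG2Structure φ) {θ : M → ℝ} (hθ : MDifferentiableAt (𝓡 6) 𝓘(ℝ, ℝ) θ p)
    {g k : ℝ → ℝ} (hg : HasDerivAt g (k (θ p)) (θ p)) (hk : HasDerivAt k (-g (θ p)) (θ p))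
    (η : TangentSpace (𝓡 6) p →ₗ[ℝ] ℝ) (u : TangentSpace (𝓡 6) p)
    (w : Fin 3 → TangentSpace (𝓡 6) p) :
    nabla (fun x w => g (θ x) * pullAlt φ ι x w + k (θ x) * pullStar (fun y => ⇑(φ y)) ι n x w)
        p u w - ∑ i, (g (θ p) * pullAlt φ ι p (Function.update w i
            (torsionSU3 (inducedI (fun y => ⇑(φ y)) ι n) η u (w i))) +
          k (θ p) * pullStar (fun y => ⇑(φ y)) ι n p (Function.update w i
            (torsionSU3 (inducedI (fun y => ⇑(φ y)) ι n) η u (w i)))) =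
      (rG2Map hφ (ι p) (push ι p u) (n p) +
        3 * twist₁ (inducedI (fun y => ⇑(φ y)) ι n p) η u - mvfderiv (𝓡 6) θ p u) *
      (g (θ p) * pullStar (fun y => ⇑(φ y)) ι n p w - k (θ p) * pullAlt φ ι p w) := by
  obtain ⟨a, ha⟩ : ∃ a, a = w 0 := ⟨_, rfl⟩
  obtain ⟨b, hb⟩ : ∃ b, b = w 1 := ⟨_, rfl⟩
  obtain ⟨c, hc⟩ : ∃ c, c = w 2 := ⟨_, rfl⟩
  have hw : w = ![a, b, c] := by rw [ha, hb, hc]; ext i; fin_cases i <;> rfl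
  rw [hw, Finset.sum_add_distrib, ← Finset.mul_sum, ← Finset.mul_sum,
    sum_update_three (⇑(pullAlt φ ι p)), sum_update_three (pullStar _ ι n p),
    nabla_cos_sin (α := fun x => ⇑(pullAlt φ ι x)) hθ hg hk u a b c
      (hι.mdifferentiableAt_pullAlt hφ p _) (hι.mvfderiv_pullStar hφ p u a b c).1]
  -- The conditions g' = k and k' = -g treat ψ₊ (cos, -sin) and ψ₋ (sin, cos) at once and make the
  -- dθ-term proportional to the torsion term.
  linear_combination g (θ p) * h.nabla_pullAlt_sub hι hφ η u a b c +
    k (θ p) * h.nabla_pullStar_sub hι hφ η u a b c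

/-- The derivatives of ψ₊ and ψ₋ are a common scalar factor times a combination of the two real
forms; parallelism is the vanishing of this factor, and ω imposes no condition. -/
theorem IsAdapted.isW5Torsion_iff (h : IsAdapted φ ι n p e f) (hι : IsHypersurface ι n)
    (hφ : IsG2Structure φ) {θ : M → ℝ} (hθ : MDifferentiableAt (𝓡 6) 𝓘(ℝ, ℝ) θ p)
    (η : TangentSpace (𝓡 6) p →ₗ[ℝ] ℝ) :
    IsW5Torsion (inducedI (fun y => ⇑(φ y)) ι n) (psiPlus (fun y => ⇑(φ y)) ι n θ)
      (psiMinus (fun y => ⇑(φ y)) ι n θ) p η ↔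
    ∀ u, 3 * twist₁ (inducedI (fun y => ⇑(φ y)) ι n p) η u =
      mvfderiv (𝓡 6) θ p u - rG2Map hφ (ι p) (push ι p u) (n p) := by
  have hp : psiPlus (fun y => ⇑(φ y)) ι n θ = fun x w => Real.cos (θ x) * pullAlt φ ι x w +
      (-Real.sin (θ x)) * pullStar (fun y => ⇑(φ y)) ι n x w := by
    funext x w
    change _ * pullAlt φ ι x w - _ = _
    ring
  have hm : psiMinus (fun y => ⇑(φ y)) ι n θ = fun x w => Real.sin (θ x) * pullAlt φ ι x w +
      Real.cos (θ x) * pullStar (fun y => ⇑(φ y)) ι n x w := rfl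
  have h1 := h.nabla_comb_sub hι hφ hθ (g := Real.cos) (k := fun t => -Real.sin t)
    (Real.hasDerivAt_cos _) (Real.hasDerivAt_sin _).neg η
  have h2 := h.nabla_comb_sub hι hφ hθ (g := Real.sin) (k := Real.cos)
    (Real.hasDerivAt_sin _) (Real.hasDerivAt_cos _) η
  rw [hp, hm]
  constructor
  · rintro ⟨-, h3, h4⟩ u
    -- On these vectors, which span the line e_1 ∧ e_2 ∧ e_4 of φ, one form is 1 and the other 0.
    -- The factor is thus killed by sin θ and by cos θ, hence zero.
    have k1 := (h1 u ![f 0, f 1, f 3]).symm.trans (h3 u _)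
    have k2 := (h2 u ![f 0, f 1, f 3]).symm.trans (h4 u _)
    have e1 : pullAlt φ ι p ![f 0, f 1, f 3] = 1 := by
      rw [h.pullAlt_eq hι, tcoords_basis, tcoords_basis, tcoords_basis, tang_single, tang_single,
        tang_single]
      simp [phiC, triple]
    have e2 : pullStar (fun y => ⇑(φ y)) ι n p ![f 0, f 1, f 3] = 0 := by
      rw [h.pullStar_eq hι, tcoords_basis, tcoords_basis, tcoords_basis, tang_single, tang_single,
        tang_single]
      simp [starC, quadruple, triple]
    rw [e1, e2] at k1 k2
    have k3 := Real.sin_sq_add_cos_sq (θ p)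
    linear_combination Real.sin (θ p) * k1 - Real.cos (θ p) * k2 - (rG2Map hφ (ι p) (push ι p u)
      (n p) + 3 * twist₁ (inducedI (fun y => ⇑(φ y)) ι n p) η u - mvfderiv (𝓡 6) θ p u) * k3
  · intro h3
    refine ⟨h.isParallelAt_kahler hι hφ η, fun u w => (h1 u w).trans ?_,
      fun u w => (h2 u w).trans ?_⟩ <;>
    · rw [h3 u]
      ring

theorem IsAdapted.exists_isW5Torsion (h : IsAdapted φ ι n p e f) (hι : IsHypersurface ι n)
    (hφ : IsG2Structure φ) {θ : M → ℝ} (hθ : MDifferentiableAt (𝓡 6) 𝓘(ℝ, ℝ) θ p) :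
    ∃ η : TangentSpace (𝓡 6) p →ₗ[ℝ] ℝ,
      (∀ η' : TangentSpace (𝓡 6) p →ₗ[ℝ] ℝ,
        IsW5Torsion (inducedI (fun y => ⇑(φ y)) ι n) (psiPlus (fun y => ⇑(φ y)) ι n θ)
          (psiMinus (fun y => ⇑(φ y)) ι n θ) p η' ↔ η' = η) ∧
      ∀ u, 3 * twist₁ (inducedI (fun y => ⇑(φ y)) ι n p) η u =
        mvfderiv (𝓡 6) θ p u - rG2Map hφ (ι p) (push ι p u) (n p) := by
  obtain ⟨ν, hν⟩ : ∃ ν : TangentSpace (𝓡 6) p →ₗ[ℝ] ℝ, ∀ u, ν u =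
      mvfderiv (𝓡 6) θ p u - rG2Map hφ (ι p) (push ι p u) (n p) :=
    ⟨(mvfderiv (𝓡 6) θ p).toLinearMap -
      (rG2Map hφ (ι p)).flip (n p) ∘ₗ (push ι p).toLinearMap, fun _ => rfl⟩
  -- As (Iη)(x) = -η(Ix) and I² = -1, the equation 3Iη = ν is solved by η = ν ∘ I / 3.
  have hη : ∀ u, 3 * twist₁ (inducedI (fun y => ⇑(φ y)) ι n p)
      ⇑((1 / 3 : ℝ) • ν ∘ₗ inducedIMap φ ι n p) u = ν u := by
    intro u
    change 3 * -((1 / 3 : ℝ) * ν (inducedI (fun y => ⇑(φ y)) ι n p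
      (inducedI (fun y => ⇑(φ y)) ι n p u))) = _
    rw [hι.inducedI_inducedI hφ, map_neg]
    ring
  refine ⟨(1 / 3 : ℝ) • ν ∘ₗ inducedIMap φ ι n p, fun η' => ?_, fun u => (hη u).trans (hν u)⟩
  rw [h.isW5Torsion_iff hι hφ hθ]
  constructor
  · intro h1
    ext u
    have h2 := h1 (inducedI (fun y => ⇑(φ y)) ι n p u)
    rw [twist₁, hι.inducedI_inducedI hφ, map_neg, neg_neg, ← hν] at h2
    change η' u = (1 / 3 : ℝ) * ν (inducedI (fun y => ⇑(φ y)) ι n p u)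
    linear_combination (1 / 3 : ℝ) * h2
  · rintro rfl u
    exact (hη u).trans (hν u)

theorem IsHypersurface.exists_isAdapted (hι : IsHypersurface ι n) (hφ : IsG2Structure φ) (p : M) :
    ∃ e f, IsAdapted φ ι n p e f := by
  obtain ⟨e, f, h1, h2, h3⟩ := hι.exists_adaptedFrame hφ p
  exact ⟨e, f, h1, h2, h3⟩

/-- The terms B(·, I·) have no trace, and 12h = 2 Tr B compensates the trace of B. What remains is
to undo a rotation by θ, with sin² + cos² = 1. -/
theorem IsAdapted.traces (h : IsAdapted φ ι n p e f) (hι : IsHypersurface ι n)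
    (hφ : IsG2Structure φ) (θ : M → ℝ) :
    pdStar (fun y => ⇑(φ y)) (ι p) (n p) =
        -2 * Real.cos (θ p) * bilinTrace (fun X Y => rMap hφ hι θ p X Y) -
        2 * Real.sin (θ p) * bilinContract (kahler (inducedI (fun y => ⇑(φ y)) ι n) p)
          (fun X Y => rMap hφ hι θ p X Y) + 12 * scalarMeanCurvature ι n p ∧
    bilinTrace (pullR (fun y => ⇑(φ y)) ι p) =
      -Real.sin (θ p) * bilinTrace (fun X Y => rMap hφ hι θ p X Y) +
        Real.cos (θ p) * bilinContract (kahler (inducedI (fun y => ⇑(φ y)) ι n) p)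
          (fun X Y => rMap hφ hι θ p X Y) := by
  have hR : bilinTrace (pullR (fun y => ⇑(φ y)) ι p) = ∑ i, rG2Map hφ (ι p)
      (push ι p (onb (TangentSpace (𝓡 6) p) i)) (push ι p (onb (TangentSpace (𝓡 6) p) i)) := rfl
  have hS := h.sum_secondFundMap_inducedI hι
  have hS' := h.pdStar_normal hι hφ
  have h0 := Real.sin_sq_add_cos_sq (θ p)
  rw [bilinContract_kahler, bilinTrace, hι.scalarMeanCurvature_eq, hR]
  simp only [rMap_apply, hι.inducedI_inducedI hφ, map_neg]
  simp only [Finset.sum_add_distrib, Finset.sum_sub_distrib, ← Finset.mul_sum,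
    Finset.sum_neg_distrib]
  rw [hS, hS']
  constructor
  · linear_combination (-2 * ∑ i, rG2Map hφ (ι p) (push ι p (onb (TangentSpace (𝓡 6) p) i))
      (push ι p (inducedI (fun y => ⇑(φ y)) ι n p (onb (TangentSpace (𝓡 6) p) i))) -
      2 * ∑ i, hι.secondFundMap p (onb (TangentSpace (𝓡 6) p) i)
        (onb (TangentSpace (𝓡 6) p) i)) * (-h0)
  · linear_combination (∑ i, rG2Map hφ (ι p) (push ι p (onb (TangentSpace (𝓡 6) p) i))
      (push ι p (onb (TangentSpace (𝓡 6) p) i))) * (-h0)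

end Parallel

end G2Hypersurface

theorem proposition4p2
    {N : Type*} [TopologicalSpace N] [ChartedSpace (EuclideanSpace ℝ (Fin 7)) N]
    [IsManifold (𝓡 7) ∞ N]
    [RiemannianBundle (fun x : N => TangentSpace (𝓡 7) x)]
    [IsContMDiffRiemannianBundle (𝓡 7) ∞ (EuclideanSpace ℝ (Fin 7))
      (fun x : N => TangentSpace (𝓡 7) x)]
    {M : Type*} [TopologicalSpace M] [ChartedSpace (EuclideanSpace ℝ (Fin 6)) M]
    [IsManifold (𝓡 6) ∞ M]
    [RiemannianBundle (fun x : M => TangentSpace (𝓡 6) x)]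
    [IsContMDiffRiemannianBundle (𝓡 6) ∞ (EuclideanSpace ℝ (Fin 6))
      (fun x : M => TangentSpace (𝓡 6) x)]
    (φ : ∀ x : N, (TangentSpace (𝓡 7) x) [⋀^Fin 3]→ₗ[ℝ] ℝ) (hφ : IsG2Structure φ)
    (ι : M → N) (n : ∀ x : M, TangentSpace (𝓡 7) (ι x)) (hι : IsHypersurface ι n)
    (θ : M → ℝ) (hθ : ContMDiff (𝓡 6) 𝓘(ℝ, ℝ) ∞ θ) (x : M) :
    let Φ : CovTensor 7 N 3 := fun y => ⇑(φ y)
    let I := inducedI Φ ι n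
    let κ := kahler I
    let ψp := psiPlus Φ ι n θ
    let ψm := psiMinus Φ ι n θ
    let r := rSU3 κ ψp x
    let rbar := rG2 Φ (ι x)
    let B := scalarSecondFund ι n x
    let h := scalarMeanCurvature ι n x
    -- the formula for `r(ω)`, where `ω` is the Kähler form `κ`
    (∀ X Y : TangentSpace (𝓡 6) x,
      r X Y = Real.cos (θ x) * (-twist₂ (I x) (pullR Φ ι x) X Y + B X Y)
        - Real.sin (θ x) * (pullR Φ ι x X Y + twist₂ (I x) B X Y)) ∧
    -- the formula for `I d*ω`
    (∀ X : TangentSpace (𝓡 6) x,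
      2 * twist₁ (I x) (coderiv₂ κ x) X = pdStar Φ (ι x) (push ι x X)
        - 2 * rbar (n x) (push ι x (I x X)) + 2 * rbar (push ι x (I x X)) (n x)) ∧
    -- the formula for `p d*φ(n)`
    pdStar Φ (ι x) (n x) = -2 * Real.cos (θ x) * bilinTrace r
        - 2 * Real.sin (θ x) * bilinContract (κ x) r + 12 * h ∧
    -- the formula for `Tr(ι^* r̄(φ))`
    bilinTrace (pullR Φ ι x) = -Real.sin (θ x) * bilinTrace r
        + Real.cos (θ x) * bilinContract (κ x) r ∧
    -- the one-form `η` of the `W₅`-part of the torsion, and the formula for it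
    (∃ η : TangentSpace (𝓡 6) x →ₗ[ℝ] ℝ,
      (∀ η' : TangentSpace (𝓡 6) x →ₗ[ℝ] ℝ, IsW5Torsion I ψp ψm x η' ↔ η' = η) ∧
      ∀ X : TangentSpace (𝓡 6) x,
        3 * twist₁ (I x) η X = mvfderiv (𝓡 6) θ x X - rbar (push ι x X) (n x)) := by
  intro Φ I κ ψp ψm r rbar B h
  obtain ⟨e, f, he⟩ := hι.exists_isAdapted hφ x
  -- With r(ω) identified as an explicit bilinear map, the trace formulas are linear algebra at the
  -- point.
  have hr : r = fun X Y => rMap hφ hι θ x X Y := by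
    funext X Y
    exact he.rSU3_eq hι hφ θ X Y
  have ht := he.traces hι hφ θ
  refine ⟨fun X Y => ?_, he.coderiv_eq hι hφ, ?_, ?_,
    he.exists_isW5Torsion hι hφ ((hθ x).mdifferentiableAt (by simp))⟩
  · rw [hr]
    change rMap hφ hι θ x X Y = Real.cos (θ x) * (- -rG2Map hφ (ι x) (push ι x X)
      (push ι x (inducedI (fun y => ⇑(φ y)) ι n x Y)) + hι.secondFundMap x X Y) -
      Real.sin (θ x) * (rG2Map hφ (ι x) (push ι x X) (push ι x Y) +
        -hι.secondFundMap x X (inducedI (fun y => ⇑(φ y)) ι n x Y))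
    rw [rMap_apply]
    ring
  · rw [hr]
    exact ht.1
  · rw [hr]
    exact ht.2
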